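/- Let $G=(V,E)$ be a finite, non-empty, connected simple graph, and let each edge $e\in E$ have a length $L_e>0$ and be identified with the interval $[0,L_e]$ (its two end points being the vertices that $e$ joins). Let $V_0\subseteq V$ be a non-empty set of outer vertices; the vertices in $V\setminus V_0$ are called inner vertices. Write $L^2(G)=\bigoplus_{e}L^2([0,L_e])$ (complex-valued functions), and let $\Delta_{\max}(f_e)_e=(f_e'')_e$ on the space of all $f=(f_e)_e$ with $f_e\in H^2([0,L_e])$ that are continuous across the vertices. For such $f$ let $(\nu f)(v)$ be the outer normal derivative at $v\in V$, that is, the sum over the edges $e$ at $v$ of the derivative of $f_e$ at $v$ in the direction out of the edge. Let $\Delta_{V_0}$ be the restriction of $\Delta_{\max}$ to those $f$ with $f=0$ on $V_0$ and $\nu f=0$ on $V\setminus V_0$, let $\sigma(-\Delta_{V_0})$ be the spectrum of $-\Delta_{V_0}$ in $L^2(G)$, and let $\lambda_1(-\Delta_{V_0})=\min\sigma(-\Delta_{V_0})$ (to be read as $+\infty$ if $G$ has no edges). For $\lambda\in\mathbb R\setminus\sigma(-\Delta_{V_0})$ the Dirichlet-to-Neumann operator $D_{\lambda,V_0}\colon\mathbb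 C^{V_0}\to\mathbb C^{V_0}$ maps $x$ to $(\nu f)|_{V_0}$, where $f$ is the unique solution of $\Delta_{\max}f+\lambda f=0$, $f|_{V_0}=x$, $(\nu f)|_{V\setminus V_0}=0$; it is identified with its matrix. The semigroup $(e^{-tD_{\lambda,V_0}})_{t\ge 0}$ is called *positive* if all entries of $e^{-tD_{\lambda,V_0}}$ are $\ge 0$ for all $t\ge 0$, *strongly positive* if they are all $>0$ for all $t>0$, and *eventually positive* (*eventually strongly positive*) if there is $t_0>0$ such that they are all $\ge 0$ (all $>0$) for all $t\ge t_0$. The reduced graph $G_0$ is the simple graph with vertex set $V_0$ in which two distinct vertices are adjacent if $G$ has an edge between them or a path between them all of whose intermediate vertices are inner vertices. **Theorem 1.3.** (i) If $\lambda<\lambda_1(-\Delta_{V_0})$, then $(e^{-tD_{\lambda,V_0}})_{t\ge0}$ is strongly positive. (ii) If $G_0$ is a tree, then for every $\lambda\in\mathbb R\setminus\sigma(-\Delta_{V_0})$ the semigroup $(e^{-tD_{\lambda,V_0}})_{t\ge0}$ is either positive or not eventually strongly positive. Suppose in addition that the family $(L_e)_{e\in E}$ is linearly independent over $\mathbb Q$.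 Then: (iii) For every $\hat\lambda\in\mathbb R$ there is $\lambda\in\mathbb R\setminus\sigma(-\Delta_{V_0})$ with $\lambda>\hat\lambda$ such that $(e^{-tD_{\lambda,V_0}})_{t\ge0}$ is strongly positive. (iv) If $|V_0|\ge2$, then for every $\hat\lambda\in\mathbb R$ there is $\lambda\in\mathbb R\setminus\sigma(-\Delta_{V_0})$ with $\lambda>\hat\lambda$ such that $(e^{-tD_{\lambda,V_0}})_{t\ge0}$ is not eventually positive. (v) If $G_0$ contains a cycle, then for every $\hat\lambda\in\mathbb R$ there is $\lambda\in\mathbb R\setminus\sigma(-\Delta_{V_0})$ with $\lambda>\hat\lambda$ such that $(e^{-tD_{\lambda,V_0}})_{t\ge0}$ is eventually strongly positive but not positive. -/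

import Mathlib

open scoped ContDiff ComplexOrder

/-! ## Sobolev functions on an interval -/

/-- Lebesgue measure on the interval `[0, ℓ]`. -/
noncomputable abbrev intervalMeasure (ℓ : ℝ) : MeasureTheory.Measure ℝ :=
  MeasureTheory.volume.restrict (Set.Icc 0 ℓ)

/-- The complex Hilbert space `L²([0, ℓ])`. -/
abbrev IntervalL2 (ℓ : ℝ) : Type := MeasureTheory.Lp ℂ 2 (intervalMeasure ℓ)

/-- `v ∈ L²([0, ℓ])` is the weak derivative of `u ∈ L²([0, ℓ])`: integration by parts holds against
every smooth function with compact support in the open interval `(0, ℓ)`. -/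
def IsWeakDeriv {ℓ : ℝ} (u v : IntervalL2 ℓ) : Prop :=
  ∀ φ : ℝ → ℝ, ContDiff ℝ ∞ φ → HasCompactSupport φ → tsupport φ ⊆ Set.Ioo 0 ℓ →
    ∫ x, deriv φ x • u x ∂(intervalMeasure ℓ) = - ∫ x, φ x • v x ∂(intervalMeasure ℓ)

/-- Membership in the Sobolev space `H²([0, ℓ])`: the first and the second weak derivative exist
and belong to `L²([0, ℓ])`. -/
def MemH2 {ℓ : ℝ} (u : IntervalL2 ℓ) : Prop :=
  ∃ v w : IntervalL2 ℓ, IsWeakDeriv u v ∧ IsWeakDeriv v w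

/-- The weak derivative of `u` (it is unique; only used where it exists). -/
noncomputable def weakDeriv {ℓ : ℝ} (u : IntervalL2 ℓ) : IntervalL2 ℓ :=
  Classical.epsilon fun v => IsWeakDeriv u v

/-- `F` is a representative of the class `u` that is continuous on `[0, ℓ]`. -/
def IsContRep {ℓ : ℝ} (u : IntervalL2 ℓ) (F : ℝ → ℂ) : Prop :=
  ContinuousOn F (Set.Icc 0 ℓ) ∧ u =ᵐ[intervalMeasure ℓ] F

/-- The continuous representative of `u` (for `0 < ℓ` it is unique on `[0, ℓ]`; only used where it
exists, in particular for `u` with a weak derivative in `L²([0, ℓ])`). -/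
noncomputable def contRep {ℓ : ℝ} (u : IntervalL2 ℓ) : ℝ → ℂ :=
  Classical.epsilon fun F => IsContRep u F

/-! ## Quantum graphs -/

/-- A quantum graph with vertex set `V`: a simple graph together with a positive length for each
edge. The edge `e` is identified with the interval `[0, length e]`, the end point `0` being the
vertex `left e` and the end point `length e` the vertex `right e`. -/
structure QuantumGraph (V : Type*) where
  /-- the underlying simple graph -/
  graph : SimpleGraph V
  /-- the edge lengths -/
  length : graph.edgeSet → ℝ
  length_pos : ∀ e, 0 < length e
  /-- the vertex at the left end point of an edge -/
  left : graph.edgeSet → V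
  /-- the vertex at the right end point of an edge -/
  right : graph.edgeSet → V
  endpoints : ∀ e, s(left e, right e) = (e : Sym2 V)

namespace QuantumGraph

variable {V : Type*} [Fintype V] (G : QuantumGraph V)

/-- The edges of a quantum graph. -/
abbrev Edge {V : Type*} (G : QuantumGraph V) : Type _ := G.graph.edgeSet

noncomputable instance instFintypeEdge : Fintype G.Edge := Fintype.ofFinite _

/-- The Hilbert space `L²(G)`, the orthogonal sum of the spaces `L²([0, length e])`. -/
abbrev L2 : Type _ := PiLp 2 fun e : G.Edge => IntervalL2 (G.length e)

variable {G}

/-- `y` is the trace of `f`, the family of the values of `f` at the vertices: every `f e` is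
continuous on `[0, length e]` and takes at its end points the values that `y` prescribes.
The functions in `C(G)` are exactly those that possess a trace. -/
def IsTrace (f : G.L2) (y : V → ℂ) : Prop :=
  ∀ e : G.Edge, ∃ F : ℝ → ℂ, IsContRep (f e) F ∧ F 0 = y (G.left e) ∧ F (G.length e) = y (G.right e)

variable (G) in
/-- The domain `C(G) ∩ H²` (edgewise) of the maximal Laplace operator. -/
def maxDomain : Set G.L2 :=
  {f | (∀ e, MemH2 (f e)) ∧ ∃ y, IsTrace f y}

/-- The maximal Laplace operator `(f e) ↦ (f e)''` (only used on `maxDomain`). -/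
noncomputable def laplace (f : G.L2) : G.L2 :=
  WithLp.toLp 2 fun e => weakDeriv (weakDeriv (f e))

open Classical in
/-- The outer normal derivative of `f` at the vertex `v`. -/
noncomputable def normalDeriv (f : G.L2) (v : V) : ℂ :=
  - (∑ e : G.Edge with G.left e = v, contRep (weakDeriv (f e)) 0)
    + ∑ e : G.Edge with G.right e = v, contRep (weakDeriv (f e)) (G.length e)

variable (G)

/-- The domain of the Laplace operator `Δ_{Vo}` with Dirichlet conditions on the set `Vo` of outer
vertices and Kirchhoff conditions on the inner vertices. -/
def dirichletDomain (Vo : Finset V) : Set G.L2 :=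
  {f | f ∈ G.maxDomain ∧ (∃ y, IsTrace f y ∧ ∀ v ∈ Vo, y v = 0) ∧ ∀ v ∉ Vo, normalDeriv f v = 0}

/-- The resolvent set of the unbounded operator `-Δ_{Vo}` on `L²(G)`: those `z` for which
`z - (-Δ_{Vo})` maps its domain bijectively onto `L²(G)` with bounded inverse `R`. -/
def dirichletResolventSet (Vo : Finset V) : Set ℂ :=
  {z | ∃ R : G.L2 →L[ℂ] G.L2,
    (∀ g, R g ∈ G.dirichletDomain Vo ∧ z • R g + laplace (R g) = g) ∧
    ∀ f ∈ G.dirichletDomain Vo, R (z • f + laplace f) = f}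

/-- The spectrum `σ(-Δ_{Vo})`. -/
def dirichletSpectrum (Vo : Finset V) : Set ℂ := (G.dirichletResolventSet Vo)ᶜ

/-- `λ₁(-Δ_{Vo})`, the bottom of the (real) spectrum. It is an extended real number only in order
that the infimum of the empty set (a graph without edges) be `+∞`. -/
noncomputable def lambda1 (Vo : Finset V) : EReal :=
  ⨅ (μ : ℝ) (_ : (μ : ℂ) ∈ G.dirichletSpectrum Vo), (μ : EReal)

/-! ## The Dirichlet-to-Neumann operator -/

variable {G}

/-- `f` solves the boundary value problem `Δ_max f + lam f = 0` on `G`, `f = x` on the outer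
vertices, `ν f = 0` on the inner vertices. -/
def IsSolution (Vo : Finset V) (lam : ℝ) (x : Vo → ℂ) (f : G.L2) : Prop :=
  f ∈ G.maxDomain ∧ laplace f + (lam : ℂ) • f = 0 ∧
    (∃ y, IsTrace f y ∧ ∀ v : Vo, y v = x v) ∧ ∀ v ∉ Vo, normalDeriv f v = 0

variable (G)

/-- The Dirichlet-to-Neumann operator `x ↦ (ν f)|_{Vo}`, where `f` is the solution of the boundary
value problem with data `x` (which exists and is unique when `lam` is not in the spectrum of
`-Δ_{Vo}`). -/
noncomputable def dtnOperator (Vo : Finset V) (lam : ℝ) (x : Vo → ℂ) : Vo → ℂ :=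
  fun v => normalDeriv (Classical.epsilon fun f : G.L2 => IsSolution Vo lam x f) v

/-- The matrix of the Dirichlet-to-Neumann operator in the standard basis. -/
noncomputable def dtnMatrix [DecidableEq V] (Vo : Finset V) (lam : ℝ) : Matrix Vo Vo ℂ :=
  Matrix.of fun v w => G.dtnOperator Vo lam (Pi.single w 1) v

/-- The reduced graph: its vertices are the outer vertices, and two of them are adjacent if they are
joined by an edge or by a path all of whose intermediate vertices are inner vertices. -/
def reducedGraph {V : Type*} (G : QuantumGraph V) (Vo : Finset V) : SimpleGraph Vo where
  Adj v w := v ≠ w ∧ (G.graph.Adj v w ∨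
    ∃ p : G.graph.Walk v w, p.IsPath ∧ ∀ u ∈ p.support, u ≠ v → u ≠ w → u ∉ Vo)
  symm := ⟨by
    rintro v w ⟨hne, h⟩
    refine ⟨hne.symm, h.imp (fun h => h.symm) ?_⟩
    rintro ⟨p, hp, hs⟩
    exact ⟨p.reverse, hp.reverse, fun u hu h1 h2 => hs u (by simpa using hu) h2 h1⟩⟩
  loopless := ⟨fun v h => h.1 rfl⟩

end QuantumGraph

/-! ## Positivity of matrix semigroups

The order on `ℂ` is the usual partial one: `0 ≤ z` means that `z` is real and non-negative, and
`0 < z` that `z` is real and positive. -/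

section Semigroup

variable {ι : Type*} [Fintype ι] [DecidableEq ι]

/-- The operator `e^{-tD}` of the matrix semigroup generated by `-D`. -/
noncomputable def semigroup (D : Matrix ι ι ℂ) (t : ℝ) : Matrix ι ι ℂ :=
  NormedSpace.exp ((-t : ℂ) • D)

/-- The semigroup `(e^{-tD})` is positive. -/
def SemigroupPositive (D : Matrix ι ι ℂ) : Prop :=
  ∀ t : ℝ, 0 ≤ t → ∀ i j, 0 ≤ semigroup D t i j

/-- The semigroup `(e^{-tD})` is strongly positive. -/
def SemigroupStronglyPositive (D : Matrix ι ι ℂ) : Prop :=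
  ∀ t : ℝ, 0 < t → ∀ i j, 0 < semigroup D t i j

/-- The semigroup `(e^{-tD})` is eventually positive. -/
def SemigroupEventuallyPositive (D : Matrix ι ι ℂ) : Prop :=
  ∃ t₀ : ℝ, 0 < t₀ ∧ ∀ t : ℝ, t₀ ≤ t → ∀ i j, 0 ≤ semigroup D t i j

/-- The semigroup `(e^{-tD})` is eventually strongly positive. -/
def SemigroupEventuallyStronglyPositive (D : Matrix ι ι ℂ) : Prop :=
  ∃ t₀ : ℝ, 0 < t₀ ∧ ∀ t : ℝ, t₀ ≤ t → ∀ i j, 0 < semigroup D t i j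

end Semigroup

/-!
# Positivity of the semigroups of Dirichlet-to-Neumann operators on quantum graphs

On an edge of length `ℓ` the solutions of `u'' + lam u = 0` are spanned by the real functions
`cosSol lam` and `sinSol lam` (cosine and sine of frequency `√lam`, or their hyperbolic analogues),
so a solution on the graph is given by its values at the vertices and its slopes at the left ends of
the edges. The boundary value problem becomes a finite linear system; if `lam` is not in the
spectrum this system is uniquely solvable (`nonResonant_of_notMem_spectrum`), and conversely unique
solvability yields the resolvent by variation of constants (`notMem_spectrum_of_nonResonant`). If
moreover no `sin`-solution vanishes at the end of an edge, the slopes can be eliminated: with `C`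
and `S` the values of the two solutions at the end of the edge `e`, the fluxes are given by the
network matrix to which `e` contributes the block `!![C/S, -1/S; -1/S, C/S]`, and the
Dirichlet-to-Neumann matrix is its Schur complement on the outer vertices (`dtnMatrix_eq_schur`).
Everything is then a matter of real matrices.

* *Below the first eigenvalue.* The semigroup of a matrix with non-positive off-diagonal entries and
  connected pattern is strongly positive. A Schur complement inherits these properties when the
  inner block is positive definite. For `lam ≤ 0` definiteness is evident since `C ≥ 1`. It can only
  be lost where a resonance occurs, and the first zero of some `S` cannot be reached without a
  resonance (`stronglyPositive_of_lt_lambda1`).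
* *Trees.* The Dirichlet-to-Neumann matrix is real, symmetric and supported on the edges of the
  reduced graph. If this graph is a forest, conjugation by a diagonal matrix of signs makes the
  off-diagonal entries non-positive, so a positive off-diagonal entry forces an entry of the
  semigroup to be non-positive for all times (`positive_or_not_eventuallyStronglyPositive`).
* *Large spectral parameters.* For rationally independent lengths and `lam = k²`, Kronecker's
  theorem lets all pairs `(cot (k L_e), 1 / sin (k L_e))` approach, up to a common positive factor,
  any pairs `(w_e, w_e)` with `w_e ≠ 0`. So the Schur complement of every weighted graph Laplacian
  with non-zero weights of arbitrary sign and invertible inner block is approximated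
  (`exists_dtnMatrix_eq_smul_schur`), and stable properties can be read off from suitable weights.
  Weights `1` give strong positivity. With weights `-1` the semigroup runs backwards in time and is
  not eventually positive.
* *Cycles.* Here weights of mixed signs are chosen such that the Schur complement is still positive
  semidefinite with the constants as kernel, which makes the semigroup converge to a positive
  multiple of the all-ones matrix and hence eventually strongly positive, while some off-diagonal
  entry is positive. If an inner component is attached to three outer vertices, one negative weight
  close to a resonance suffices (`exists_eventuallyStronglyPositive_of_three`). Otherwise a small
  negative weight is put on an edge of the reduced graph that is not a bridge
  (`exists_eventuallyStronglyPositive_of_not_isBridge`).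
-/

open MeasureTheory

/-! ### Weak derivatives on an interval -/

/-- The relation `IsWeakDeriv` for functions instead of classes of functions. -/
def HasWeakDeriv (ℓ : ℝ) (f g : ℝ → ℂ) : Prop :=
  ∀ φ : ℝ → ℝ, ContDiff ℝ ∞ φ → HasCompactSupport φ → tsupport φ ⊆ Set.Ioo 0 ℓ →
    ∫ x, deriv φ x • f x ∂(intervalMeasure ℓ) = - ∫ x, φ x • g x ∂(intervalMeasure ℓ)

section WeakDeriv

variable {ℓ : ℝ} {f g f' g' : ℝ → ℂ}

theorem isWeakDeriv_iff {u v : IntervalL2 ℓ} : IsWeakDeriv u v ↔ HasWeakDeriv ℓ u v := Iff.rfl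

theorem HasWeakDeriv.congr (h : HasWeakDeriv ℓ f g) (hf : f =ᵐ[intervalMeasure ℓ] f')
    (hg : g =ᵐ[intervalMeasure ℓ] g') : HasWeakDeriv ℓ f' g' := by
  intro φ h1 h2 h3
  have e1 : ∫ x, deriv φ x • f' x ∂(intervalMeasure ℓ)
      = ∫ x, deriv φ x • f x ∂(intervalMeasure ℓ) :=
    integral_congr_ae (by filter_upwards [hf] with x hx; rw [hx])
  have e2 : ∫ x, φ x • g' x ∂(intervalMeasure ℓ)
      = ∫ x, φ x • g x ∂(intervalMeasure ℓ) :=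
    integral_congr_ae (by filter_upwards [hg] with x hx; rw [hx])
  rw [e1, e2]
  exact h φ h1 h2 h3

theorem integrable_smul_of_continuous {φ : ℝ → ℝ} (hφ : Continuous φ)
    (hf : Integrable f (intervalMeasure ℓ)) :
    Integrable (fun x => φ x • f x) (intervalMeasure ℓ) :=
  (show IntegrableOn f (Set.Icc 0 ℓ) volume from hf).continuousOn_smul hφ.continuousOn isCompact_Icc

theorem continuous_deriv_of_smooth {φ : ℝ → ℝ} (hφ : ContDiff ℝ ∞ φ) : Continuous (deriv φ) :=
  hφ.continuous_deriv (by simp)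

theorem HasWeakDeriv.add (h : HasWeakDeriv ℓ f g) (h' : HasWeakDeriv ℓ f' g')
    (hf : Integrable f (intervalMeasure ℓ)) (hg : Integrable g (intervalMeasure ℓ))
    (hf' : Integrable f' (intervalMeasure ℓ)) (hg' : Integrable g' (intervalMeasure ℓ)) :
    HasWeakDeriv ℓ (fun x => f x + f' x) (fun x => g x + g' x) := by
  intro φ h1 h2 h3
  have hd := continuous_deriv_of_smooth h1
  simp only [smul_add]
  rw [integral_add (integrable_smul_of_continuous hd hf) (integrable_smul_of_continuous hd hf'),
    integral_add (integrable_smul_of_continuous h1.continuous hg)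
      (integrable_smul_of_continuous h1.continuous hg'), h φ h1 h2 h3, h' φ h1 h2 h3]
  ring

theorem HasWeakDeriv.const_mul (h : HasWeakDeriv ℓ f g) (c : ℂ) :
    HasWeakDeriv ℓ (fun x => c * f x) (fun x => c * g x) := by
  intro φ h1 h2 h3
  have e : ∀ (r : ℝ) (z : ℂ), r • (c * z) = c * (r • z) := fun r z => by
    simp only [Complex.real_smul]; ring
  simp only [e]
  rw [integral_const_mul, integral_const_mul, h φ h1 h2 h3]
  ring

/-- The product rule for a weakly differentiable function and a smooth factor. -/
theorem HasWeakDeriv.smooth_mul (h : HasWeakDeriv ℓ f g) {c c' : ℝ → ℝ} (hc : ContDiff ℝ ∞ c)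
    (hc' : deriv c = c') (hf : Integrable f (intervalMeasure ℓ))
    (hg : Integrable g (intervalMeasure ℓ)) :
    HasWeakDeriv ℓ (fun x => (c x : ℂ) * f x) (fun x => (c' x : ℂ) * f x + (c x : ℂ) * g x) := by
  subst hc'
  intro φ h1 h2 h3
  have key := h (fun x => φ x * c x) (h1.mul hc) h2.mul_right
    ((tsupport_mul_subset_left).trans h3)
  have hd : ∀ x, deriv (fun x => φ x * c x) x = deriv φ x * c x + φ x * deriv c x := fun x =>
    deriv_fun_mul (h1.differentiable (by simp) x) (hc.differentiable (by simp) x)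
  have hcd := continuous_deriv_of_smooth hc
  have i1 : Integrable (fun x => (deriv φ x * c x) • f x) (intervalMeasure ℓ) :=
    integrable_smul_of_continuous ((continuous_deriv_of_smooth h1).mul hc.continuous) hf
  have i2 : Integrable (fun x => (φ x * deriv c x) • f x) (intervalMeasure ℓ) :=
    integrable_smul_of_continuous (h1.continuous.mul hcd) hf
  have i3 : Integrable (fun x => (φ x * c x) • g x) (intervalMeasure ℓ) :=
    integrable_smul_of_continuous (h1.continuous.mul hc.continuous) hg
  simp only [hd, add_smul] at key
  rw [integral_add i1 i2] at key
  have e1 : ∀ x, deriv φ x • ((c x : ℂ) * f x) = (deriv φ x * c x) • f x := fun x => by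
    simp only [Complex.real_smul]; push_cast; ring
  have e2 : ∀ x, φ x • (((deriv c x : ℝ) : ℂ) * f x + (c x : ℂ) * g x)
      = (φ x * deriv c x) • f x + (φ x * c x) • g x := fun x => by
    simp only [Complex.real_smul]; push_cast; ring
  simp only [e1, e2]
  rw [integral_add i2 i3]
  linear_combination key

theorem integral_deriv_Icc_of_tsupport {φ : ℝ → ℝ} (h1 : ContDiff ℝ ∞ φ)
    (h3 : tsupport φ ⊆ Set.Ioo 0 ℓ) (s : ℝ) :
    ∫ x in s..ℓ, deriv φ x = - φ s := by
  rw [intervalIntegral.integral_deriv_eq_sub (fun x _ => h1.differentiable (by simp) x)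
    ((continuous_deriv_of_smooth h1).intervalIntegrable _ _)]
  have : φ ℓ = 0 := image_eq_zero_of_notMem_tsupport fun h => (h3 h).2.ne rfl
  rw [this, zero_sub]

/-- A primitive of an integrable function has that function as its weak derivative. -/
theorem hasWeakDeriv_primitive (hg : Integrable g (intervalMeasure ℓ)) :
    HasWeakDeriv ℓ (fun x => ∫ s in (0 : ℝ)..x, g s) g := by
  intro φ h1 h2 h3
  have hd := continuous_deriv_of_smooth h1
  let F : ℝ → ℝ → ℂ := fun x s => if s ≤ x then deriv φ x • g s else 0
  have hmeas : MeasurableSet {p : ℝ × ℝ | p.2 ≤ p.1} :=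
    measurableSet_le measurable_snd measurable_fst
  have hFint : Integrable (Function.uncurry F) ((intervalMeasure ℓ).prod (intervalMeasure ℓ)) := by
    have hdi : Integrable (fun x => ((deriv φ x : ℝ) : ℂ)) (intervalMeasure ℓ) :=
      (show Continuous fun x => ((deriv φ x : ℝ) : ℂ) from
        Complex.continuous_ofReal.comp hd).continuousOn.integrableOn_Icc
    have := (hdi.mul_prod hg).indicator hmeas
    refine this.congr (Filter.Eventually.of_forall fun p => ?_)
    by_cases hp : p.2 ≤ p.1
    · simp [F, Set.indicator, hp, Function.uncurry]
    · simp [F, Set.indicator, hp, Function.uncurry]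
  have e1 : ∫ x, deriv φ x • (∫ s in (0 : ℝ)..x, g s) ∂(intervalMeasure ℓ)
      = ∫ x, ∫ s, F x s ∂(intervalMeasure ℓ) ∂(intervalMeasure ℓ) := by
    refine setIntegral_congr_fun measurableSet_Icc fun x hx => ?_
    have : (fun s => F x s) = Set.indicator (Set.Iic x) (fun s => deriv φ x • g s) := by
      ext s; simp [F, Set.indicator]
    simp only [this]
    rw [integral_indicator measurableSet_Iic, Measure.restrict_restrict measurableSet_Iic,
      integral_smul, intervalIntegral.integral_of_le hx.1, ← integral_Icc_eq_integral_Ioc]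
    congr 3
    ext s; simp only [Set.mem_inter_iff, Set.mem_Iic, Set.mem_Icc]
    constructor
    · rintro ⟨a, b⟩; exact ⟨b, a, b.trans hx.2⟩
    · rintro ⟨a, b, _⟩; exact ⟨b, a⟩
  have e2 : ∫ s, ∫ x, F x s ∂(intervalMeasure ℓ) ∂(intervalMeasure ℓ)
      = ∫ s, -(φ s • g s) ∂(intervalMeasure ℓ) := by
    refine setIntegral_congr_fun measurableSet_Icc fun s hs => ?_
    have : (fun x => F x s) = Set.indicator (Set.Ici s) (fun x => deriv φ x • g s) := by
      ext x; simp [F, Set.indicator]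
    simp only [this]
    rw [integral_indicator measurableSet_Ici, Measure.restrict_restrict measurableSet_Ici,
      integral_smul_const]
    have hI : Set.Ici s ∩ Set.Icc 0 ℓ = Set.Icc s ℓ := by
      ext x; simp only [Set.mem_inter_iff, Set.mem_Ici, Set.mem_Icc]
      constructor
      · rintro ⟨a, b, c⟩; exact ⟨a, c⟩
      · rintro ⟨a, c⟩; exact ⟨a, hs.1.trans a, c⟩
    rw [hI, integral_Icc_eq_integral_Ioc, ← intervalIntegral.integral_of_le hs.2,
      integral_deriv_Icc_of_tsupport h1 h3, neg_smul]
  rw [e1, integral_integral_swap hFint, e2, integral_neg]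

theorem hasWeakDeriv_const (c : ℂ) : HasWeakDeriv ℓ (fun _ => c) (fun _ => 0) := by
  intro φ h1 h2 h3
  rcases le_or_gt 0 ℓ with hℓ | hℓ
  · simp only [smul_zero, integral_zero, neg_zero]
    rw [integral_smul_const, integral_Icc_eq_integral_Ioc, ← intervalIntegral.integral_of_le hℓ,
      integral_deriv_Icc_of_tsupport h1 h3]
    have : φ 0 = 0 := image_eq_zero_of_notMem_tsupport fun h => (h3 h).1.ne rfl
    simp [this]
  · simp [intervalMeasure, Set.Icc_eq_empty_of_lt hℓ]

theorem ae_intervalMeasure_of_Ioo {p : ℝ → Prop} (h : ∀ᵐ x, x ∈ Set.Ioo 0 ℓ → p x) :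
    ∀ᵐ x ∂(intervalMeasure ℓ), p x := by
  have : intervalMeasure ℓ = volume.restrict (Set.Ioo 0 ℓ) :=
    (Measure.restrict_congr_set Ioo_ae_eq_Icc).symm
  rw [this]
  exact (ae_restrict_iff' measurableSet_Ioo).2 h

theorem setIntegral_smul_eq_integral {φ : ℝ → ℝ} (h3 : tsupport φ ⊆ Set.Ioo 0 ℓ) (f : ℝ → ℂ) :
    ∫ x, φ x • f x ∂(intervalMeasure ℓ) = ∫ x, φ x • f x := by
  refine setIntegral_eq_integral_of_forall_compl_eq_zero fun x hx => ?_
  rw [image_eq_zero_of_notMem_tsupport fun h => hx (Set.Ioo_subset_Icc_self (h3 h)), zero_smul]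

/-- A function annihilated by all test functions vanishes almost everywhere. -/
theorem ae_eq_zero_of_test (hf : Integrable f (intervalMeasure ℓ))
    (h : ∀ φ : ℝ → ℝ, ContDiff ℝ ∞ φ → HasCompactSupport φ → tsupport φ ⊆ Set.Ioo 0 ℓ →
      ∫ x, φ x • f x ∂(intervalMeasure ℓ) = 0) :
    ∀ᵐ x ∂(intervalMeasure ℓ), f x = 0 := by
  refine ae_intervalMeasure_of_Ioo ?_
  refine isOpen_Ioo.ae_eq_zero_of_integral_contDiff_smul_eq_zero ?_ ?_
  · exact ((show IntegrableOn f (Set.Icc 0 ℓ) volume from hf).mono_set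
      Set.Ioo_subset_Icc_self).locallyIntegrableOn
  · intro φ h1 h2 h3
    rw [← setIntegral_smul_eq_integral h3]
    exact h φ h1 h2 h3

theorem HasWeakDeriv.unique (h : HasWeakDeriv ℓ f g) (h' : HasWeakDeriv ℓ f g')
    (hg : Integrable g (intervalMeasure ℓ)) (hg' : Integrable g' (intervalMeasure ℓ)) :
    g =ᵐ[intervalMeasure ℓ] g' := by
  have := ae_eq_zero_of_test (f := fun x => g x - g' x) (hg.sub hg') ?_
  · filter_upwards [this] with x hx using sub_eq_zero.1 hx
  · intro φ h1 h2 h3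
    simp only [smul_sub]
    rw [integral_sub (integrable_smul_of_continuous h1.continuous hg)
      (integrable_smul_of_continuous h1.continuous hg'), sub_eq_zero]
    exact neg_injective ((h φ h1 h2 h3).symm.trans (h' φ h1 h2 h3))

/-- A test function of integral zero is the derivative of a test function. -/
theorem exists_test_primitive {χ : ℝ → ℝ} (h1 : ContDiff ℝ ∞ χ)
    (h2 : HasCompactSupport χ) (h3 : tsupport χ ⊆ Set.Ioo 0 ℓ) (h0 : ∫ x, χ x = 0) :
    ∃ φ : ℝ → ℝ, ContDiff ℝ ∞ φ ∧ HasCompactSupport φ ∧ tsupport φ ⊆ Set.Ioo 0 ℓ ∧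
      deriv φ = χ := by
  have hder : ∀ x, HasDerivAt (fun x => ∫ s in (0 : ℝ)..x, χ s) (χ x) x := fun x =>
    intervalIntegral.integral_hasDerivAt_right (h1.continuous.intervalIntegrable _ _)
      (h1.continuous.stronglyMeasurableAtFilter _ _) h1.continuous.continuousAt
  have hd : deriv (fun x => ∫ s in (0 : ℝ)..x, χ s) = χ := funext fun x => (hder x).deriv
  -- the support of `χ` lies in a compact subinterval `[a, b]` of `(0, ℓ)`
  obtain ⟨a, b, ha, hb, hab⟩ : ∃ a b, 0 < a ∧ b < ℓ ∧ tsupport χ ⊆ Set.Icc a b := by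
    rcases (tsupport χ).eq_empty_or_nonempty with he | hne
    · exact ⟨1, ℓ - 1, one_pos, by linarith, by simp [he]⟩
    · have hK : IsCompact (tsupport χ) := h2
      refine ⟨sInf (tsupport χ), sSup (tsupport χ), (h3 (hK.sInf_mem hne)).1,
        (h3 (hK.sSup_mem hne)).2, fun x hx => ⟨csInf_le hK.bddBelow hx, le_csSup hK.bddAbove hx⟩⟩
  have hzero : ∀ x, x ∉ Set.Icc a b → χ x = 0 := fun x hx =>
    image_eq_zero_of_notMem_tsupport fun h => hx (hab h)
  have hsup : tsupport (fun x => ∫ s in (0 : ℝ)..x, χ s) ⊆ Set.Icc a b := by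
    refine closure_minimal (fun x hx => ?_) isClosed_Icc
    by_contra hxI
    apply hx
    show ∫ s in (0 : ℝ)..x, χ s = 0
    rcases lt_or_ge x a with hxa | hxa
    · refine intervalIntegral.integral_zero_ae (Filter.Eventually.of_forall fun s hs => hzero s ?_)
      rintro ⟨h, -⟩
      rcases Set.mem_uIoc.1 hs with ⟨_, h'⟩ | ⟨_, h'⟩ <;> linarith
    · have hxb : b < x := by
        by_contra h; exact hxI ⟨hxa, not_lt.1 h⟩
      have ht : tsupport χ ⊆ Set.Ioc 0 x := fun s hs =>
        ⟨ha.trans_le (hab hs).1, (hab hs).2.trans hxb.le⟩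
      rw [intervalIntegral.integral_eq_integral_of_support_subset
        ((subset_tsupport χ).trans ht), h0]
  exact ⟨_, contDiff_infty_iff_deriv.2 ⟨fun x => (hder x).differentiableAt, hd.symm ▸ h1⟩,
    HasCompactSupport.of_support_subset_isCompact isCompact_Icc
      ((subset_tsupport _).trans hsup), hsup.trans fun x hx =>
        ⟨ha.trans_le hx.1, hx.2.trans_lt hb⟩, hd⟩

/-- The lemma of du Bois-Reymond. -/
theorem HasWeakDeriv.ae_const (hℓ : 0 < ℓ) (h : HasWeakDeriv ℓ f (fun _ => 0))
    (hf : Integrable f (intervalMeasure ℓ)) : ∃ c : ℂ, f =ᵐ[intervalMeasure ℓ] fun _ => c := by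
  let B : ContDiffBump (ℓ / 2) := ⟨ℓ / 4, ℓ / 3, by linarith, by linarith⟩
  let η : ℝ → ℝ := B.normed volume
  have η1 : ContDiff ℝ ∞ η := B.contDiff_normed
  have η2 : HasCompactSupport η := B.hasCompactSupport_normed
  have η3 : tsupport η ⊆ Set.Ioo 0 ℓ := by
    show tsupport (B.normed volume) ⊆ _
    rw [B.tsupport_normed_eq, Real.closedBall_eq_Icc]
    exact fun x hx => ⟨by have := hx.1; simp only [B] at this; linarith,
      by have := hx.2; simp only [B] at this; linarith⟩
  have η4 : ∫ x, η x = 1 := B.integral_normed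
  refine ⟨∫ x, η x • f x ∂(intervalMeasure ℓ), ?_⟩
  set c := ∫ x, η x • f x ∂(intervalMeasure ℓ) with hc
  have := ae_eq_zero_of_test (f := fun x => f x - c) (hf.sub (integrable_const c)) ?_
  · filter_upwards [this] with x hx using sub_eq_zero.1 hx
  intro ψ h1 h2 h3
  -- subtract a multiple of `η` to obtain a test function of integral zero
  set m := ∫ x, ψ x with hm
  obtain ⟨φ, p1, p2, p3, p4⟩ := exists_test_primitive (χ := fun x => ψ x - m * η x) (ℓ := ℓ)
    (h1.sub (contDiff_const.mul η1)) (h2.sub η2.mul_left)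
    ((tsupport_sub _ _).trans (Set.union_subset h3 ((tsupport_mul_subset_right).trans η3))) (by
      rw [integral_sub (h1.continuous.integrable_of_hasCompactSupport h2)
        ((η1.continuous.integrable_of_hasCompactSupport η2).const_mul m), integral_const_mul, η4,
        ← hm]
      ring)
  have key := h φ p1 p2 p3
  rw [p4] at key
  simp only [smul_zero, integral_zero, neg_zero, sub_smul, mul_smul] at key
  have i2 : Integrable (fun x => m • η x • f x) (intervalMeasure ℓ) :=
    (integrable_smul_of_continuous η1.continuous hf).smul m
  rw [integral_sub (integrable_smul_of_continuous h1.continuous hf) i2, integral_smul, ← hc] at key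
  simp only [smul_sub]
  rw [integral_sub (integrable_smul_of_continuous h1.continuous hf)
    (integrable_smul_of_continuous h1.continuous (integrable_const c)),
    setIntegral_smul_eq_integral h3 (fun _ => c), integral_smul_const, ← hm]
  exact key

theorem integrable_coe (u : IntervalL2 ℓ) : Integrable u (intervalMeasure ℓ) :=
  (Lp.memLp u).integrable (by norm_num)

theorem weakDeriv_eq {u v : IntervalL2 ℓ} (h : IsWeakDeriv u v) : weakDeriv u = v := by
  have h' : IsWeakDeriv u (weakDeriv u) := Classical.epsilon_spec ⟨v, h⟩
  exact Lp.ext (HasWeakDeriv.unique h' h (integrable_coe _) (integrable_coe _))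

theorem contRep_eqOn (hℓ : 0 < ℓ) {u : IntervalL2 ℓ} {F : ℝ → ℂ} (h : IsContRep u F) :
    Set.EqOn (contRep u) F (Set.Icc 0 ℓ) := by
  have h' : IsContRep u (contRep u) := Classical.epsilon_spec ⟨F, h⟩
  exact Measure.eqOn_Icc_of_ae_eq volume hℓ.ne (h'.2.symm.trans h.2) h'.1 h.1

theorem IsContRep.eqOn (hℓ : 0 < ℓ) {u : IntervalL2 ℓ} {F F' : ℝ → ℂ} (h : IsContRep u F)
    (h' : IsContRep u F') : Set.EqOn F F' (Set.Icc 0 ℓ) :=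
  Measure.eqOn_Icc_of_ae_eq volume hℓ.ne (h.2.symm.trans h'.2) h.1 h'.1

theorem continuousOn_primitive_of_integrable (hℓ : 0 ≤ ℓ)
    (hg : Integrable g (intervalMeasure ℓ)) :
    ContinuousOn (fun x => ∫ s in (0 : ℝ)..x, g s) (Set.Icc 0 ℓ) := by
  have := intervalIntegral.continuousOn_primitive_interval (μ := volume) (f := g) (a := 0) (b := ℓ)
    (by rw [Set.uIcc_of_le hℓ]; exact hg)
  rwa [Set.uIcc_of_le hℓ] at this

/-- A weakly differentiable class has a continuous representative. -/
theorem IsWeakDeriv.isContRep (hℓ : 0 < ℓ) {u v : IntervalL2 ℓ} (h : IsWeakDeriv u v) :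
    IsContRep u (contRep u) := by
  have hP := continuousOn_primitive_of_integrable hℓ.le (integrable_coe v)
  have hPi : Integrable (fun x => ∫ s in (0 : ℝ)..x, v s) (intervalMeasure ℓ) :=
    hP.integrableOn_Icc
  have h1 : HasWeakDeriv ℓ (fun x => u x + (-1) * ∫ s in (0 : ℝ)..x, v s) (fun _ => 0) :=
    ((isWeakDeriv_iff.1 h).add ((hasWeakDeriv_primitive (integrable_coe v)).const_mul (-1))
      (integrable_coe u) (integrable_coe v) (hPi.const_mul _)
      ((integrable_coe v).const_mul _)).congr (by rfl)
      (Filter.Eventually.of_forall fun x => by simp)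
  obtain ⟨c, hc⟩ := h1.ae_const hℓ ((integrable_coe u).add (hPi.const_mul _))
  refine Classical.epsilon_spec (p := fun F => IsContRep u F)
    ⟨fun x => c + ∫ s in (0 : ℝ)..x, v s, continuousOn_const.add hP, ?_⟩
  filter_upwards [hc] with x hx
  rw [← hx]; ring

theorem memLp_of_continuousOn {F : ℝ → ℂ} (hF : ContinuousOn F (Set.Icc 0 ℓ)) :
    MemLp F 2 (intervalMeasure ℓ) := by
  obtain ⟨C, hC⟩ := isCompact_Icc.exists_bound_of_continuousOn hF
  exact MemLp.of_bound (hF.aestronglyMeasurable measurableSet_Icc) C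
    ((ae_restrict_iff' measurableSet_Icc).2 (Filter.Eventually.of_forall hC))

end WeakDeriv

/-! ### The equation `u'' + λu = 0` on an interval -/

/-- The solution of `u'' + lam u = 0` with `u(0) = 1` and `u'(0) = 0`. As `√` vanishes on negative
numbers, this is `cos (√lam x)` for `0 ≤ lam` and `cosh (√(-lam) x)` for `lam ≤ 0`; the product
makes the continuity in `lam` evident. -/
noncomputable def cosSol (lam x : ℝ) : ℝ := Real.cos (√lam * x) * Real.cosh (√(-lam) * x)

/-- The solution of `u'' + lam u = 0` with `u(0) = 0` and `u'(0) = 1`. -/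
noncomputable def sinSol (lam x : ℝ) : ℝ := ∫ t in (0 : ℝ)..x, cosSol lam t

section ODE

variable (lam : ℝ)

theorem continuous_cosSol_uncurry : Continuous fun p : ℝ × ℝ => cosSol p.1 p.2 := by
  unfold cosSol; fun_prop

theorem continuous_cosSol : Continuous (cosSol lam) := by
  unfold cosSol; fun_prop

theorem continuous_cosSol_left (x : ℝ) : Continuous fun l => cosSol l x := by
  unfold cosSol; fun_prop

theorem continuous_sinSol_left (x : ℝ) : Continuous fun l => sinSol l x :=
  intervalIntegral.continuous_parametric_intervalIntegral_of_continuous'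
    continuous_cosSol_uncurry 0 x

@[simp] theorem cosSol_zero : cosSol lam 0 = 1 := by simp [cosSol]

@[simp] theorem sinSol_zero : sinSol lam 0 = 0 := by simp [sinSol]

theorem hasDerivAt_sinSol (x : ℝ) : HasDerivAt (sinSol lam) (cosSol lam x) x :=
  intervalIntegral.integral_hasDerivAt_right ((continuous_cosSol lam).intervalIntegrable _ _)
    ((continuous_cosSol lam).stronglyMeasurableAtFilter _ _) (continuous_cosSol lam).continuousAt

variable {lam}

theorem cosSol_of_nonneg (h : 0 ≤ lam) (x : ℝ) : cosSol lam x = Real.cos (√lam * x) := by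
  simp [cosSol, Real.sqrt_eq_zero_of_nonpos (neg_nonpos.2 h)]

theorem cosSol_of_nonpos (h : lam ≤ 0) (x : ℝ) : cosSol lam x = Real.cosh (√(-lam) * x) := by
  simp [cosSol, Real.sqrt_eq_zero_of_nonpos h]

theorem sqrt_mul_sinSol (h : 0 ≤ lam) (x : ℝ) : √lam * sinSol lam x = Real.sin (√lam * x) := by
  have hd : ∀ t : ℝ, HasDerivAt (fun t => Real.sin (√lam * t)) (√lam * cosSol lam t) t := fun t => by
    rw [cosSol_of_nonneg h]
    simpa [mul_comm] using ((hasDerivAt_id t).const_mul (√lam)).sin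
  have := intervalIntegral.integral_eq_sub_of_hasDerivAt (a := 0) (b := x) (fun t _ => hd t)
    (((continuous_cosSol lam).const_mul _).intervalIntegrable _ _)
  rw [intervalIntegral.integral_const_mul] at this
  simpa [sinSol] using this

theorem sqrt_neg_mul_sinSol (h : lam ≤ 0) (x : ℝ) :
    √(-lam) * sinSol lam x = Real.sinh (√(-lam) * x) := by
  have hd : ∀ t : ℝ, HasDerivAt (fun t => Real.sinh (√(-lam) * t)) (√(-lam) * cosSol lam t) t :=
    fun t => by
      rw [cosSol_of_nonpos h]
      simpa [mul_comm] using ((hasDerivAt_id t).const_mul (√(-lam))).sinh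
  have := intervalIntegral.integral_eq_sub_of_hasDerivAt (a := 0) (b := x) (fun t _ => hd t)
    (((continuous_cosSol lam).const_mul _).intervalIntegrable _ _)
  rw [intervalIntegral.integral_const_mul] at this
  simpa [sinSol] using this

variable (lam)

theorem hasDerivAt_cosSol (x : ℝ) : HasDerivAt (cosSol lam) (-lam * sinSol lam x) x := by
  rcases le_total 0 lam with h | h
  · have e : cosSol lam = fun t => Real.cos (√lam * t) := funext (cosSol_of_nonneg h)
    have h2 : -lam * sinSol lam x = -Real.sin (√lam * x) * √lam := by
      rw [← sqrt_mul_sinSol h]; linear_combination sinSol lam x * Real.mul_self_sqrt h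
    rw [e, h2]
    simpa using ((hasDerivAt_id x).const_mul (√lam)).cos
  · have e : cosSol lam = fun t => Real.cosh (√(-lam) * t) := funext (cosSol_of_nonpos h)
    have h2 : -lam * sinSol lam x = Real.sinh (√(-lam) * x) * √(-lam) := by
      rw [← sqrt_neg_mul_sinSol h]
      linear_combination -sinSol lam x * Real.mul_self_sqrt (neg_nonneg.2 h)
    rw [e, h2]
    simpa using ((hasDerivAt_id x).const_mul (√(-lam))).cosh

theorem continuous_sinSol : Continuous (sinSol lam) :=
  continuous_iff_continuousAt.2 fun x => (hasDerivAt_sinSol lam x).continuousAt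

theorem deriv_cosSol : deriv (cosSol lam) = fun x => -lam * sinSol lam x :=
  funext fun x => (hasDerivAt_cosSol lam x).deriv

theorem deriv_sinSol : deriv (sinSol lam) = cosSol lam :=
  funext fun x => (hasDerivAt_sinSol lam x).deriv

theorem contDiff_cosSol : ContDiff ℝ ∞ (cosSol lam) := by
  unfold cosSol
  exact (Real.contDiff_cos.comp (contDiff_const.mul contDiff_id)).mul
    (Real.contDiff_cosh.comp (contDiff_const.mul contDiff_id))

theorem contDiff_sinSol : ContDiff ℝ ∞ (sinSol lam) :=
  contDiff_infty_iff_deriv.2 ⟨fun x => (hasDerivAt_sinSol lam x).differentiableAt, by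
    rw [deriv_sinSol]; exact contDiff_cosSol lam⟩

theorem cosSol_sq_add (x : ℝ) : cosSol lam x ^ 2 + lam * sinSol lam x ^ 2 = 1 := by
  have hd : ∀ t, HasDerivAt (fun t => cosSol lam t ^ 2 + lam * sinSol lam t ^ 2) 0 t := fun t => by
    have := ((hasDerivAt_cosSol lam t).pow 2).add (((hasDerivAt_sinSol lam t).pow 2).const_mul lam)
    refine this.congr_deriv ?_
    push_cast; ring
  have := is_const_of_deriv_eq_zero (fun t => (hd t).differentiableAt) (fun t => (hd t).deriv) x 0
  simpa using this

theorem cosSol_sq_add_complex (x : ℝ) :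
    (cosSol lam x : ℂ) ^ 2 + (lam : ℂ) * (sinSol lam x : ℂ) ^ 2 = 1 := by
  exact_mod_cast congrArg (fun r : ℝ => (r : ℂ)) (cosSol_sq_add lam x)

/-- The solution of `u'' + lam u = 0` with `u(0) = a` and `u'(0) = b`, as a function. -/
noncomputable def odeFun (a b : ℂ) (x : ℝ) : ℂ := a * cosSol lam x + b * sinSol lam x

theorem continuous_odeFun (a b : ℂ) : Continuous (odeFun lam a b) := by
  have h1 := continuous_cosSol lam
  have h2 := continuous_sinSol lam
  unfold odeFun; fun_prop

/-- The solution of `u'' + lam u = 0` with `u(0) = a` and `u'(0) = b`, as an element of `L²`. -/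
noncomputable def odeSol (ℓ : ℝ) (a b : ℂ) : IntervalL2 ℓ :=
  (memLp_of_continuousOn (continuous_odeFun lam a b).continuousOn).toLp _

variable {ℓ : ℝ}

theorem coeFn_odeSol (a b : ℂ) : odeSol lam ℓ a b =ᵐ[intervalMeasure ℓ] odeFun lam a b :=
  MemLp.coeFn_toLp _

theorem isContRep_odeSol (a b : ℂ) : IsContRep (odeSol lam ℓ a b) (odeFun lam a b) :=
  ⟨(continuous_odeFun lam a b).continuousOn, coeFn_odeSol lam a b⟩

theorem integrable_of_continuous {F : ℝ → ℂ} (hF : Continuous F) :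
    Integrable F (intervalMeasure ℓ) := hF.continuousOn.integrableOn_Icc

theorem isWeakDeriv_odeSol (a b : ℂ) :
    IsWeakDeriv (odeSol lam ℓ a b) (odeSol lam ℓ b (-lam * a)) := by
  have h1 := (hasWeakDeriv_const (ℓ := ℓ) a).smooth_mul (contDiff_cosSol lam) (deriv_cosSol lam)
    (integrable_const _) (integrable_const _)
  have h2 := (hasWeakDeriv_const (ℓ := ℓ) b).smooth_mul (contDiff_sinSol lam) (deriv_sinSol lam)
    (integrable_const _) (integrable_const _)
  have c1 := continuous_cosSol lam
  have c2 := continuous_sinSol lam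
  refine (h1.add h2 (integrable_of_continuous (by fun_prop)) (integrable_of_continuous (by fun_prop))
    (integrable_of_continuous (by fun_prop)) (integrable_of_continuous (by fun_prop))).congr ?_ ?_
  · filter_upwards [coeFn_odeSol lam (ℓ := ℓ) a b] with x hx
    rw [hx, odeFun]; ring
  · filter_upwards [coeFn_odeSol lam (ℓ := ℓ) b (-lam * a)] with x hx
    rw [hx, odeFun]; push_cast; ring

theorem odeSol_smul (c a b : ℂ) : odeSol lam ℓ (c * a) (c * b) = c • odeSol lam ℓ a b := by
  refine Lp.ext ?_
  filter_upwards [coeFn_odeSol lam (ℓ := ℓ) a b, coeFn_odeSol lam (ℓ := ℓ) (c * a) (c * b),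
    Lp.coeFn_smul c (odeSol lam ℓ a b)] with x h1 h2 h3
  rw [h2, h3, Pi.smul_apply, h1, odeFun, odeFun, smul_eq_mul]; ring

theorem odeSol_add (a b a' b' : ℂ) :
    odeSol lam ℓ (a + a') (b + b') = odeSol lam ℓ a b + odeSol lam ℓ a' b' := by
  refine Lp.ext ?_
  filter_upwards [coeFn_odeSol lam (ℓ := ℓ) a b, coeFn_odeSol lam (ℓ := ℓ) a' b',
    coeFn_odeSol lam (ℓ := ℓ) (a + a') (b + b'),
    Lp.coeFn_add (odeSol lam ℓ a b) (odeSol lam ℓ a' b')] with x h1 h2 h3 h4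
  rw [h3, h4, Pi.add_apply, h1, h2, odeFun, odeFun, odeFun]; ring

theorem weakDeriv_odeSol (a b : ℂ) :
    weakDeriv (odeSol lam ℓ a b) = odeSol lam ℓ b (-lam * a) :=
  weakDeriv_eq (isWeakDeriv_odeSol lam a b)

theorem weakDeriv_weakDeriv_odeSol (a b : ℂ) :
    weakDeriv (weakDeriv (odeSol lam ℓ a b)) = (-lam : ℂ) • odeSol lam ℓ a b := by
  rw [weakDeriv_odeSol, weakDeriv_odeSol, odeSol_smul]

theorem memH2_odeSol (a b : ℂ) : MemH2 (odeSol lam ℓ a b) :=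
  ⟨_, _, isWeakDeriv_odeSol lam a b, isWeakDeriv_odeSol lam _ _⟩

variable {lam} in
theorem contRep_odeSol (hℓ : 0 < ℓ) (a b : ℂ) {x : ℝ} (hx : x ∈ Set.Icc 0 ℓ) :
    contRep (odeSol lam ℓ a b) x = odeFun lam a b x :=
  contRep_eqOn hℓ (isContRep_odeSol lam a b) hx

variable {lam} in
/-- Weak solutions of `u'' + lam u = 0` are classical: the two first integrals `C u - S u'` and
`lam S u + C u'`, where `C` and `S` are the fundamental solutions, have weak derivative zero. -/
theorem exists_eq_odeSol (hℓ : 0 < ℓ) {u : IntervalL2 ℓ} (hu : MemH2 u)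
    (h : weakDeriv (weakDeriv u) + (lam : ℂ) • u = 0) : ∃ a b, u = odeSol lam ℓ a b := by
  obtain ⟨v, w, huv, hvw⟩ := hu
  rw [weakDeriv_eq huv, weakDeriv_eq hvw] at h
  have hw : w = (-lam : ℂ) • u := by rw [neg_smul]; exact eq_neg_of_add_eq_zero_left h
  have hwae : ⇑w =ᵐ[intervalMeasure ℓ] fun x => (-lam : ℂ) * u x := by
    rw [hw]; filter_upwards [Lp.coeFn_smul (-lam : ℂ) u] with x hx using by rw [hx]; rfl
  have huv' : HasWeakDeriv ℓ u v := huv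
  have hvw' : HasWeakDeriv ℓ v (fun x => (-lam : ℂ) * u x) :=
    (isWeakDeriv_iff.1 hvw).congr (by rfl) hwae
  have iu := integrable_coe u
  have iv := integrable_coe v
  have iw : Integrable (fun x => (-lam : ℂ) * u x) (intervalMeasure ℓ) := iu.const_mul _
  have imul : ∀ {c : ℝ → ℝ} {f : ℝ → ℂ}, Continuous c → Integrable f (intervalMeasure ℓ) →
      Integrable (fun x => (c x : ℂ) * f x) (intervalMeasure ℓ) := fun hc hf => by
    simpa only [Complex.real_smul] using integrable_smul_of_continuous hc hf
  have cC := continuous_cosSol lam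
  have cS := continuous_sinSol lam
  have cC' : Continuous fun x => -lam * sinSol lam x := by fun_prop
  have Cu := huv'.smooth_mul (contDiff_cosSol lam) (deriv_cosSol lam) iu iv
  have Su := huv'.smooth_mul (contDiff_sinSol lam) (deriv_sinSol lam) iu iv
  have Cv := hvw'.smooth_mul (contDiff_cosSol lam) (deriv_cosSol lam) iv iw
  have Sv := hvw'.smooth_mul (contDiff_sinSol lam) (deriv_sinSol lam) iv iw
  have hA := (Cu.add (Sv.const_mul (-1)) (imul cC iu) ((imul cC' iu).add (imul cC iv))
    ((imul cS iv).const_mul _) (((imul cC iv).add (imul cS iw)).const_mul _)).congr (by rfl)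
    (g' := fun _ => 0) (Filter.Eventually.of_forall fun x => by push_cast; ring)
  have hB := ((Su.const_mul lam).add Cv ((imul cS iu).const_mul _)
    (((imul cC iu).add (imul cS iv)).const_mul _) (imul cC iv)
    ((imul cC' iv).add (imul cC iw))).congr (by rfl)
    (g' := fun _ => 0) (Filter.Eventually.of_forall fun x => by push_cast; ring)
  obtain ⟨a, ha⟩ := hA.ae_const hℓ ((imul cC iu).add ((imul cS iv).const_mul _))
  obtain ⟨b, hb⟩ := hB.ae_const hℓ (((imul cS iu).const_mul _).add (imul cC iv))
  refine ⟨a, b, Lp.ext ?_⟩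
  filter_upwards [ha, hb, coeFn_odeSol lam (ℓ := ℓ) a b] with x h1 h2 h3
  rw [h3, odeFun, ← h1, ← h2]
  linear_combination (-(u x)) * cosSol_sq_add_complex lam x

end ODE

/-! ### The boundary value problem as a finite linear system -/

namespace QuantumGraph

variable {V : Type*} [Fintype V] {G : QuantumGraph V}

section System

variable (lam : ℝ) (b b' : G.Edge → ℂ) (y y' : V → ℂ)

/-- The element of `L²(G)` that solves `u'' + lam u = 0` on every edge `e`, with value `y (left e)`
and slope `b e` at the left end point. -/
noncomputable def edgeSol : G.L2 :=
  WithLp.toLp 2 fun e => odeSol lam (G.length e) (y (G.left e)) (b e)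

/-- The function with slopes `b` and vertex values `y` takes the prescribed value at the right end
point of every edge. -/
def EdgeCompat : Prop :=
  ∀ e : G.Edge, (cosSol lam (G.length e) : ℂ) * y (G.left e) + (sinSol lam (G.length e) : ℂ) * b e
    = y (G.right e)

open Classical in
/-- The outer normal derivative at `v` of the function with slopes `b` and vertex values `y`. -/
noncomputable def flux (v : V) : ℂ :=
  -(∑ e : G.Edge with G.left e = v, b e)
    + ∑ e : G.Edge with G.right e = v, ((cosSol lam (G.length e) : ℂ) * b e
        - lam * (sinSol lam (G.length e) : ℂ) * y (G.left e))

/-- The homogeneous system of the boundary value problem has only the trivial solution. -/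
def NonResonant (G : QuantumGraph V) (Vo : Finset V) (lam : ℝ) : Prop :=
  ∀ (b : G.Edge → ℂ) (y : V → ℂ), EdgeCompat lam b y → (∀ v ∈ Vo, y v = 0) →
    (∀ v ∉ Vo, flux lam b y v = 0) → b = 0 ∧ y = 0

variable {lam b b' y y'}

omit [Fintype V] in
theorem isTrace_edgeSol (h : EdgeCompat lam b y) : IsTrace (edgeSol lam b y) y := fun e =>
  ⟨_, isContRep_odeSol lam _ _, by simp [odeFun], by rw [← h e, odeFun]; ring⟩

theorem normalDeriv_edgeSol (v : V) : normalDeriv (edgeSol lam b y) v = flux lam b y v := by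
  unfold normalDeriv flux
  congr 1
  · congr 1
    refine Finset.sum_congr rfl fun e _ => ?_
    have : weakDeriv (edgeSol lam b y e) = odeSol lam (G.length e) (b e) (-lam * y (G.left e)) :=
      weakDeriv_odeSol lam _ _
    rw [this, contRep_odeSol (G.length_pos e) _ _ ⟨le_rfl, (G.length_pos e).le⟩]
    simp [odeFun]
  · refine Finset.sum_congr rfl fun e _ => ?_
    have : weakDeriv (edgeSol lam b y e) = odeSol lam (G.length e) (b e) (-lam * y (G.left e)) :=
      weakDeriv_odeSol lam _ _
    rw [this, contRep_odeSol (G.length_pos e) _ _ ⟨(G.length_pos e).le, le_rfl⟩, odeFun]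
    ring

omit [Fintype V] in
theorem laplace_edgeSol : laplace (edgeSol lam b y) + (lam : ℂ) • edgeSol lam b y = 0 := by
  ext1 e
  have : laplace (edgeSol lam b y) e = (-lam : ℂ) • edgeSol lam b y e :=
    weakDeriv_weakDeriv_odeSol lam _ _
  show laplace (edgeSol lam b y) e + (lam : ℂ) • edgeSol lam b y e = 0
  rw [this, neg_smul, neg_add_cancel]

omit [Fintype V] in
theorem edgeSol_mem_maxDomain (h : EdgeCompat lam b y) : edgeSol lam b y ∈ G.maxDomain :=
  ⟨fun _ => memH2_odeSol lam _ _, y, isTrace_edgeSol h⟩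

theorem isSolution_edgeSol {Vo : Finset V} {x : Vo → ℂ} (h : EdgeCompat lam b y)
    (hx : ∀ v : Vo, y v = x v) (hf : ∀ v ∉ Vo, flux lam b y v = 0) :
    IsSolution Vo lam x (edgeSol lam b y) :=
  ⟨edgeSol_mem_maxDomain h, laplace_edgeSol, ⟨y, isTrace_edgeSol h, hx⟩,
    fun v hv => by rw [normalDeriv_edgeSol, hf v hv]⟩

theorem IsSolution.exists_eq_edgeSol {Vo : Finset V} {x : Vo → ℂ} {f : G.L2}
    (h : IsSolution Vo lam x f) : ∃ (b : G.Edge → ℂ) (y : V → ℂ), f = edgeSol lam b y ∧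
      EdgeCompat lam b y ∧ (∀ v : Vo, y v = x v) ∧ ∀ v ∉ Vo, flux lam b y v = 0 := by
  obtain ⟨⟨h2, -⟩, hlap, ⟨y, hy, hyx⟩, hflux⟩ := h
  have hode : ∀ e, ∃ a b, f e = odeSol lam (G.length e) a b := fun e =>
    exists_eq_odeSol (G.length_pos e) (h2 e) (congrArg (fun g : G.L2 => g e) hlap)
  choose a b hab using hode
  have key : ∀ e, a e = y (G.left e) ∧
      (cosSol lam (G.length e) : ℂ) * a e + (sinSol lam (G.length e) : ℂ) * b e
        = y (G.right e) := fun e => by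
    obtain ⟨F, hF, hF0, hF1⟩ := hy e
    have hE := hF.eqOn (G.length_pos e) (hab e ▸ isContRep_odeSol lam (a e) (b e))
    constructor
    · rw [← hF0, hE ⟨le_rfl, (G.length_pos e).le⟩]; simp [odeFun]
    · rw [← hF1, hE ⟨(G.length_pos e).le, le_rfl⟩, odeFun]; ring
  have hfs : f = edgeSol lam b y := by
    ext1 e
    rw [hab e, (key e).1]; rfl
  exact ⟨b, y, hfs, fun e => by rw [← (key e).1]; exact (key e).2, hyx, fun v hv => by
    rw [← normalDeriv_edgeSol, ← hfs, hflux v hv]⟩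

theorem odeSol_eq_zero {ℓ : ℝ} (hℓ : 0 < ℓ) {a b : ℂ} (h : odeSol lam ℓ a b = 0) :
    a = 0 ∧ b = 0 := by
  have h0 : odeSol lam ℓ 0 0 = 0 := by
    have := odeSol_smul lam (ℓ := ℓ) 0 0 0
    rwa [mul_zero, zero_smul] at this
  have hd := congrArg weakDeriv (h.trans h0.symm)
  rw [weakDeriv_odeSol, weakDeriv_odeSol] at hd
  have hI : (0 : ℝ) ∈ Set.Icc 0 ℓ := ⟨le_rfl, hℓ.le⟩
  have e1 := (isContRep_odeSol lam (ℓ := ℓ) a b).eqOn hℓ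
    ((h.trans h0.symm) ▸ isContRep_odeSol lam 0 0) hI
  have e2 := (isContRep_odeSol lam (ℓ := ℓ) b (-lam * a)).eqOn hℓ
    (hd ▸ isContRep_odeSol lam 0 (-lam * 0)) hI
  simp only [odeFun, cosSol_zero, sinSol_zero] at e1 e2
  exact ⟨by simpa using e1, by simpa using e2⟩

omit [Fintype V] in
theorem exists_edge_of_notMem (hG : G.graph.Connected) {Vo : Finset V} (hVo : Vo.Nonempty) {v : V}
    (hv : v ∉ Vo) : ∃ e : G.Edge, G.left e = v ∨ G.right e = v := by
  obtain ⟨w, hw⟩ := hVo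
  have : Nontrivial V := ⟨v, w, fun h => hv (h ▸ hw)⟩
  obtain ⟨u, hu⟩ := hG.preconnected.exists_adj_of_nontrivial v
  let e : G.Edge := ⟨s(v, u), hu⟩
  refine ⟨e, ?_⟩
  have h1 : v ∈ s(G.left e, G.right e) := by rw [G.endpoints e]; exact Sym2.mem_mk_left v u
  rcases Sym2.mem_iff.1 h1 with h | h
  · exact Or.inl h.symm
  · exact Or.inr h.symm

theorem nonResonant_of_notMem_spectrum (hG : G.graph.Connected) {Vo : Finset V}
    (hVo : Vo.Nonempty) (h : (lam : ℂ) ∉ G.dirichletSpectrum Vo) : G.NonResonant Vo lam := by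
  intro b y hc hy hf
  obtain ⟨R, -, hR⟩ := not_not.1 h
  have hmem : edgeSol lam b y ∈ G.dirichletDomain Vo :=
    ⟨edgeSol_mem_maxDomain hc, ⟨y, isTrace_edgeSol hc, hy⟩,
      fun v hv => by rw [normalDeriv_edgeSol, hf v hv]⟩
  have h0 := hR _ hmem
  rw [add_comm, laplace_edgeSol, map_zero] at h0
  have he : ∀ e, y (G.left e) = 0 ∧ b e = 0 := fun e =>
    odeSol_eq_zero (G.length_pos e) (congrArg (fun g : G.L2 => g e) h0.symm)
  refine ⟨funext fun e => (he e).2, funext fun v => ?_⟩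
  by_cases hv : v ∈ Vo
  · exact hy v hv
  · obtain ⟨e, rfl | rfl⟩ := exists_edge_of_notMem hG hVo hv
    · exact (he e).1
    · rw [← hc e, (he e).1, (he e).2]; simp

theorem flux_add (v : V) :
    flux lam (b + b') (y + y') v = flux lam b y v + flux lam b' y' v := by
  simp only [flux, Pi.add_apply, mul_add, Finset.sum_add_distrib, Finset.sum_sub_distrib]
  ring

theorem flux_smul (c : ℂ) (v : V) : flux lam (c • b) (c • y) v = c * flux lam b y v := by
  simp only [flux, Pi.smul_apply, smul_eq_mul, mul_add, Finset.mul_sum, mul_neg, mul_sub,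
    mul_left_comm]

variable (G) in
/-- The linear map of the boundary value problem: slopes and vertex values are mapped to the defects
at the right end points of the edges, and to the values on the outer and the normal derivatives on
the inner vertices. -/
noncomputable def systemMap [DecidableEq V] (Vo : Finset V) (lam : ℝ) :
    ((G.Edge → ℂ) × (V → ℂ)) →ₗ[ℂ] ((G.Edge → ℂ) × (V → ℂ)) where
  toFun p := (fun e => (cosSol lam (G.length e) : ℂ) * p.2 (G.left e)
      + (sinSol lam (G.length e) : ℂ) * p.1 e - p.2 (G.right e),
    fun v => if v ∈ Vo then p.2 v else flux lam p.1 p.2 v)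
  map_add' p q := by
    refine Prod.ext (funext fun e => ?_) (funext fun v => ?_)
    · simp only [Prod.fst_add, Prod.snd_add, Pi.add_apply]; ring
    · simp only [Prod.fst_add, Prod.snd_add, Pi.add_apply, flux_add]; split_ifs <;> rfl
  map_smul' c p := by
    refine Prod.ext (funext fun e => ?_) (funext fun v => ?_)
    · simp only [Prod.smul_fst, Prod.smul_snd, Pi.smul_apply, smul_eq_mul, RingHom.id_apply]; ring
    · simp only [Prod.smul_fst, Prod.smul_snd, Pi.smul_apply, smul_eq_mul, RingHom.id_apply,
        flux_smul, mul_ite]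

theorem NonResonant.injective [DecidableEq V] {Vo : Finset V} (h : G.NonResonant Vo lam) :
    Function.Injective (systemMap G Vo lam) := by
  refine (injective_iff_map_eq_zero _).2 fun p hp => ?_
  have h1 : ∀ e, _ = (0 : ℂ) := fun e => congrFun (congrArg Prod.fst hp) e
  have h2 : ∀ v, _ = (0 : ℂ) := fun v => congrFun (congrArg Prod.snd hp) v
  simp only [systemMap, LinearMap.coe_mk, AddHom.coe_mk] at h1 h2
  obtain ⟨hb, hy⟩ := h p.1 p.2 (fun e => sub_eq_zero.1 (h1 e))
    (fun v hv => by simpa [hv] using h2 v) (fun v hv => by simpa [hv] using h2 v)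
  exact Prod.ext hb hy

theorem NonResonant.bijective [DecidableEq V] {Vo : Finset V} (h : G.NonResonant Vo lam) :
    Function.Bijective (systemMap G Vo lam) :=
  ⟨h.injective, LinearMap.injective_iff_surjective.1 h.injective⟩

theorem NonResonant.exists_sys [DecidableEq V] {Vo : Finset V} (h : G.NonResonant Vo lam)
    (x : Vo → ℂ) : ∃ (b : G.Edge → ℂ) (y : V → ℂ), EdgeCompat lam b y ∧ (∀ v : Vo, y v = x v) ∧
      ∀ v ∉ Vo, flux lam b y v = 0 := by
  obtain ⟨⟨b, y⟩, hp⟩ := h.bijective.2 (0, fun v => if hv : v ∈ Vo then x ⟨v, hv⟩ else 0)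
  have h1 : ∀ e, _ = (0 : ℂ) := fun e => congrFun (congrArg Prod.fst hp) e
  have h2 := fun v => congrFun (congrArg Prod.snd hp) v
  simp only [systemMap, LinearMap.coe_mk, AddHom.coe_mk] at h1 h2
  exact ⟨b, y, fun e => sub_eq_zero.1 (h1 e), fun v => by simpa using h2 v,
    fun v hv => by simpa [hv] using h2 v⟩

theorem NonResonant.sys_unique {Vo : Finset V} (h : G.NonResonant Vo lam)
    (hc : EdgeCompat lam b y) (hc' : EdgeCompat lam b' y') (hy : ∀ v ∈ Vo, y v = y' v)
    (hf : ∀ v ∉ Vo, flux lam b y v = 0) (hf' : ∀ v ∉ Vo, flux lam b' y' v = 0) :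
    b = b' ∧ y = y' := by
  have hb : b - b' = b + (-1 : ℂ) • b' := by simp [sub_eq_add_neg]
  have hy' : y - y' = y + (-1 : ℂ) • y' := by simp [sub_eq_add_neg]
  obtain ⟨h1, h2⟩ := h (b - b') (y - y')
    (fun e => by
      simp only [Pi.sub_apply]; linear_combination hc e - hc' e)
    (fun v hv => by simp [hy v hv])
    (fun v hv => by rw [hb, hy', flux_add, flux_smul, hf v hv, hf' v hv]; simp)
  exact ⟨sub_eq_zero.1 h1, sub_eq_zero.1 h2⟩

/-- Off resonance, the columns of the Dirichlet-to-Neumann matrix are the normal derivatives of the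
solutions of the linear system. -/
theorem NonResonant.dtnMatrix_apply [DecidableEq V] {Vo : Finset V} (h : G.NonResonant Vo lam)
    {w : Vo} (hc : EdgeCompat lam b y) (hy : ∀ v : Vo, y v = (Pi.single w 1 : Vo → ℂ) v)
    (hf : ∀ v ∉ Vo, flux lam b y v = 0) (v : Vo) :
    G.dtnMatrix Vo lam v w = flux lam b y v := by
  have hex : IsSolution Vo lam (Pi.single w 1) (Classical.epsilon fun f : G.L2 =>
      IsSolution Vo lam (Pi.single w 1) f) :=
    Classical.epsilon_spec ⟨_, isSolution_edgeSol hc hy hf⟩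
  obtain ⟨b', y', he, hc', hy', hf'⟩ := hex.exists_eq_edgeSol
  obtain ⟨rfl, rfl⟩ := h.sys_unique hc hc'
    (fun v hv => (hy ⟨v, hv⟩).trans (hy' ⟨v, hv⟩).symm) hf hf'
  show normalDeriv (Classical.epsilon fun f : G.L2 => IsSolution Vo lam (Pi.single w 1) f) v = _
  rw [he, normalDeriv_edgeSol]

end System

end QuantumGraph

/-! ### The resolvent -/

section Volterra

variable {ℓ : ℝ}

theorem exists_integral_norm_le (ℓ : ℝ) :
    ∃ K : ℝ, 0 ≤ K ∧ ∀ g : IntervalL2 ℓ, ∫ x, ‖g x‖ ∂(intervalMeasure ℓ) ≤ K * ‖g‖ := by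
  refine ⟨((intervalMeasure ℓ Set.univ) ^ (1 / (1 : ENNReal).toReal - 1 / (2 : ENNReal).toReal)).toReal,
    ENNReal.toReal_nonneg, fun g => ?_⟩
  have h := eLpNorm_le_eLpNorm_mul_rpow_measure_univ (μ := intervalMeasure ℓ) (f := g)
    (p := 1) (q := 2) (by norm_num) (Lp.aestronglyMeasurable g)
  rw [integral_norm_eq_lintegral_enorm (Lp.aestronglyMeasurable g), ← eLpNorm_one_eq_lintegral_enorm,
    mul_comm, Lp.norm_def, ← ENNReal.toReal_mul]
  refine ENNReal.toReal_mono (ENNReal.mul_ne_top (Lp.eLpNorm_ne_top g) ?_) h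
  refine ENNReal.rpow_ne_top_of_nonneg (by norm_num) (measure_ne_top _ _)

/-- The integral of `c g` over `[0, x]`. -/
noncomputable def wint (c : ℝ → ℝ) (g : ℝ → ℂ) (x : ℝ) : ℂ := ∫ s in (0 : ℝ)..x, (c s : ℂ) * g s

theorem integrable_mul_coe {c : ℝ → ℝ} (hc : Continuous c) (g : IntervalL2 ℓ) :
    Integrable (fun x => (c x : ℂ) * g x) (intervalMeasure ℓ) := by
  simpa only [Complex.real_smul] using integrable_smul_of_continuous hc (integrable_coe g)

theorem wint_eq {x : ℝ} (hx : x ∈ Set.Icc 0 ℓ) (c : ℝ → ℝ) (g : ℝ → ℂ) :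
    wint c g x = ∫ s in Set.Icc 0 x, (c s : ℂ) * g s ∂(intervalMeasure ℓ) := by
  rw [wint, intervalIntegral.integral_of_le hx.1, ← integral_Icc_eq_integral_Ioc,
    Measure.restrict_restrict measurableSet_Icc, Set.inter_eq_left.2 (Set.Icc_subset_Icc_right hx.2)]

theorem wint_add {c : ℝ → ℝ} (hc : Continuous c) (g g' : IntervalL2 ℓ) {x : ℝ}
    (hx : x ∈ Set.Icc 0 ℓ) : wint c (g + g' : IntervalL2 ℓ) x = wint c g x + wint c g' x := by
  rw [wint_eq hx, wint_eq hx, wint_eq hx, ← integral_add (integrable_mul_coe hc g).integrableOn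
    (integrable_mul_coe hc g').integrableOn]
  refine integral_congr_ae (ae_restrict_of_ae ?_)
  filter_upwards [Lp.coeFn_add g g'] with s hs
  rw [hs, Pi.add_apply, mul_add]

theorem wint_smul (c : ℝ → ℝ) (k : ℂ) (g : IntervalL2 ℓ) {x : ℝ}
    (hx : x ∈ Set.Icc 0 ℓ) : wint c (k • g : IntervalL2 ℓ) x = k * wint c g x := by
  rw [wint_eq hx, wint_eq hx, ← integral_const_mul]
  refine integral_congr_ae (ae_restrict_of_ae ?_)
  filter_upwards [Lp.coeFn_smul k g] with s hs
  rw [hs, Pi.smul_apply, smul_eq_mul]; ring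

theorem exists_wint_bound (ℓ : ℝ) {c : ℝ → ℝ} (hc : Continuous c) :
    ∃ K : ℝ, 0 ≤ K ∧ ∀ (g : IntervalL2 ℓ), ∀ x ∈ Set.Icc 0 ℓ, ‖wint c g x‖ ≤ K * ‖g‖ := by
  obtain ⟨K, hK, h⟩ := exists_integral_norm_le ℓ
  obtain ⟨B, hB⟩ := isCompact_Icc.exists_bound_of_continuousOn (s := Set.Icc 0 ℓ) hc.continuousOn
  refine ⟨|B| * K, by positivity, fun g x hx => ?_⟩
  rw [wint_eq hx]
  have i1 := integrable_mul_coe hc g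
  calc ‖∫ s in Set.Icc 0 x, (c s : ℂ) * g s ∂(intervalMeasure ℓ)‖
      ≤ ∫ s in Set.Icc 0 x, ‖(c s : ℂ) * g s‖ ∂(intervalMeasure ℓ) := norm_integral_le_integral_norm _
    _ ≤ ∫ s, ‖(c s : ℂ) * g s‖ ∂(intervalMeasure ℓ) :=
        setIntegral_le_integral i1.norm (Filter.Eventually.of_forall fun s => norm_nonneg _)
    _ ≤ ∫ s, |B| * ‖g s‖ ∂(intervalMeasure ℓ) := by
        refine integral_mono_ae i1.norm ((integrable_coe g).norm.const_mul _) ?_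
        refine (ae_restrict_iff' measurableSet_Icc).2 (Filter.Eventually.of_forall fun s hs => ?_)
        simp only [norm_mul, Complex.norm_real]
        exact mul_le_mul_of_nonneg_right ((hB s hs).trans (le_abs_self B)) (norm_nonneg _)
    _ ≤ |B| * K * ‖g‖ := by
        rw [integral_const_mul, mul_assoc]
        exact mul_le_mul_of_nonneg_left (h g) (abs_nonneg _)

theorem continuousOn_wint (hℓ : 0 ≤ ℓ) {c : ℝ → ℝ} (hc : Continuous c) (g : IntervalL2 ℓ) :
    ContinuousOn (wint c g) (Set.Icc 0 ℓ) :=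
  continuousOn_primitive_of_integrable hℓ (integrable_mul_coe hc g)

variable (lam : ℝ)

/-- The solution of `u'' + lam u = g` with `u(0) = u'(0) = 0`, by variation of constants. -/
noncomputable def volterraFun (g : ℝ → ℂ) (x : ℝ) : ℂ :=
  sinSol lam x * wint (cosSol lam) g x - cosSol lam x * wint (sinSol lam) g x

/-- The derivative of `volterraFun`. -/
noncomputable def volterraDerivFun (g : ℝ → ℂ) (x : ℝ) : ℂ :=
  cosSol lam x * wint (cosSol lam) g x + lam * sinSol lam x * wint (sinSol lam) g x

theorem continuousOn_volterraFun (hℓ : 0 ≤ ℓ) (g : IntervalL2 ℓ) :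
    ContinuousOn (volterraFun lam g) (Set.Icc 0 ℓ) := by
  have h1 := continuousOn_wint hℓ (continuous_cosSol lam) g
  have h2 := continuousOn_wint hℓ (continuous_sinSol lam) g
  have h3 := continuous_cosSol lam
  have h4 := continuous_sinSol lam
  unfold volterraFun
  fun_prop

theorem continuousOn_volterraDerivFun (hℓ : 0 ≤ ℓ) (g : IntervalL2 ℓ) :
    ContinuousOn (volterraDerivFun lam g) (Set.Icc 0 ℓ) := by
  have h1 := continuousOn_wint hℓ (continuous_cosSol lam) g
  have h2 := continuousOn_wint hℓ (continuous_sinSol lam) g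
  have h3 := continuous_cosSol lam
  have h4 := continuous_sinSol lam
  unfold volterraDerivFun
  fun_prop

theorem hasWeakDeriv_volterra (hℓ : 0 ≤ ℓ) (g : IntervalL2 ℓ) :
    HasWeakDeriv ℓ (volterraFun lam g) (volterraDerivFun lam g) ∧
    HasWeakDeriv ℓ (volterraDerivFun lam g) (fun x => g x - lam * volterraFun lam g x) := by
  have cC := continuous_cosSol lam
  have cS := continuous_sinSol lam
  have cC' : Continuous fun x => -lam * sinSol lam x := by fun_prop
  have iP : Integrable (wint (cosSol lam) g) (intervalMeasure ℓ) :=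
    (continuousOn_wint hℓ cC g).integrableOn_Icc
  have iQ : Integrable (wint (sinSol lam) g) (intervalMeasure ℓ) :=
    (continuousOn_wint hℓ cS g).integrableOn_Icc
  have iCg := integrable_mul_coe cC g
  have iSg := integrable_mul_coe cS g
  have imul : ∀ {c : ℝ → ℝ} {f : ℝ → ℂ}, Continuous c → Integrable f (intervalMeasure ℓ) →
      Integrable (fun x => (c x : ℂ) * f x) (intervalMeasure ℓ) := fun hc hf => by
    simpa only [Complex.real_smul] using integrable_smul_of_continuous hc hf
  have P : HasWeakDeriv ℓ (wint (cosSol lam) g) _ := hasWeakDeriv_primitive iCg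
  have Q : HasWeakDeriv ℓ (wint (sinSol lam) g) _ := hasWeakDeriv_primitive iSg
  have CP := P.smooth_mul (contDiff_cosSol lam) (deriv_cosSol lam) iP iCg
  have SP := P.smooth_mul (contDiff_sinSol lam) (deriv_sinSol lam) iP iCg
  have CQ := Q.smooth_mul (contDiff_cosSol lam) (deriv_cosSol lam) iQ iSg
  have SQ := Q.smooth_mul (contDiff_sinSol lam) (deriv_sinSol lam) iQ iSg
  constructor
  · refine (SP.add (CQ.const_mul (-1)) (imul cS iP) ((imul cC iP).add (imul cS iCg))
      ((imul cC iQ).const_mul _) (((imul cC' iQ).add (imul cC iSg)).const_mul _)).congr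
      (Filter.Eventually.of_forall fun x => ?_) (Filter.Eventually.of_forall fun x => ?_)
    · simp only [volterraFun]; ring
    · simp only [volterraDerivFun]; push_cast; ring
  · refine (CP.add (SQ.const_mul lam) (imul cC iP) ((imul cC' iP).add (imul cC iCg))
      ((imul cS iQ).const_mul _) (((imul cC iQ).add (imul cS iSg)).const_mul _)).congr
      (Filter.Eventually.of_forall fun x => ?_) (Filter.Eventually.of_forall fun x => ?_)
    · simp only [volterraDerivFun]; ring
    · simp only [volterraFun]; push_cast
      linear_combination (g x) * cosSol_sq_add_complex lam x

/-- Integration of `c g` over `[0, ℓ]` as a bounded functional of `g`. -/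
noncomputable def wintCLM (hℓ : 0 ≤ ℓ) {c : ℝ → ℝ} (hc : Continuous c) : IntervalL2 ℓ →L[ℂ] ℂ :=
  LinearMap.mkContinuousOfExistsBound
    { toFun := fun g => wint c g ℓ
      map_add' := fun g g' => wint_add hc g g' ⟨hℓ, le_rfl⟩
      map_smul' := fun k g => wint_smul c k g ⟨hℓ, le_rfl⟩ }
    (by
      obtain ⟨K, -, h⟩ := exists_wint_bound ℓ hc
      exact ⟨K, fun g => h g ℓ ⟨hℓ, le_rfl⟩⟩)

/-- The solution operator of `u'' + lam u = g`, `u(0) = u'(0) = 0`, on `L²([0, ℓ])`. -/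
noncomputable def volterraCLM (hℓ : 0 ≤ ℓ) : IntervalL2 ℓ →L[ℂ] IntervalL2 ℓ :=
  LinearMap.mkContinuousOfExistsBound
    { toFun := fun g => (memLp_of_continuousOn (continuousOn_volterraFun lam hℓ g)).toLp _
      map_add' := fun g g' => by
        rw [← MemLp.toLp_add]
        refine MemLp.toLp_congr _ _ ?_
        refine (ae_restrict_iff' measurableSet_Icc).2 (Filter.Eventually.of_forall fun x hx => ?_)
        simp only [volterraFun, Pi.add_apply, wint_add (continuous_cosSol lam) g g' hx,
          wint_add (continuous_sinSol lam) g g' hx]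
        ring
      map_smul' := fun k g => by
        rw [RingHom.id_apply, ← MemLp.toLp_const_smul]
        refine MemLp.toLp_congr _ _ ?_
        refine (ae_restrict_iff' measurableSet_Icc).2 (Filter.Eventually.of_forall fun x hx => ?_)
        simp only [volterraFun, Pi.smul_apply, wint_smul _ k g hx, smul_eq_mul]
        ring }
    (by
      obtain ⟨K, hK, h⟩ := exists_wint_bound ℓ (continuous_cosSol lam)
      obtain ⟨K', hK', h'⟩ := exists_wint_bound ℓ (continuous_sinSol lam)
      obtain ⟨B, hB⟩ := isCompact_Icc.exists_bound_of_continuousOn (s := Set.Icc 0 ℓ)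
        (continuous_cosSol lam).continuousOn
      obtain ⟨B', hB'⟩ := isCompact_Icc.exists_bound_of_continuousOn (s := Set.Icc 0 ℓ)
        (continuous_sinSol lam).continuousOn
      refine ⟨(measureUnivNNReal (intervalMeasure ℓ) : ℝ) ^ ((2 : ENNReal).toReal)⁻¹ *
        (|B'| * K + |B| * K'), fun g => ?_⟩
      rw [mul_assoc]
      refine Lp.norm_le_of_ae_bound (by positivity) ?_
      have hfn := MemLp.coeFn_toLp (memLp_of_continuousOn (continuousOn_volterraFun lam hℓ g))
      filter_upwards [hfn, ae_restrict_mem measurableSet_Icc] with x hx hxI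
      simp only [LinearMap.coe_mk, AddHom.coe_mk]
      rw [hx, volterraFun]
      refine (norm_sub_le _ _).trans ?_
      rw [norm_mul, norm_mul, Complex.norm_real, Complex.norm_real, add_mul, mul_assoc, mul_assoc]
      exact add_le_add
        (mul_le_mul ((hB' x hxI).trans (le_abs_self _)) (h g x hxI) (norm_nonneg _) (abs_nonneg _))
        (mul_le_mul ((hB x hxI).trans (le_abs_self _)) (h' g x hxI) (norm_nonneg _) (abs_nonneg _)))

theorem isContRep_volterraCLM (hℓ : 0 ≤ ℓ) (g : IntervalL2 ℓ) :
    IsContRep (volterraCLM lam hℓ g) (volterraFun lam g) :=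
  ⟨continuousOn_volterraFun lam hℓ g,
    MemLp.coeFn_toLp (memLp_of_continuousOn (continuousOn_volterraFun lam hℓ g))⟩

/-- The class of `volterraDerivFun` in `L²`. -/
noncomputable def volterraDeriv (hℓ : 0 ≤ ℓ) (g : IntervalL2 ℓ) : IntervalL2 ℓ :=
  (memLp_of_continuousOn (continuousOn_volterraDerivFun lam hℓ g)).toLp _

theorem isContRep_volterraDeriv (hℓ : 0 ≤ ℓ) (g : IntervalL2 ℓ) :
    IsContRep (volterraDeriv lam hℓ g) (volterraDerivFun lam g) :=
  ⟨continuousOn_volterraDerivFun lam hℓ g, MemLp.coeFn_toLp _⟩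

theorem isWeakDeriv_volterraCLM (hℓ : 0 ≤ ℓ) (g : IntervalL2 ℓ) :
    IsWeakDeriv (volterraCLM lam hℓ g) (volterraDeriv lam hℓ g) :=
  (hasWeakDeriv_volterra lam hℓ g).1.congr (isContRep_volterraCLM lam hℓ g).2.symm
    (isContRep_volterraDeriv lam hℓ g).2.symm

theorem isWeakDeriv_volterraDeriv (hℓ : 0 ≤ ℓ) (g : IntervalL2 ℓ) :
    IsWeakDeriv (volterraDeriv lam hℓ g) (g - (lam : ℂ) • volterraCLM lam hℓ g) := by
  refine (hasWeakDeriv_volterra lam hℓ g).2.congr (isContRep_volterraDeriv lam hℓ g).2.symm ?_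
  filter_upwards [(isContRep_volterraCLM lam hℓ g).2, Lp.coeFn_smul (lam : ℂ) (volterraCLM lam hℓ g),
    Lp.coeFn_sub g ((lam : ℂ) • volterraCLM lam hℓ g)] with x h1 h2 h3
  rw [h3, Pi.sub_apply, h2, Pi.smul_apply, h1, smul_eq_mul]

variable {lam}

theorem IsWeakDeriv.add {u v u' v' : IntervalL2 ℓ} (h : IsWeakDeriv u v) (h' : IsWeakDeriv u' v') :
    IsWeakDeriv (u + u') (v + v') :=
  (HasWeakDeriv.add h h' (integrable_coe _) (integrable_coe _) (integrable_coe _)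
    (integrable_coe _)).congr (Lp.coeFn_add u u').symm (Lp.coeFn_add v v').symm

theorem IsWeakDeriv.smul {u v : IntervalL2 ℓ} (h : IsWeakDeriv u v) (c : ℂ) :
    IsWeakDeriv (c • u) (c • v) :=
  (HasWeakDeriv.const_mul h c).congr (Lp.coeFn_smul c u).symm (Lp.coeFn_smul c v).symm

theorem IsContRep.add {u u' : IntervalL2 ℓ} {F F' : ℝ → ℂ} (h : IsContRep u F)
    (h' : IsContRep u' F') : IsContRep (u + u') (fun x => F x + F' x) := by
  refine ⟨h.1.add h'.1, ?_⟩
  filter_upwards [Lp.coeFn_add u u', h.2, h'.2] with x h1 h2 h3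
  rw [h1, Pi.add_apply, h2, h3]

theorem IsContRep.smul {u : IntervalL2 ℓ} {F : ℝ → ℂ} (h : IsContRep u F) (c : ℂ) :
    IsContRep (c • u) (fun x => c * F x) := by
  refine ⟨continuousOn_const.mul h.1, ?_⟩
  filter_upwards [Lp.coeFn_smul c u, h.2] with x h1 h2
  rw [h1, Pi.smul_apply, h2, smul_eq_mul]

end Volterra

namespace QuantumGraph

variable {V : Type*} [Fintype V] {G : QuantumGraph V}

section Linearity

omit [Fintype V] in
theorem IsTrace.add_smul {f f' : G.L2} {y y' : V → ℂ} (h : IsTrace f y) (h' : IsTrace f' y')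
    (c : ℂ) : IsTrace (f + c • f') (y + c • y') := fun e => by
  obtain ⟨F, h1, h2, h3⟩ := h e
  obtain ⟨F', h1', h2', h3'⟩ := h' e
  exact ⟨_, h1.add (h1'.smul c), by simp [h2, h2'], by simp [h3, h3']⟩

omit [Fintype V] in
theorem laplace_add_smul {f f' : G.L2} (h : f ∈ G.maxDomain) (h' : f' ∈ G.maxDomain) (c : ℂ) :
    laplace (f + c • f') = laplace f + c • laplace f' := by
  ext1 e
  obtain ⟨v, w, h1, h2⟩ := h.1 e
  obtain ⟨v', w', h1', h2'⟩ := h'.1 e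
  show weakDeriv (weakDeriv (f e + c • f' e)) = weakDeriv (weakDeriv (f e))
    + c • weakDeriv (weakDeriv (f' e))
  rw [weakDeriv_eq h1, weakDeriv_eq h1', weakDeriv_eq h2, weakDeriv_eq h2',
    weakDeriv_eq (h1.add (h1'.smul c)), weakDeriv_eq (h2.add (h2'.smul c))]

omit [Fintype V] in
theorem add_smul_mem_maxDomain {f f' : G.L2} (h : f ∈ G.maxDomain) (h' : f' ∈ G.maxDomain) (c : ℂ) :
    f + c • f' ∈ G.maxDomain := by
  refine ⟨fun e => ?_, ?_⟩
  · obtain ⟨v, w, h1, h2⟩ := h.1 e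
    obtain ⟨v', w', h1', h2'⟩ := h'.1 e
    exact ⟨_, _, h1.add (h1'.smul c), h2.add (h2'.smul c)⟩
  · obtain ⟨y, hy⟩ := h.2
    obtain ⟨y', hy'⟩ := h'.2
    exact ⟨_, hy.add_smul hy' c⟩

theorem normalDeriv_add_smul {f f' : G.L2} (h : f ∈ G.maxDomain) (h' : f' ∈ G.maxDomain) (c : ℂ)
    (v : V) : normalDeriv (f + c • f') v = normalDeriv f v + c * normalDeriv f' v := by
  have key : ∀ (e : G.Edge), ∀ x ∈ Set.Icc 0 (G.length e),
      contRep (weakDeriv ((f + c • f') e)) x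
        = contRep (weakDeriv (f e)) x + c * contRep (weakDeriv (f' e)) x := fun e x hx => by
    obtain ⟨u, w, h1, h2⟩ := h.1 e
    obtain ⟨u', w', h1', h2'⟩ := h'.1 e
    have e1 : weakDeriv ((f + c • f') e) = u + c • u' := weakDeriv_eq (h1.add (h1'.smul c))
    rw [weakDeriv_eq h1, weakDeriv_eq h1', e1]
    exact contRep_eqOn (G.length_pos e) ((h2.isContRep (G.length_pos e)).add
      ((h2'.isContRep (G.length_pos e)).smul c)) hx
  simp only [normalDeriv]
  rw [Finset.sum_congr rfl fun e _ => key e 0 ⟨le_rfl, (G.length_pos e).le⟩,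
    Finset.sum_congr rfl fun e _ => key e (G.length e) ⟨(G.length_pos e).le, le_rfl⟩,
    Finset.sum_add_distrib, Finset.sum_add_distrib, mul_add, mul_neg, Finset.mul_sum,
    Finset.mul_sum]
  ring

end Linearity

section Resolvent

variable (G) (lam : ℝ)

/-- The solution of `u'' + lam u = g` on every edge with initial values `0` at the left end
points. -/
noncomputable def edgeVolterra : G.L2 →L[ℂ] G.L2 :=
  ((PiLp.continuousLinearEquiv 2 ℂ fun e : G.Edge => IntervalL2 (G.length e)).symm :
      (∀ e : G.Edge, IntervalL2 (G.length e)) →L[ℂ] G.L2).comp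
    (ContinuousLinearMap.pi fun e => (volterraCLM lam (G.length_pos e).le).comp
      (PiLp.proj 2 (fun e : G.Edge => IntervalL2 (G.length e)) e))

/-- The value at the right end point of the edge `e` of `edgeVolterra`. -/
noncomputable def volterraEnd (e : G.Edge) : IntervalL2 (G.length e) →L[ℂ] ℂ :=
  (sinSol lam (G.length e) : ℂ) • wintCLM (G.length_pos e).le (continuous_cosSol lam)
    - (cosSol lam (G.length e) : ℂ) • wintCLM (G.length_pos e).le (continuous_sinSol lam)

/-- The slope at the right end point of the edge `e` of `edgeVolterra`. -/
noncomputable def volterraEndDeriv (e : G.Edge) : IntervalL2 (G.length e) →L[ℂ] ℂ :=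
  (cosSol lam (G.length e) : ℂ) • wintCLM (G.length_pos e).le (continuous_cosSol lam)
    + ((lam : ℂ) * (sinSol lam (G.length e) : ℂ)) • wintCLM (G.length_pos e).le (continuous_sinSol lam)

open Classical in
/-- The right-hand side of the linear system by which `edgeVolterra lam g` is corrected to an
element of the domain of the Laplace operator. -/
noncomputable def resolventData (Vo : Finset V) : G.L2 →L[ℂ] (G.Edge → ℂ) × (V → ℂ) :=
  (ContinuousLinearMap.pi fun e => -(volterraEnd G lam e).comp
      (PiLp.proj 2 (fun e : G.Edge => IntervalL2 (G.length e)) e)).prod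
    (ContinuousLinearMap.pi fun v => if v ∈ Vo then 0 else
      -∑ e : G.Edge with G.right e = v, (volterraEndDeriv G lam e).comp
        (PiLp.proj 2 (fun e : G.Edge => IntervalL2 (G.length e)) e))

/-- `edgeSol` as a linear map. -/
noncomputable def edgeSolLin : ((G.Edge → ℂ) × (V → ℂ)) →ₗ[ℂ] G.L2 where
  toFun p := edgeSol lam p.1 p.2
  map_add' p q := by
    ext1 e
    exact odeSol_add lam _ _ _ _
  map_smul' c p := by
    ext1 e
    exact odeSol_smul lam _ _ _

variable {G lam}

open Classical in
theorem notMem_spectrum_of_nonResonant {Vo : Finset V} (h : G.NonResonant Vo lam) :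
    (lam : ℂ) ∉ G.dirichletSpectrum Vo := by
  let T := (LinearEquiv.ofBijective _ h.bijective).symm
  let R : G.L2 →L[ℂ] G.L2 := edgeVolterra G lam +
    ((edgeSolLin G lam).toContinuousLinearMap.comp T.toLinearMap.toContinuousLinearMap).comp
      (resolventData G lam Vo)
  have hR1 : ∀ g, R g ∈ G.dirichletDomain Vo ∧ (lam : ℂ) • R g + laplace (R g) = g := by
    intro g
    set b := (T (resolventData G lam Vo g)).1 with hb
    set y := (T (resolventData G lam Vo g)).2 with hy
    have hT : systemMap G Vo lam (b, y) = resolventData G lam Vo g :=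
      LinearEquiv.apply_symm_apply (LinearEquiv.ofBijective _ h.bijective) _
    have hRe : ∀ e, R g e = volterraCLM lam (G.length_pos e).le (g e)
        + odeSol lam (G.length e) (y (G.left e)) (b e) := fun e => rfl
    have hd1 : ∀ e, IsWeakDeriv (R g e) (volterraDeriv lam (G.length_pos e).le (g e)
        + odeSol lam (G.length e) (b e) (-lam * y (G.left e))) := fun e => by
      rw [hRe]; exact (isWeakDeriv_volterraCLM lam _ _).add (isWeakDeriv_odeSol lam _ _)
    have hd2 : ∀ e, IsWeakDeriv (volterraDeriv lam (G.length_pos e).le (g e)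
        + odeSol lam (G.length e) (b e) (-lam * y (G.left e)))
        (g e - (lam : ℂ) • R g e) := fun e => by
      have := (isWeakDeriv_volterraDeriv lam (G.length_pos e).le (g e)).add
        (isWeakDeriv_odeSol lam (ℓ := G.length e) (b e) (-lam * y (G.left e)))
      rw [odeSol_smul] at this
      convert this using 1
      rw [hRe, smul_add, neg_smul]; abel
    have htr : IsTrace (R g) y := fun e => by
      refine ⟨_, (hRe e).symm ▸ (isContRep_volterraCLM lam (G.length_pos e).le (g e)).add
        (isContRep_odeSol lam (y (G.left e)) (b e)), ?_, ?_⟩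
      · simp [volterraFun, wint, odeFun]
      · have := congrFun (congrArg Prod.fst hT) e
        have h2 : (cosSol lam (G.length e) : ℂ) * y (G.left e)
          + (sinSol lam (G.length e) : ℂ) * b e - y (G.right e)
          = -volterraFun lam (g e) (G.length e) := this
        rw [odeFun]
        linear_combination h2
    have hN : ∀ v, normalDeriv (R g) v = flux lam b y v
        + ∑ e : G.Edge with G.right e = v, volterraDerivFun lam (g e) (G.length e) := fun v => by
      have hc : ∀ e, ∀ x ∈ Set.Icc 0 (G.length e), contRep (weakDeriv (R g e)) x
          = volterraDerivFun lam (g e) x + odeFun lam (b e) (-lam * y (G.left e)) x := fun e x hx => by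
        rw [weakDeriv_eq (hd1 e)]
        exact contRep_eqOn (G.length_pos e) ((isContRep_volterraDeriv lam _ _).add
          (isContRep_odeSol lam _ _)) hx
      simp only [normalDeriv, flux]
      rw [Finset.sum_congr rfl fun e _ => hc e 0 ⟨le_rfl, (G.length_pos e).le⟩,
        Finset.sum_congr rfl fun e _ => hc e (G.length e) ⟨(G.length_pos e).le, le_rfl⟩,
        add_assoc, ← Finset.sum_add_distrib]
      congr 2
      · exact Finset.sum_congr rfl fun e _ => by simp [volterraDerivFun, wint, odeFun]
      · exact funext fun e => by rw [odeFun]; ring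
    have h2 : ∀ v, (if v ∈ Vo then y v else flux lam b y v)
        = (resolventData G lam Vo g).2 v := fun v => by
      rw [← hT]; simp [systemMap]
    refine ⟨⟨⟨fun e => ⟨_, _, hd1 e, hd2 e⟩, y, htr⟩, ⟨y, htr, fun v hv => ?_⟩, fun v hv => ?_⟩, ?_⟩
    · have := h2 v
      rw [if_pos hv] at this
      rw [this]
      simp [resolventData, hv]
    · have := h2 v
      rw [if_neg hv] at this
      rw [hN, this]
      have h3 : (resolventData G lam Vo g).2 v
          = -∑ e : G.Edge with G.right e = v, volterraDerivFun lam (g e) (G.length e) := by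
        simp only [resolventData, ContinuousLinearMap.prod_apply, ContinuousLinearMap.coe_pi', if_neg hv,
          _root_.neg_apply, _root_.sum_apply]
        rfl
      rw [h3]; ring
    · ext1 e
      show (lam : ℂ) • R g e + weakDeriv (weakDeriv (R g e)) = g e
      rw [weakDeriv_eq (hd1 e), weakDeriv_eq (hd2 e)]
      abel
  refine not_not.2 ⟨R, hR1, fun f hf => ?_⟩
  obtain ⟨hr, hr'⟩ := hR1 ((lam : ℂ) • f + laplace f)
  set r := R ((lam : ℂ) • f + laplace f) with hrdef
  obtain ⟨hm, ⟨z, hz, hz0⟩, hn⟩ := hf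
  obtain ⟨hm', ⟨z', hz', hz0'⟩, hn'⟩ := hr
  have hsol : IsSolution Vo lam (0 : Vo → ℂ) (f + (-1 : ℂ) • r) := by
    refine ⟨add_smul_mem_maxDomain hm hm' _, ?_, ⟨_, hz.add_smul hz' _, fun v => ?_⟩, fun v hv => ?_⟩
    · rw [laplace_add_smul hm hm']
      rw [← sub_eq_zero] at hr'
      rw [← neg_eq_zero, ← hr', smul_add, smul_comm, neg_one_smul, neg_one_smul]
      abel
    · simp [hz0 v v.2, hz0' v v.2]
    · rw [normalDeriv_add_smul hm hm', hn v hv, hn' v hv]; simp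
  obtain ⟨b, y, he, hc, hy, hfl⟩ := hsol.exists_eq_edgeSol
  obtain ⟨rfl, rfl⟩ := h b y hc (fun v hv => hy ⟨v, hv⟩) hfl
  have h0 : edgeSol lam (0 : G.Edge → ℂ) (0 : V → ℂ) = 0 := (edgeSolLin G lam).map_zero
  rw [h0, neg_one_smul, ← sub_eq_add_neg, sub_eq_zero] at he
  exact he.symm

end Resolvent

end QuantumGraph

/-! ### Positivity of real matrix semigroups -/

namespace Matrix

open NormedSpace

variable {ι : Type*} [Fintype ι] [DecidableEq ι] {A : Matrix ι ι ℝ}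

section Exponential

open scoped Matrix.Norms.Operator

theorem hasSum_exp (A : Matrix ι ι ℝ) :
    HasSum (fun n : ℕ => ((n.factorial : ℝ)⁻¹) • A ^ n) (exp A) :=
  exp_series_hasSum_exp' A

theorem continuous_exp : Continuous (exp : Matrix ι ι ℝ → Matrix ι ι ℝ) := exp_continuous

theorem hasDerivAt_exp_smul (A : Matrix ι ι ℝ) (t : ℝ) :
    HasDerivAt (fun u : ℝ => exp (u • A)) (A * exp (t • A)) t :=
  hasDerivAt_exp_smul_const' A t

theorem exp_map_ofReal (A : Matrix ι ι ℝ) :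
    exp (A.map Complex.ofReal) = (exp A).map Complex.ofReal :=
  (map_exp (Complex.ofRealHom.mapMatrix (m := ι))
    (continuous_id.matrix_map Complex.continuous_ofReal) A).symm

end Exponential

theorem semigroup_map_ofReal (A : Matrix ι ι ℝ) (t : ℝ) :
    semigroup (A.map Complex.ofReal) t = (exp ((-t) • A)).map Complex.ofReal := by
  rw [← exp_map_ofReal, semigroup]
  congr 1
  ext i j
  simp

theorem semigroupPositive_map_iff : SemigroupPositive (A.map Complex.ofReal) ↔
    ∀ t : ℝ, 0 ≤ t → ∀ i j, 0 ≤ exp ((-t) • A) i j := by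
  simp only [SemigroupPositive, semigroup_map_ofReal, map_apply, Complex.zero_le_real]

theorem semigroupStronglyPositive_map_iff : SemigroupStronglyPositive (A.map Complex.ofReal) ↔
    ∀ t : ℝ, 0 < t → ∀ i j, 0 < exp ((-t) • A) i j := by
  simp only [SemigroupStronglyPositive, semigroup_map_ofReal, map_apply, Complex.zero_lt_real]

theorem semigroupEventuallyPositive_map_iff : SemigroupEventuallyPositive (A.map Complex.ofReal) ↔
    ∃ t₀ : ℝ, 0 < t₀ ∧ ∀ t : ℝ, t₀ ≤ t → ∀ i j, 0 ≤ exp ((-t) • A) i j := by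
  simp only [SemigroupEventuallyPositive, semigroup_map_ofReal, map_apply, Complex.zero_le_real]

theorem semigroupEventuallyStronglyPositive_map_iff :
    SemigroupEventuallyStronglyPositive (A.map Complex.ofReal) ↔
    ∃ t₀ : ℝ, 0 < t₀ ∧ ∀ t : ℝ, t₀ ≤ t → ∀ i j, 0 < exp ((-t) • A) i j := by
  simp only [SemigroupEventuallyStronglyPositive, semigroup_map_ofReal, map_apply,
    Complex.zero_lt_real]

theorem exp_neg_smul_add (A : Matrix ι ι ℝ) (s t : ℝ) :
    exp ((-(s + t)) • A) = exp ((-s) • A) * exp ((-t) • A) := by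
  rw [← exp_add_of_commute _ _ (((Commute.refl A).smul_left _).smul_right _), ← add_smul]
  congr 2; ring

/-- For a matrix with non-positive off-diagonal entries, `e^{-tA}` dominates a positive multiple of
`1 + t (c - A)`, where `c` bounds the diagonal of `A`. -/
theorem exists_le_exp_neg_smul (hA : ∀ i j, i ≠ j → A i j ≤ 0) {t : ℝ} (ht : 0 ≤ t) :
    ∃ r : ℝ, 0 < r ∧ ∀ i j, 0 ≤ exp ((-t) • A) i j ∧ r * (1 : Matrix ι ι ℝ) i j ≤ exp ((-t) • A) i j ∧
      (i ≠ j → r * (t * -A i j) ≤ exp ((-t) • A) i j) := by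
  let c : ℝ := ∑ i, |A i i|
  let B : Matrix ι ι ℝ := c • 1 - A
  have hB : ∀ i j, 0 ≤ B i j := fun i j => by
    by_cases hij : i = j
    · subst hij
      have : |A i i| ≤ c := Finset.single_le_sum (f := fun i => |A i i|)
        (fun i _ => abs_nonneg _) (Finset.mem_univ i)
      have := le_abs_self (A i i)
      simp only [B, sub_apply, smul_apply, one_apply_eq, smul_eq_mul, mul_one]
      linarith
    · simp only [B, sub_apply, smul_apply, one_apply_ne hij, smul_eq_mul, mul_zero]
      linarith [hA i j hij]
  have hexp : exp ((-t) • A) = Real.exp (-t * c) • exp (t • B) := by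
    have h1 : (-t) • A = diagonal (fun _ => -t * c) + t • B := by
      rw [show diagonal (fun _ : ι => -t * c) = (-t * c) • (1 : Matrix ι ι ℝ) from
        (smul_one_eq_diagonal _).symm]
      simp only [B, smul_sub, smul_smul, neg_smul, neg_mul]
      abel
    have hcomm : Commute (diagonal fun _ : ι => -t * c) (t • B) := by
      rw [← smul_one_eq_diagonal]
      exact (Commute.one_left _).smul_left _
    rw [h1, exp_add_of_commute _ _ hcomm, exp_diagonal]
    have : exp (fun _ : ι => -t * c) = fun _ => Real.exp (-t * c) := by
      rw [Pi.exp_def, Real.exp_eq_exp_ℝ]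
    rw [this, ← smul_one_eq_diagonal, smul_mul_assoc, one_mul]
  have hpow : ∀ n : ℕ, ∀ i j, 0 ≤ ((t • B) ^ n) i j := fun n => by
    induction n with
    | zero => intro i j; rw [pow_zero, one_apply]; split_ifs <;> norm_num
    | succ n ih =>
      intro i j
      rw [pow_succ, mul_apply]
      exact Finset.sum_nonneg fun k _ => mul_nonneg (ih i k) (mul_nonneg ht (hB k j))
  have hsum : ∀ i j, HasSum (fun n : ℕ => (((n.factorial : ℝ)⁻¹) • (t • B) ^ n) i j)
      (exp (t • B) i j) := fun i j => Pi.hasSum.1 (Pi.hasSum.1 (hasSum_exp (t • B)) i) j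
  have hnn : ∀ n i j, 0 ≤ (((Nat.factorial n : ℝ)⁻¹) • (t • B) ^ n) i j := fun n i j =>
    mul_nonneg (by positivity) (hpow n i j)
  have hle : ∀ n i j, (((Nat.factorial n : ℝ)⁻¹) • (t • B) ^ n) i j ≤ exp (t • B) i j := fun n i j =>
    le_hasSum (hsum i j) n fun m _ => hnn m i j
  refine ⟨Real.exp (-t * c), Real.exp_pos _, fun i j => ?_⟩
  rw [hexp, smul_apply, smul_eq_mul]
  refine ⟨mul_nonneg (Real.exp_pos _).le ((hnn 0 i j).trans (hle 0 i j)),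
    mul_le_mul_of_nonneg_left (by simpa using hle 0 i j) (Real.exp_pos _).le, fun hij =>
    mul_le_mul_of_nonneg_left ?_ (Real.exp_pos _).le⟩
  simpa [B, one_apply_ne hij] using hle 1 i j

theorem exp_neg_smul_nonneg (hA : ∀ i j, i ≠ j → A i j ≤ 0) {t : ℝ} (ht : 0 ≤ t) (i j : ι) :
    0 ≤ exp ((-t) • A) i j := by
  obtain ⟨r, -, h⟩ := exists_le_exp_neg_smul hA ht
  exact (h i j).1

/-- Irreducibility makes the semigroup strongly positive. -/
theorem exp_neg_smul_pos (hA : ∀ i j, i ≠ j → A i j ≤ 0)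
    (hconn : ∀ i j, Relation.ReflTransGen (fun i j => A i j < 0) i j) {t : ℝ} (ht : 0 < t)
    (i j : ι) : 0 < exp ((-t) • A) i j := by
  have hdiag : ∀ s : ℝ, 0 < s → ∀ i, 0 < exp ((-s) • A) i i := fun s hs i => by
    obtain ⟨r, hr, h⟩ := exists_le_exp_neg_smul hA hs.le
    exact hr.trans_le (by simpa using (h i i).2.1)
  have key : ∀ s : ℝ, 0 < s → 0 < exp ((-s) • A) i j := by
    induction hconn i j with
    | refl => exact fun s hs => hdiag s hs i
    | @tail k l _ hkl ih =>
      intro s hs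
      have hs2 := half_pos hs
      have hkl' : 0 < exp ((-(s / 2)) • A) k l := by
        obtain ⟨r, hr, h⟩ := exists_le_exp_neg_smul hA hs2.le
        by_cases hkl2 : k = l
        · subst hkl2; exact hdiag _ hs2 k
        · refine lt_of_lt_of_le ?_ ((h k l).2.2 hkl2)
          have : 0 < -A k l := neg_pos.2 hkl
          positivity
      rw [show s = s / 2 + s / 2 by ring, exp_neg_smul_add, mul_apply]
      exact Finset.sum_pos' (fun m _ => mul_nonneg (exp_neg_smul_nonneg hA hs2.le _ _)
        (exp_neg_smul_nonneg hA hs2.le _ _)) ⟨k, Finset.mem_univ _, mul_pos (ih _ hs2) hkl'⟩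
  exact key t ht

/-- A positive semigroup has a generator with non-positive off-diagonal entries. -/
theorem nonpos_of_exp_neg_smul_nonneg (h : ∀ t : ℝ, 0 ≤ t → ∀ i j, 0 ≤ exp ((-t) • A) i j)
    {i j : ι} (hij : i ≠ j) : A i j ≤ 0 := by
  have hd : HasDerivAt (fun u : ℝ => exp (u • (-A)) i j) ((-A) i j) 0 := by
    have := hasDerivAt_pi.1 (hasDerivAt_pi.1 (hasDerivAt_exp_smul (-A) 0) i) j
    simpa using this
  by_contra hpos
  push Not at hpos
  have hneg : (-A) i j < 0 := by simpa using hpos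
  have hs := (hasDerivAt_iff_tendsto_slope.1 hd).eventually (gt_mem_nhds hneg)
  have hs' : ∀ᶠ u in nhdsWithin (0 : ℝ) (Set.Ioi 0),
      slope (fun u : ℝ => exp (u • (-A)) i j) 0 u < 0 :=
    hs.filter_mono (nhdsWithin_mono _ fun u (hu : 0 < u) => hu.ne')
  obtain ⟨u, hu, hu0⟩ := (hs'.and self_mem_nhdsWithin).exists
  have hu0 : 0 < u := hu0
  rw [slope_def_field] at hu
  have h1 := h u hu0.le i j
  rw [neg_smul, ← smul_neg] at h1
  have h0 : exp ((0 : ℝ) • (-A)) i j = 0 := by simp [one_apply_ne hij]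
  rw [h0, sub_zero, sub_zero] at hu
  exact absurd hu (not_lt.2 (div_nonneg h1 hu0.le))

/-- If `e^{-tA}` has positive entries for `t > 0`, then the inverse semigroup is not eventually
positive: a product of a positive matrix and a non-negative one without zero rows is not `1`. -/
theorem not_eventually_nonneg_of_pos [Nontrivial ι]
    (h : ∀ t : ℝ, 0 < t → ∀ i j, 0 < exp ((-t) • A) i j) :
    ¬ ∃ t₀ : ℝ, 0 < t₀ ∧ ∀ t : ℝ, t₀ ≤ t → ∀ i j, 0 ≤ exp ((-t) • (-A)) i j := by
  rintro ⟨t, ht, ht'⟩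
  have hE := ht' t le_rfl
  have hP := h t ht
  have hmul : exp ((-t) • (-A)) * exp ((-t) • A) = 1 := by
    have h1 : (-t) • (-A) = (-(-t)) • A := by simp
    rw [h1, ← exp_neg_smul_add]; simp
  have hzero : ∀ i k, exp ((-t) • (-A)) i k = 0 := fun i k => by
    obtain ⟨j, hj⟩ := exists_ne i
    have h1 := congrFun (congrFun hmul i) j
    rw [mul_apply, one_apply_ne hj.symm] at h1
    have h2 := (Finset.sum_eq_zero_iff_of_nonneg
      (fun k _ => mul_nonneg (hE i k) (hP k j).le)).1 h1 k (Finset.mem_univ k)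
    exact (mul_eq_zero.1 h2).resolve_right (hP k j).ne'
  obtain ⟨i⟩ : Nonempty ι := inferInstance
  have h1 := congrFun (congrFun hmul i) i
  rw [mul_apply, one_apply_eq, Finset.sum_eq_zero fun k _ => by rw [hzero, zero_mul]] at h1
  exact zero_ne_one h1

/-- If a change of signs makes the off-diagonal entries non-positive, the semigroup is either
positive or has a non-positive entry at all times. -/
theorem nonneg_or_not_eventually_pos_of_signs {s : ι → ℝ} (hs : ∀ i, s i * s i = 1)
    (hA : ∀ i j, i ≠ j → s i * A i j * s j ≤ 0) :
    (∀ t : ℝ, 0 ≤ t → ∀ i j, 0 ≤ exp ((-t) • A) i j) ∨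
      ¬ ∃ t₀ : ℝ, 0 < t₀ ∧ ∀ t : ℝ, t₀ ≤ t → ∀ i j, 0 < exp ((-t) • A) i j := by
  by_cases hpos : ∀ i j, i ≠ j → A i j ≤ 0
  · exact Or.inl fun t ht i j => exp_neg_smul_nonneg hpos ht i j
  right
  push Not at hpos
  obtain ⟨i, j, hij, hAij⟩ := hpos
  rintro ⟨t, ht, h⟩
  have h1 := h t le_rfl i j
  let S : Matrix ι ι ℝ := diagonal s
  have hSS : S * S = 1 := by
    simp only [S, diagonal_mul_diagonal, hs]; exact diagonal_one
  have hinv : S⁻¹ = S := inv_eq_left_inv hSS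
  have hu : IsUnit S := ⟨⟨S, S, hSS, hSS⟩, rfl⟩
  have hconj : exp ((-t) • (S * A * S)) = S * exp ((-t) • A) * S := by
    have := exp_conj S ((-t) • A) hu
    rw [hinv] at this
    rw [← this]; simp
  have hent : ∀ (B : Matrix ι ι ℝ) k l, (S * B * S) k l = s k * B k l * s l := fun B k l => by
    simp [S]
  have h2 := exp_neg_smul_nonneg (A := S * A * S) (fun k l hkl => by rw [hent]; exact hA k l hkl)
    ht.le i j
  rw [hconj, hent] at h2
  have h3 := hA i j hij
  -- `s i * s j` must be negative because `A i j` is positive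
  have h4 : s i * s j ≤ 0 := by
    by_contra hc
    push Not at hc
    have := mul_pos hc hAij
    nlinarith
  have h5 : (s i * s j) * (s i * s j) = 1 := by
    calc (s i * s j) * (s i * s j) = (s i * s i) * (s j * s j) := by ring
      _ = 1 := by rw [hs, hs, one_mul]
  have h6 : s i * s j < 0 := lt_of_le_of_ne h4 fun h0 => by rw [h0] at h5; norm_num at h5
  have := mul_neg_of_neg_of_pos h6 h1
  nlinarith

theorem exp_smul_pos_iff {k : ℝ} (hk : 0 < k) (P : Matrix ι ι ℝ → Prop) :
    (∃ t₀ : ℝ, 0 < t₀ ∧ ∀ t : ℝ, t₀ ≤ t → P (exp ((-t) • (k • A)))) ↔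
      ∃ t₀ : ℝ, 0 < t₀ ∧ ∀ t : ℝ, t₀ ≤ t → P (exp ((-t) • A)) := by
  constructor
  · rintro ⟨t₀, h0, h⟩
    refine ⟨k * t₀, by positivity, fun t ht => ?_⟩
    have := h (t / k) ((le_div_iff₀ hk).2 (by linarith))
    rwa [smul_smul, neg_mul, div_mul_cancel₀ _ hk.ne'] at this
  · rintro ⟨t₀, h0, h⟩
    refine ⟨t₀ / k, by positivity, fun t ht => ?_⟩
    rw [smul_smul, neg_mul]
    exact h _ ((div_le_iff₀ hk).1 ht)

/-- If `A` is symmetric, annihilates constants and is positive definite modulo constants, then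
`e^{-tA}` converges to a positive matrix, the projection onto the constants. -/
theorem exists_forall_exp_neg_smul_pos [Nonempty ι] (hsymm : A.IsSymm) (h1 : A *ᵥ 1 = 0)
    (hpos : ∀ x : ι → ℝ, (∃ i j, x i ≠ x j) → 0 < x ⬝ᵥ A *ᵥ x) :
    ∃ T : ℝ, 0 < T ∧ ∀ t : ℝ, T ≤ t → ∀ i j, 0 < exp ((-t) • A) i j := by
  have hA : A.IsHermitian := by
    rw [IsHermitian, conjTranspose_eq_transpose_of_trivial]; exact hsymm
  let U : Matrix ι ι ℝ := hA.eigenvectorUnitary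
  let μ : ι → ℝ := hA.eigenvalues
  have hUU : U * star U = 1 := mem_unitaryGroup_iff.1 hA.eigenvectorUnitary.2
  have hUU' : star U * U = 1 := mem_unitaryGroup_iff'.1 hA.eigenvectorUnitary.2
  have hspec : A = U * diagonal μ * star U := hA.spectral_theorem
  have hexp : ∀ (t : ℝ) (i j : ι), exp ((-t) • A) i j = ∑ k, Real.exp (-t * μ k) * (U i k * U j k) := by
    intro t i j
    have hinv : U⁻¹ = star U := inv_eq_left_inv hUU'
    have e1 : (-t) • A = U * diagonal (fun k => -t * μ k) * U⁻¹ := by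
      rw [hinv]
      conv_lhs => rw [hspec]
      rw [← smul_mul_assoc, ← mul_smul_comm, ← diagonal_smul]; rfl
    have e2 : exp (fun k => -t * μ k) = fun k => Real.exp (-t * μ k) := by
      rw [Pi.exp_def, Real.exp_eq_exp_ℝ]
    rw [e1, exp_conj U _ ⟨⟨U, star U, hUU, hUU'⟩, rfl⟩, exp_diagonal, e2, hinv, mul_apply]
    refine Finset.sum_congr rfl fun k _ => ?_
    rw [mul_diagonal, star_apply, star_trivial]; ring
  have hcol : ∀ k, A *ᵥ (fun i => U i k) = μ k • fun i => U i k := fun k =>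
    hA.mulVec_eigenvectorBasis k
  have hnorm : ∀ k, (fun i => U i k) ⬝ᵥ (fun i => U i k) = 1 := fun k => by
    have := congrFun (congrFun hUU' k) k
    simpa [mul_apply, dotProduct, star_apply] using this
  have hμ : ∀ k, (fun i => U i k) ⬝ᵥ A *ᵥ (fun i => U i k) = μ k := fun k => by
    rw [hcol, dotProduct_smul, hnorm, smul_eq_mul, mul_one]
  have hconst : ∀ k, (∀ i j, U i k = U j k) → μ k = 0 := fun k hk => by
    have hk' : (fun i => U i k) = U (Classical.arbitrary ι) k • (1 : ι → ℝ) := by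
      ext i; simp [hk i (Classical.arbitrary ι)]
    rw [← hμ, hk', mulVec_smul, h1]; simp
  have hμ0 : ∀ k, 0 < μ k ∨ (μ k = 0 ∧ ∀ i j, U i k = U j k) := fun k => by
    by_cases hk : ∀ i j, U i k = U j k
    · exact Or.inr ⟨hconst k hk, hk⟩
    · push Not at hk
      left; rw [← hμ]; exact hpos _ hk
  obtain ⟨k0, hk0⟩ : ∃ k, μ k = 0 := by
    by_contra hne
    push Not at hne
    have hdet : A.det ≠ 0 := by
      rw [hA.det_eq_prod_eigenvalues]
      exact Finset.prod_ne_zero_iff.2 fun k _ => by simpa using hne k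
    have := eq_zero_of_mulVec_eq_zero hdet h1
    exact one_ne_zero this
  have hlim : ∀ i j, Filter.Tendsto (fun t : ℝ => exp ((-t) • A) i j) Filter.atTop
      (nhds (∑ k, if μ k = 0 then U i k * U j k else 0)) := fun i j => by
    simp only [hexp]
    refine tendsto_finsetSum _ fun k _ => ?_
    by_cases hk : μ k = 0
    · simp [hk]
    · rw [if_neg hk]
      have hk' : 0 < μ k := (hμ0 k).resolve_right fun h => hk h.1
      have : Filter.Tendsto (fun t : ℝ => Real.exp (-t * μ k)) Filter.atTop (nhds 0) := by
        refine Real.tendsto_exp_atBot.comp ?_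
        simp only [neg_mul]
        exact Filter.tendsto_neg_atTop_atBot.comp (Filter.tendsto_id.atTop_mul_const hk')
      simpa using this.mul_const (U i k * U j k)
  have hlimpos : ∀ i j, 0 < ∑ k, if μ k = 0 then U i k * U j k else 0 := fun i j => by
    have hc : ∀ k, μ k = 0 → ∀ i j, U i k = U j k := fun k hk =>
      ((hμ0 k).resolve_left (by rw [hk]; exact lt_irrefl _)).2
    refine Finset.sum_pos' (fun k _ => ?_) ⟨k0, Finset.mem_univ _, ?_⟩
    · split_ifs with hk
      · rw [hc k hk i j]; exact mul_self_nonneg _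
      · exact le_rfl
    · rw [if_pos hk0, hc k0 hk0 i j]
      have hne : U j k0 ≠ 0 := fun h0 => by
        have h2 := hnorm k0
        rw [show (fun i => U i k0) = 0 from funext fun i => (hc k0 hk0 i j).trans h0] at h2
        simp at h2
      exact mul_self_pos.2 hne
  have hev : ∀ᶠ t : ℝ in Filter.atTop, ∀ i j, 0 < exp ((-t) • A) i j :=
    Filter.eventually_all.2 fun i => Filter.eventually_all.2 fun j =>
      (hlim i j).eventually (lt_mem_nhds (hlimpos i j))
  obtain ⟨T, hT⟩ := (hev.and (Filter.eventually_gt_atTop 0)).exists_forall_of_atTop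
  exact ⟨T, (hT T le_rfl).2, fun t ht => (hT t ht).1⟩

omit [DecidableEq ι] in
theorem mul_pos_of_pos [Nonempty ι] {P Q : Matrix ι ι ℝ} (hP : ∀ i j, 0 < P i j)
    (hQ : ∀ i j, 0 < Q i j) (i j : ι) : 0 < (P * Q) i j := by
  rw [mul_apply]
  exact Finset.sum_pos (fun k _ => mul_pos (hP i k) (hQ k j)) Finset.univ_nonempty

/-- Eventual strong positivity is an open property: by the semigroup law it is decided on a compact
interval of times. -/
theorem eventually_exists_forall_exp_pos [Nonempty ι] {T : ℝ} (hT : 0 < T)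
    (h : ∀ t : ℝ, T ≤ t → ∀ i j, 0 < exp ((-t) • A) i j) :
    ∀ᶠ B : Matrix ι ι ℝ in nhds A, ∃ t₀ : ℝ, 0 < t₀ ∧ ∀ t : ℝ, t₀ ≤ t → ∀ i j, 0 < exp ((-t) • B) i j := by
  have hcont : Continuous fun p : Matrix ι ι ℝ × ℝ => exp ((-p.2) • p.1) :=
    continuous_exp.comp (by fun_prop)
  have hev : ∀ᶠ B : Matrix ι ι ℝ in nhds A, ∀ t ∈ Set.Icc T (2 * T), ∀ i j, 0 < exp ((-t) • B) i j := by
    refine isCompact_Icc.eventually_forall_of_forall_eventually fun t ht => ?_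
    refine Filter.eventually_all.2 fun i => Filter.eventually_all.2 fun j => ?_
    have : ContinuousAt (fun p : Matrix ι ι ℝ × ℝ => exp ((-p.2) • p.1) i j) (A, t) :=
      ((continuous_apply j).comp ((continuous_apply i).comp hcont)).continuousAt
    exact this.eventually (lt_mem_nhds (h t ht.1 i j))
  filter_upwards [hev] with B hB
  refine ⟨T, hT, ?_⟩
  have hstep : ∀ n : ℕ, ∀ t ∈ Set.Icc T ((n + 2) * T), ∀ i j, 0 < exp ((-t) • B) i j := by
    intro n
    induction n with
    | zero => intro t ht; exact hB t (by simpa using ht)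
    | succ n ih =>
      intro t ht i j
      rcases le_total t (2 * T) with h2 | h2
      · exact hB t ⟨ht.1, h2⟩ i j
      · rw [show t = T + (t - T) by ring, exp_neg_smul_add]
        refine mul_pos_of_pos (hB T ⟨le_rfl, by linarith⟩) (ih _ ⟨by linarith, ?_⟩) i j
        have := ht.2
        push_cast at this
        linarith
  intro t ht
  obtain ⟨n, hn⟩ := exists_nat_ge (t / T)
  refine hstep n t ⟨ht, ?_⟩
  have := (div_le_iff₀ hT).1 hn
  nlinarith

end Matrix

/-! ### Schur complements and discrete harmonic functions -/

namespace Matrix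

variable {V : Type*} [Fintype V] [DecidableEq V]

/-- The block of `M` that belongs to the inner vertices. -/
def innerBlock (M : Matrix V V ℝ) (Vo : Finset V) : Matrix {v // v ∉ Vo} {v // v ∉ Vo} ℝ :=
  M.submatrix Subtype.val Subtype.val

/-- The Schur complement of the inner block of `M`, a matrix on the outer vertices. -/
noncomputable def schur (M : Matrix V V ℝ) (Vo : Finset V) : Matrix Vo Vo ℝ :=
  M.submatrix Subtype.val Subtype.val
    - M.submatrix (Subtype.val : Vo → V) (Subtype.val : {v // v ∉ Vo} → V) * (innerBlock M Vo)⁻¹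
      * M.submatrix (Subtype.val : {v // v ∉ Vo} → V) (Subtype.val : Vo → V)

variable {M : Matrix V V ℝ} {Vo : Finset V}

theorem mulVec_eq_sum_outer_add_inner (M : Matrix V V ℝ) (Vo : Finset V) (y : V → ℝ) (v : V) :
    (M *ᵥ y) v = ∑ w : Vo, M v w * y w + ∑ w : {v // v ∉ Vo}, M v w * y w := by
  rw [mulVec, dotProduct, ← Fintype.sum_subtype_add_sum_subtype (fun w => w ∈ Vo)]
  congr! 1
  exact Finset.sum_congr (by ext; simp) fun _ _ => rfl

theorem eq_zero_of_harmonic (hdet : (innerBlock M Vo).det ≠ 0) {y : V → ℝ}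
    (h0 : ∀ v ∈ Vo, y v = 0) (h : ∀ v ∉ Vo, (M *ᵥ y) v = 0) : y = 0 := by
  have key : innerBlock M Vo *ᵥ (fun w => y w) = 0 := by
    ext v
    have := h v v.2
    rw [mulVec_eq_sum_outer_add_inner M Vo, Finset.sum_eq_zero fun w _ => by rw [h0 w w.2, mul_zero],
      zero_add] at this
    exact this
  have h2 := eq_zero_of_mulVec_eq_zero hdet key
  ext v
  by_cases hv : v ∈ Vo
  · exact h0 v hv
  · exact congrFun h2 ⟨v, hv⟩

theorem harmonic_unique (hdet : (innerBlock M Vo).det ≠ 0) {y y' : V → ℝ}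
    (h0 : ∀ v ∈ Vo, y v = y' v) (h : ∀ v ∉ Vo, (M *ᵥ y) v = 0) (h' : ∀ v ∉ Vo, (M *ᵥ y') v = 0) :
    y = y' :=
  sub_eq_zero.1 <| eq_zero_of_harmonic hdet (fun v hv => by simp [h0 v hv])
    fun v hv => by rw [mulVec_sub, Pi.sub_apply, h v hv, h' v hv, sub_zero]

theorem exists_harmonic (hdet : (innerBlock M Vo).det ≠ 0) (x : Vo → ℝ) :
    ∃ y : V → ℝ, (∀ v : Vo, y v = x v) ∧ (∀ v ∉ Vo, (M *ᵥ y) v = 0) ∧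
      ∀ v : Vo, (M *ᵥ y) v = (schur M Vo *ᵥ x) v := by
  let N := M.submatrix (Subtype.val : {v // v ∉ Vo} → V) (Subtype.val : Vo → V)
  let z := -((innerBlock M Vo)⁻¹ *ᵥ (N *ᵥ x))
  let y : V → ℝ := fun v => if h : v ∈ Vo then x ⟨v, h⟩ else z ⟨v, h⟩
  have h1 : ∀ v : Vo, y v = x v := fun v => by simp [y]
  have h2 : ∀ v : {v // v ∉ Vo}, y v = z v := fun v => by simp [y, v.2]
  have hM : ∀ v, (M *ᵥ y) v = ∑ w : Vo, M v w * x w + ∑ w : {v // v ∉ Vo}, M v w * z w := fun v => by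
    rw [mulVec_eq_sum_outer_add_inner M Vo]; simp only [h1, h2]
  refine ⟨y, h1, fun v hv => ?_, fun v => ?_⟩
  · have e : (M *ᵥ y) v = (N *ᵥ x + innerBlock M Vo *ᵥ z) ⟨v, hv⟩ := hM v
    rw [e, mulVec_neg, mulVec_mulVec, mul_nonsing_inv _ (isUnit_iff_ne_zero.2 hdet), one_mulVec,
      add_neg_cancel, Pi.zero_apply]
  · have e : (M *ᵥ y) v = (M.submatrix (Subtype.val : Vo → V) (Subtype.val : Vo → V) *ᵥ x
        + M.submatrix (Subtype.val : Vo → V) (Subtype.val : {v // v ∉ Vo} → V) *ᵥ z) v := hM v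
    rw [e, schur, sub_mulVec, mulVec_neg, mulVec_mulVec, mulVec_mulVec, Matrix.mul_assoc,
      ← sub_eq_add_neg]

/-- The Schur complement maps the outer values of a function that is harmonic on the inner vertices
to its flux. -/
theorem schur_mulVec (hdet : (innerBlock M Vo).det ≠ 0) {y : V → ℝ}
    (h : ∀ v ∉ Vo, (M *ᵥ y) v = 0) (v : Vo) :
    (schur M Vo *ᵥ fun w => y w) v = (M *ᵥ y) v := by
  obtain ⟨y', h1, h2, h3⟩ := exists_harmonic hdet fun w : Vo => y w
  rw [← h3, harmonic_unique hdet (fun v hv => h1 ⟨v, hv⟩) h2 h]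

theorem schur_apply (hdet : (innerBlock M Vo).det ≠ 0) {y : V → ℝ} {w : Vo}
    (h0 : ∀ v : Vo, y v = (Pi.single w 1 : Vo → ℝ) v)
    (h : ∀ v ∉ Vo, (M *ᵥ y) v = 0) (v : Vo) : schur M Vo v w = (M *ᵥ y) v := by
  rw [← schur_mulVec hdet h, funext h0, mulVec_single_one, col_apply]

theorem schur_isSymm (hM : M.IsSymm) : (schur M Vo).IsSymm := by
  have h1 : (innerBlock M Vo)ᵀ = innerBlock M Vo := by
    rw [innerBlock, transpose_submatrix, hM]
  rw [IsSymm, schur, transpose_sub, transpose_mul, transpose_mul, transpose_nonsing_inv, h1]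
  simp only [transpose_submatrix, hM.eq, Matrix.mul_assoc]

theorem dotProduct_schur_mulVec (hdet : (innerBlock M Vo).det ≠ 0) {y : V → ℝ}
    (h : ∀ v ∉ Vo, (M *ᵥ y) v = 0) :
    (fun w : Vo => y w) ⬝ᵥ (schur M Vo *ᵥ fun w => y w) = y ⬝ᵥ M *ᵥ y := by
  rw [dotProduct, dotProduct, ← Fintype.sum_subtype_add_sum_subtype (fun w => w ∈ Vo),
    Finset.sum_eq_zero (s := (Finset.univ : Finset {v // v ∉ Vo}))
      fun v _ => by rw [h v v.2, mul_zero], add_zero]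
  have : ∀ v : Vo, y v * (schur M Vo *ᵥ fun w => y w) v = y v * (M *ᵥ y) v := fun v => by
    rw [schur_mulVec hdet h]
  rw [Finset.sum_congr rfl fun v _ => this v]
  exact Finset.sum_congr (by ext; simp) fun _ _ => rfl

omit [Fintype V] [DecidableEq V] in
theorem innerBlock_smul (k : ℝ) : innerBlock (k • M) Vo = k • innerBlock M Vo := rfl

theorem det_innerBlock_smul {k : ℝ} (hk : k ≠ 0) (hdet : (innerBlock M Vo).det ≠ 0) :
    (innerBlock (k • M) Vo).det ≠ 0 := by
  rw [innerBlock_smul, det_smul]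
  exact mul_ne_zero (pow_ne_zero _ hk) hdet

theorem schur_smul {k : ℝ} (hk : k ≠ 0) (hdet : (innerBlock M Vo).det ≠ 0) :
    schur (k • M) Vo = k • schur M Vo := by
  refine ext_of_mulVec_single fun w => ?_
  obtain ⟨y, h1, h2, h3⟩ := exists_harmonic hdet (Pi.single w (1 : ℝ))
  have hM : ∀ v, ((k • M) *ᵥ y) v = k * (M *ᵥ y) v := fun v => by
    rw [smul_mulVec]; rfl
  ext v
  rw [smul_mulVec, Pi.smul_apply, ← h3, ← funext h1,
    schur_mulVec (det_innerBlock_smul hk hdet) (fun v hv => by rw [hM, h2 v hv, mul_zero]), hM]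
  rfl

theorem continuousAt_schur (hdet : (innerBlock M Vo).det ≠ 0) :
    ContinuousAt (fun N : Matrix V V ℝ => schur N Vo) M := by
  have hib : Continuous fun N : Matrix V V ℝ => innerBlock N Vo :=
    continuous_id.matrix_submatrix _ _
  have hinv : ContinuousAt (fun N : Matrix V V ℝ => (innerBlock N Vo)⁻¹) M := by
    have : (fun N : Matrix V V ℝ => (innerBlock N Vo)⁻¹)
        = fun N => ((innerBlock N Vo).det)⁻¹ • (innerBlock N Vo).adjugate := by
      ext1 N; rw [inv_def, Ring.inverse_eq_inv']
    rw [this]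
    exact (hib.matrix_det.continuousAt.inv₀ hdet).smul hib.matrix_adjugate.continuousAt
  have hinv' : ∀ a b, ContinuousAt (fun N : Matrix V V ℝ => (innerBlock N Vo)⁻¹ a b) M := fun a b =>
    continuousAt_pi.1 (continuousAt_pi.1 hinv a) b
  have he : ∀ a b, ContinuousAt (fun N : Matrix V V ℝ => N a b) M := fun a b =>
    continuousAt_pi.1 (continuousAt_pi.1 continuousAt_id a) b
  refine continuousAt_pi.2 fun v => continuousAt_pi.2 fun w => ?_
  simp only [schur, sub_apply, mul_apply, submatrix_apply]
  exact (he _ _).sub (tendsto_finsetSum _ fun b _ => (tendsto_finsetSum _ fun a _ =>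
    (he _ _).mul (hinv' a b)).mul (he _ _))

/-- Positive definiteness of `M` on the functions that vanish on the outer vertices. -/
def DirichletPosDef (M : Matrix V V ℝ) (Vo : Finset V) : Prop :=
  ∀ y : V → ℝ, (∀ v ∈ Vo, y v = 0) → y ≠ 0 → 0 < y ⬝ᵥ M *ᵥ y

theorem dotProduct_mulVec_eq_zero {y : V → ℝ} (h0 : ∀ v ∈ Vo, y v = 0)
    (h : ∀ v ∉ Vo, (M *ᵥ y) v = 0) : y ⬝ᵥ M *ᵥ y = 0 :=
  Finset.sum_eq_zero fun v _ => by
    by_cases hv : v ∈ Vo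
    · rw [h0 v hv, zero_mul]
    · rw [h v hv, mul_zero]

theorem exists_harmonic_of_det_eq_zero (hdet : (innerBlock M Vo).det = 0) :
    ∃ y : V → ℝ, y ≠ 0 ∧ (∀ v ∈ Vo, y v = 0) ∧ ∀ v ∉ Vo, (M *ᵥ y) v = 0 := by
  obtain ⟨z, hz, hz0⟩ := exists_mulVec_eq_zero_iff.2 hdet
  let y : V → ℝ := fun v => if h : v ∈ Vo then 0 else z ⟨v, h⟩
  have h1 : ∀ v ∈ Vo, y v = 0 := fun v hv => by simp [y, hv]
  have h2 : ∀ v : {v // v ∉ Vo}, y v = z v := fun v => by simp [y, v.2]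
  refine ⟨y, fun hy => hz (funext fun v => by rw [← h2, hy]; rfl), h1, fun v hv => ?_⟩
  rw [mulVec_eq_sum_outer_add_inner M Vo, Finset.sum_eq_zero fun w _ => by rw [h1 w w.2, mul_zero],
    zero_add]
  simp only [h2]
  exact congrFun hz0 ⟨v, hv⟩

theorem DirichletPosDef.det_ne_zero (h : DirichletPosDef M Vo) : (innerBlock M Vo).det ≠ 0 := by
  intro hdet
  obtain ⟨y, hy, h0, h1⟩ := exists_harmonic_of_det_eq_zero hdet
  exact (h y h0 hy).ne' (dotProduct_mulVec_eq_zero h0 h1)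

omit [DecidableEq V] in
/-- Positive definiteness is an open condition, as the unit sphere is compact. -/
theorem DirichletPosDef.eventually (h : DirichletPosDef M Vo) :
    ∀ᶠ N in nhds M, DirichletPosDef N Vo := by
  have hK : IsCompact (Metric.sphere (0 : V → ℝ) 1 ∩ {y | ∀ v ∈ Vo, y v = 0}) := by
    refine (isCompact_sphere 0 1).inter_right ?_
    simp only [Set.ofPred_forall]
    exact isClosed_iInter fun v => isClosed_iInter fun _ =>
      isClosed_eq (continuous_apply v) continuous_const
  have hcont : Continuous fun p : Matrix V V ℝ × (V → ℝ) => p.2 ⬝ᵥ p.1 *ᵥ p.2 :=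
    continuous_snd.dotProduct (continuous_fst.matrix_mulVec continuous_snd)
  have hev : ∀ᶠ N in nhds M, ∀ y ∈ Metric.sphere (0 : V → ℝ) 1 ∩ {y | ∀ v ∈ Vo, y v = 0},
      0 < y ⬝ᵥ N *ᵥ y := by
    refine hK.eventually_forall_of_forall_eventually fun y hy => ?_
    exact hcont.continuousAt.eventually (lt_mem_nhds (h y hy.2 fun h0 => by
      have := hy.1; rw [h0] at this; simp at this))
  filter_upwards [hev] with N hN y hy hy0
  have hn : ‖y‖ ≠ 0 := norm_ne_zero_iff.2 hy0
  have := hN (‖y‖⁻¹ • y) ⟨by simp [norm_smul, hn], fun v hv => by simp [hy v hv]⟩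
  rw [mulVec_smul, dotProduct_smul, smul_dotProduct, smul_eq_mul, smul_eq_mul] at this
  have hpos : 0 < ‖y‖⁻¹ := by positivity
  exact pos_of_mul_pos_right (pos_of_mul_pos_right this hpos.le) hpos.le

section ZMatrix

variable (hoff : ∀ v w, v ≠ w → M v w ≤ 0)

include hoff

/-- The minimum principle. -/
theorem DirichletPosDef.nonneg (h : DirichletPosDef M Vo) {y : V → ℝ} (h0 : ∀ v ∈ Vo, 0 ≤ y v)
    (h1 : ∀ v ∉ Vo, 0 ≤ (M *ᵥ y) v) (v : V) : 0 ≤ y v := by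
  let n : V → ℝ := fun v => max (-y v) 0
  have hn0 : ∀ v, 0 ≤ n v := fun v => le_max_right _ _
  have hn : ∀ v ∈ Vo, n v = 0 := fun v hv => max_eq_right (by linarith [h0 v hv])
  have hterm : ∀ v w, n v * (M v w * (y w + n w)) ≤ 0 := fun v w => by
    have hp : 0 ≤ y w + n w := by have := le_max_left (-y w) 0; simp only [n]; linarith
    by_cases hvw : v = w
    · subst hvw
      have : n v * (y v + n v) = 0 := by
        rcases le_total (y v) 0 with hy | hy
        · rw [show n v = -y v from max_eq_left (by linarith)]; ring
        · rw [show n v = 0 from max_eq_right (by linarith)]; ring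
      rw [mul_left_comm, this, mul_zero]
    · exact mul_nonpos_of_nonneg_of_nonpos (hn0 v)
        (mul_nonpos_of_nonpos_of_nonneg (hoff v w hvw) hp)
  have h2 : n ⬝ᵥ M *ᵥ (y + n) ≤ 0 := by
    simp only [dotProduct, mulVec, Finset.mul_sum, Pi.add_apply]
    exact Finset.sum_nonpos fun v _ => Finset.sum_nonpos fun w _ => hterm v w
  have h3 : 0 ≤ n ⬝ᵥ M *ᵥ y := Finset.sum_nonneg fun v _ => by
    by_cases hv : v ∈ Vo
    · rw [hn v hv, zero_mul]
    · exact mul_nonneg (hn0 v) (h1 v hv)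
  rw [mulVec_add, dotProduct_add] at h2
  have h4 : n = 0 := by
    by_contra hne
    have := h n hn hne
    linarith
  have := congrFun h4 v
  have h5 := le_max_left (-y v) 0
  simp only [n, Pi.zero_apply] at this
  linarith

/-- The strong minimum principle. -/
theorem eq_zero_of_harmonic_of_eq_zero {y : V → ℝ} (hy : ∀ v, 0 ≤ y v) {z : V}
    (hz : (M *ᵥ y) z = 0) (hz0 : y z = 0) {u : V} (hu : M z u < 0) : y u = 0 := by
  have hle : ∀ w ∈ Finset.univ, M z w * y w ≤ 0 := fun w _ => by
    by_cases hw : z = w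
    · rw [← hw, hz0, mul_zero]
    · exact mul_nonpos_of_nonpos_of_nonneg (hoff z w hw) (hy w)
  have := (Finset.sum_eq_zero_iff_of_nonpos hle).1 hz u (Finset.mem_univ u)
  exact (mul_eq_zero.1 this).resolve_left hu.ne

theorem DirichletPosDef.schur_nonpos (h : DirichletPosDef M Vo) {v w : Vo} (hvw : v ≠ w) :
    schur M Vo v w ≤ 0 := by
  obtain ⟨y, h1, h2, h3⟩ := exists_harmonic h.det_ne_zero (Pi.single w (1 : ℝ))
  have hy : ∀ u, 0 ≤ y u := h.nonneg hoff
    (fun u hu => by rw [h1 ⟨u, hu⟩, Pi.single_apply]; split_ifs <;> norm_num)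
    (fun u hu => (h2 u hu).ge)
  rw [schur_apply h.det_ne_zero h1 h2]
  refine Finset.sum_nonpos fun u _ => ?_
  by_cases hu : (v : V) = u
  · rw [← hu, h1, Pi.single_eq_of_ne hvw, mul_zero]
  · exact mul_nonpos_of_nonpos_of_nonneg (hoff v u hu) (hy u)

/-- The Schur complement of an irreducible matrix is irreducible. -/
theorem DirichletPosDef.schur_reflTransGen (h : DirichletPosDef M Vo)
    (hsymm : M.IsSymm) (hconn : ∀ v w, Relation.ReflTransGen (fun v w => M v w < 0) v w) (v w : Vo) :
    Relation.ReflTransGen (fun v w => schur M Vo v w < 0) v w := by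
  choose y h1 h2 h3 using fun u : Vo => exists_harmonic h.det_ne_zero (Pi.single u (1 : ℝ))
  have hy : ∀ u a, 0 ≤ y u a := fun u => h.nonneg hoff
    (fun a ha => by rw [h1 u ⟨a, ha⟩, Pi.single_apply]; split_ifs <;> norm_num)
    (fun a ha => (h2 u a ha).ge)
  have key : ∀ a : V, ∃ u : Vo, Relation.ReflTransGen (fun v w => schur M Vo v w < 0) u w
      ∧ 0 < y u a := fun a => by
    induction hconn w a with
    | refl => exact ⟨w, .refl, by rw [h1, Pi.single_eq_same]; exact one_pos⟩
    | @tail a a' _ haa' ih =>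
      obtain ⟨u, hu, hua⟩ := ih
      have ha'a : M a' a < 0 := by rw [← hsymm.apply a' a]; exact haa'
      by_cases ha' : a' ∈ Vo
      · by_cases hne : (⟨a', ha'⟩ : Vo) = u
        · exact ⟨u, hu, by rw [h1 u ⟨a', ha'⟩, hne, Pi.single_eq_same]; exact one_pos⟩
        · refine ⟨⟨a', ha'⟩, .head ?_ hu, by rw [h1 ⟨a', ha'⟩ ⟨a', ha'⟩, Pi.single_eq_same]; exact one_pos⟩
          refine lt_of_le_of_ne (h.schur_nonpos hoff hne) fun h0 => hua.ne' ?_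
          rw [schur_apply h.det_ne_zero (h1 u) (h2 u)] at h0
          exact eq_zero_of_harmonic_of_eq_zero hoff (hy u) h0
            (by rw [h1 u ⟨a', ha'⟩, Pi.single_eq_of_ne hne]) ha'a
      · refine ⟨u, hu, lt_of_le_of_ne (hy u a') fun h0 => hua.ne' ?_⟩
        exact eq_zero_of_harmonic_of_eq_zero hoff (hy u) (h2 u a' ha') h0.symm ha'a
  obtain ⟨u, hu, huv⟩ := key v
  have : v = u := by
    by_contra hne
    rw [h1, Pi.single_eq_of_ne hne] at huv
    exact huv.ne rfl
  exact this ▸ hu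

theorem DirichletPosDef.stronglyPositive (h : DirichletPosDef M Vo) (hsymm : M.IsSymm)
    (hconn : ∀ v w, Relation.ReflTransGen (fun v w => M v w < 0) v w) :
    SemigroupStronglyPositive ((schur M Vo).map Complex.ofReal) :=
  semigroupStronglyPositive_map_iff.2 fun _ ht => exp_neg_smul_pos
    (fun _ _ hij => h.schur_nonpos hoff hij) (h.schur_reflTransGen hoff hsymm hconn) ht

end ZMatrix

end Matrix

/-! ### Network matrices -/

namespace QuantumGraph

open Matrix

variable {V : Type*} [Fintype V] [DecidableEq V] {G : QuantumGraph V}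

variable (G) in
/-- The matrix on the vertices to which every edge `e` contributes the block
`!![c e, -s e; -s e, c e]`. For `c = s` this is the weighted graph Laplacian. -/
noncomputable def netMatrix (c s : G.Edge → ℝ) : Matrix V V ℝ :=
  Matrix.of fun v w => ∑ e : G.Edge,
    ((if G.left e = v then c e * (if G.left e = w then 1 else 0)
        - s e * (if G.right e = w then 1 else 0) else 0)
      + (if G.right e = v then c e * (if G.right e = w then 1 else 0)
        - s e * (if G.left e = w then 1 else 0) else 0))

variable {c s : G.Edge → ℝ}

theorem netMatrix_mulVec (y : V → ℝ) (v : V) :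
    (G.netMatrix c s *ᵥ y) v = ∑ e : G.Edge,
      ((if G.left e = v then c e * y (G.left e) - s e * y (G.right e) else 0)
      + (if G.right e = v then c e * y (G.right e) - s e * y (G.left e) else 0)) := by
  have hδ : ∀ a : V, ∑ w, (if a = w then (1 : ℝ) else 0) * y w = y a := fun a => by simp
  simp only [mulVec, dotProduct, netMatrix, Matrix.of_apply, Finset.sum_mul]
  rw [Finset.sum_comm]
  refine Finset.sum_congr rfl fun e _ => ?_
  have hl : ∀ (a b : V) (p q : ℝ), ∑ w, (p * (if a = w then (1 : ℝ) else 0)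
      - q * (if b = w then 1 else 0)) * y w = p * y a - q * y b := fun a b p q => by
    simp only [sub_mul, mul_assoc, Finset.sum_sub_distrib, ← Finset.mul_sum, hδ]
  simp only [add_mul, Finset.sum_add_distrib]
  congr 1
  · split_ifs
    · exact hl _ _ _ _
    · simp
  · split_ifs
    · exact hl _ _ _ _
    · simp

theorem dotProduct_netMatrix_mulVec (z y : V → ℝ) :
    z ⬝ᵥ G.netMatrix c s *ᵥ y = ∑ e : G.Edge,
      (z (G.left e) * (c e * y (G.left e) - s e * y (G.right e))
      + z (G.right e) * (c e * y (G.right e) - s e * y (G.left e))) := by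
  simp only [dotProduct, netMatrix_mulVec, Finset.mul_sum]
  rw [Finset.sum_comm]
  refine Finset.sum_congr rfl fun e _ => ?_
  simp [mul_add, Finset.sum_add_distrib]

omit [Fintype V] [DecidableEq V] in
theorem left_ne_right (e : G.Edge) : G.left e ≠ G.right e := fun h => by
  have := e.2
  rw [← G.endpoints e, h] at this
  exact G.graph.loopless.irrefl _ this

omit [Fintype V] [DecidableEq V] in
theorem adj_left_right (e : G.Edge) : G.graph.Adj (G.left e) (G.right e) := by
  have := e.2
  rw [← G.endpoints e] at this
  exact this

omit [Fintype V] [DecidableEq V] in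
theorem exists_edge_of_adj {v w : V} (h : G.graph.Adj v w) :
    ∃ e : G.Edge, (G.left e = v ∧ G.right e = w) ∨ (G.left e = w ∧ G.right e = v) := by
  refine ⟨⟨s(v, w), h⟩, ?_⟩
  have := G.endpoints ⟨s(v, w), h⟩
  simpa using this

theorem netMatrix_isSymm : (G.netMatrix c s).IsSymm := by
  ext v w
  rw [transpose_apply]
  simp only [netMatrix, of_apply]
  refine Finset.sum_congr rfl fun e _ => ?_
  have := left_ne_right e
  split_ifs <;> simp_all

theorem netMatrix_apply_nonpos (hs : ∀ e, 0 ≤ s e) {v w : V} (hvw : v ≠ w) :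
    G.netMatrix c s v w ≤ 0 := by
  refine Finset.sum_nonpos fun e _ => ?_
  have := left_ne_right e
  have := hs e
  split_ifs <;> simp_all

theorem netMatrix_apply_neg_of_edge (hs : ∀ e, 0 ≤ s e) {v w : V} {e₀ : G.Edge}
    (he₀ : (G.left e₀ = v ∧ G.right e₀ = w) ∨ (G.left e₀ = w ∧ G.right e₀ = v)) (hs₀ : 0 < s e₀) :
    G.netMatrix c s v w < 0 := by
  have hne : v ≠ w := by
    rcases he₀ with ⟨h1, h2⟩ | ⟨h1, h2⟩
    · rw [← h1, ← h2]; exact left_ne_right e₀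
    · rw [← h1, ← h2]; exact (left_ne_right e₀).symm
  refine Finset.sum_neg' (fun e _ => ?_) ⟨e₀, Finset.mem_univ _, ?_⟩
  · have := left_ne_right e
    have := hs e
    split_ifs <;> simp_all
  · have := left_ne_right e₀
    have := this.symm
    rcases he₀ with ⟨h1, h2⟩ | ⟨h1, h2⟩
    · subst h1; subst h2; simp_all
    · subst h1; subst h2; simp_all

theorem netMatrix_apply_neg (hs : ∀ e, 0 < s e) {v w : V} (hvw : G.graph.Adj v w) :
    G.netMatrix c s v w < 0 := by
  obtain ⟨e₀, he₀⟩ := exists_edge_of_adj hvw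
  exact netMatrix_apply_neg_of_edge (fun e => (hs e).le) he₀ (hs e₀)

theorem netMatrix_reflTransGen (hG : G.graph.Connected) (hs : ∀ e, 0 < s e) (v w : V) :
    Relation.ReflTransGen (fun v w => G.netMatrix c s v w < 0) v w :=
  Relation.ReflTransGen.mono (fun _ _ h => netMatrix_apply_neg hs h) _ _
    ((SimpleGraph.reachable_iff_reflTransGen v w).1 (hG.preconnected v w))

theorem netMatrix_smul (k : ℝ) : G.netMatrix (k • c) (k • s) = k • G.netMatrix c s := by
  ext v w
  simp only [netMatrix, of_apply, Matrix.smul_apply, smul_eq_mul, Finset.mul_sum, Pi.smul_apply]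
  refine Finset.sum_congr rfl fun e _ => ?_
  split_ifs <;> ring

theorem continuous_netMatrix :
    Continuous fun p : (G.Edge → ℝ) × (G.Edge → ℝ) => G.netMatrix p.1 p.2 := by
  refine continuous_matrix fun v w => ?_
  simp only [netMatrix, of_apply]
  refine continuous_finsetSum _ fun e _ => ?_
  split_ifs <;> fun_prop

omit [Fintype V] [DecidableEq V] in
theorem eq_of_forall_edge {y : V → ℝ} (hG : G.graph.Connected)
    (h : ∀ e : G.Edge, y (G.left e) = y (G.right e)) (v w : V) : y v = y w := by
  induction (SimpleGraph.reachable_iff_reflTransGen v w).1 (hG.preconnected v w) with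
  | refl => rfl
  | tail _ hab ih =>
    obtain ⟨e, ⟨h1, h2⟩ | ⟨h1, h2⟩⟩ := exists_edge_of_adj hab
    · rw [ih, ← h1, ← h2, h e]
    · rw [ih, ← h1, ← h2, h e]

theorem netMatrix_dirichletPosDef (hG : G.graph.Connected) {Vo : Finset V} (hVo : Vo.Nonempty)
    (hs : ∀ e, 0 < s e) (hcs : ∀ e, s e ≤ c e) : DirichletPosDef (G.netMatrix c s) Vo := by
  intro y h0 hy
  rw [dotProduct_netMatrix_mulVec]
  have hterm : ∀ e, y (G.left e) * (c e * y (G.left e) - s e * y (G.right e))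
      + y (G.right e) * (c e * y (G.right e) - s e * y (G.left e))
      = (c e - s e) * (y (G.left e) ^ 2 + y (G.right e) ^ 2)
        + s e * (y (G.left e) - y (G.right e)) ^ 2 := fun e => by ring
  have hnn : ∀ e, 0 ≤ (c e - s e) * (y (G.left e) ^ 2 + y (G.right e) ^ 2) := fun e =>
    mul_nonneg (sub_nonneg.2 (hcs e)) (by positivity)
  have hnn' : ∀ e, 0 ≤ s e * (y (G.left e) - y (G.right e)) ^ 2 := fun e =>
    mul_nonneg (hs e).le (sq_nonneg _)
  simp only [hterm]
  refine lt_of_le_of_ne (Finset.sum_nonneg fun e _ => add_nonneg (hnn e) (hnn' e)) fun hsum => hy ?_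
  have hz := (Finset.sum_eq_zero_iff_of_nonneg fun e _ => add_nonneg (hnn e) (hnn' e)).1 hsum.symm
  obtain ⟨w, hw⟩ := hVo
  ext v
  rw [Pi.zero_apply, ← h0 w hw]
  refine eq_of_forall_edge hG (fun e => ?_) v w
  have h1 : s e * (y (G.left e) - y (G.right e)) ^ 2 = 0 := by
    have := hz e (Finset.mem_univ e); linarith [hnn e, hnn' e]
  have h2 := (mul_eq_zero.1 h1).resolve_left (hs e).ne'
  exact sub_eq_zero.1 (pow_eq_zero_iff (two_ne_zero) |>.1 h2)

section Bridge

variable (G) (lam : ℝ)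

/-- The diagonal coefficients `C / S` of the network matrix of the equation `u'' + lam u = 0`, where
`C` and `S` are the values of the fundamental solutions at the right end points. -/
noncomputable def edgeDiag (e : G.Edge) : ℝ := cosSol lam (G.length e) / sinSol lam (G.length e)

/-- The off-diagonal coefficients `1 / S` of the network matrix of the equation `u'' + lam u = 0`.
-/
noncomputable def edgeOff (e : G.Edge) : ℝ := (sinSol lam (G.length e))⁻¹

variable {G lam}

/-- If no edge is resonant, the flux of a function with real vertex values is given by the network
matrix. -/
theorem flux_ofReal (hS : ∀ e : G.Edge, sinSol lam (G.length e) ≠ 0) (y : V → ℝ) (v : V) :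
    flux lam (fun e => (((y (G.right e) - cosSol lam (G.length e) * y (G.left e))
      / sinSol lam (G.length e) : ℝ) : ℂ)) (fun v => (y v : ℂ)) v
      = ((G.netMatrix (G.edgeDiag lam) (G.edgeOff lam) *ᵥ y) v : ℝ) := by
  classical
  simp only [flux]
  rw [netMatrix_mulVec, Finset.sum_filter, Finset.sum_filter, ← Finset.sum_neg_distrib,
    ← Finset.sum_add_distrib, Complex.ofReal_sum]
  refine Finset.sum_congr rfl fun e _ => ?_
  have h1 := hS e
  rw [Complex.ofReal_add]
  congr 1
  · split_ifs
    · rw [← Complex.ofReal_neg]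
      congr 1
      rw [edgeDiag, edgeOff]; field_simp; ring
    · simp
  · split_ifs
    · rw [← Complex.ofReal_mul, ← Complex.ofReal_mul, ← Complex.ofReal_mul, ← Complex.ofReal_sub]
      congr 1
      rw [edgeDiag, edgeOff]; field_simp
      linear_combination -y (G.left e) * cosSol_sq_add lam (G.length e)
    · simp

omit [Fintype V] [DecidableEq V] in
theorem edgeCompat_ofReal (hS : ∀ e : G.Edge, sinSol lam (G.length e) ≠ 0) (y : V → ℝ) :
    EdgeCompat lam (fun e => (((y (G.right e) - cosSol lam (G.length e) * y (G.left e))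
      / sinSol lam (G.length e) : ℝ) : ℂ)) (fun v => (y v : ℂ)) := fun e => by
  rw [← Complex.ofReal_mul, ← Complex.ofReal_mul, ← Complex.ofReal_add]
  congr 1
  have h1 := hS e
  field_simp; ring

theorem nonResonant_of_det_ne_zero {Vo : Finset V} (hS : ∀ e : G.Edge, sinSol lam (G.length e) ≠ 0)
    (hdet : (innerBlock (G.netMatrix (G.edgeDiag lam) (G.edgeOff lam)) Vo).det ≠ 0) :
    G.NonResonant Vo lam := by
  intro b y hc hy hf
  let B : (V → ℝ) → G.Edge → ℂ := fun y e =>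
    (((y (G.right e) - cosSol lam (G.length e) * y (G.left e)) / sinSol lam (G.length e) : ℝ) : ℂ)
  let y1 : V → ℝ := fun v => (y v).re
  let y2 : V → ℝ := fun v => (y v).im
  have hyd : y = (fun v => (y1 v : ℂ)) + Complex.I • (fun v => (y2 v : ℂ)) := by
    ext v; simp only [Pi.add_apply, Pi.smul_apply, smul_eq_mul, mul_comm Complex.I]
    exact (Complex.re_add_im (y v)).symm
  have hS' : ∀ e : G.Edge, (sinSol lam (G.length e) : ℂ) ≠ 0 := fun e => by exact_mod_cast hS e
  have hbd : b = B y1 + Complex.I • B y2 := by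
    ext e
    refine mul_left_cancel₀ (hS' e) ?_
    have h1 := edgeCompat_ofReal hS y1 e
    have h2 := edgeCompat_ofReal hS y2 e
    have h3 := hc e
    rw [hyd] at h3
    simp only [Pi.add_apply, Pi.smul_apply, smul_eq_mul] at h3 ⊢
    simp only [B]
    linear_combination h3 - h1 - Complex.I * h2
  have hflux : ∀ v ∉ Vo, (G.netMatrix (G.edgeDiag lam) (G.edgeOff lam) *ᵥ y1) v = 0 ∧
      (G.netMatrix (G.edgeDiag lam) (G.edgeOff lam) *ᵥ y2) v = 0 := fun v hv => by
    have h1 := hf v hv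
    rw [hyd, hbd, flux_add, flux_smul, flux_ofReal hS, flux_ofReal hS] at h1
    have h2 := congrArg Complex.re h1
    have h3 := congrArg Complex.im h1
    simp at h2 h3
    exact ⟨h2, h3⟩
  have e1 := eq_zero_of_harmonic hdet (y := y1) (fun v hv => by simp [y1, hy v hv])
    (fun v hv => (hflux v hv).1)
  have e2 := eq_zero_of_harmonic hdet (y := y2) (fun v hv => by simp [y2, hy v hv])
    (fun v hv => (hflux v hv).2)
  constructor
  · rw [hbd, e1, e2]; ext e; simp [B]
  · rw [hyd, e1, e2]; ext v; simp

/-- If no edge is resonant, the Dirichlet-to-Neumann matrix is a Schur complement. -/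
theorem dtnMatrix_eq_schur {Vo : Finset V} (hS : ∀ e : G.Edge, sinSol lam (G.length e) ≠ 0)
    (hdet : (innerBlock (G.netMatrix (G.edgeDiag lam) (G.edgeOff lam)) Vo).det ≠ 0) :
    G.dtnMatrix Vo lam
      = (schur (G.netMatrix (G.edgeDiag lam) (G.edgeOff lam)) Vo).map Complex.ofReal := by
  ext v w
  obtain ⟨y, h1, h2, h3⟩ := exists_harmonic hdet (Pi.single w (1 : ℝ))
  rw [(nonResonant_of_det_ne_zero hS hdet).dtnMatrix_apply (edgeCompat_ofReal hS y)
    (fun v => by rw [h1, Pi.single_apply, Pi.single_apply]; split_ifs <;> simp)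
    (fun v hv => by rw [flux_ofReal hS, h2 v hv, Complex.ofReal_zero]), flux_ofReal hS,
    ← schur_apply hdet h1 h2]
  rfl

theorem nonResonant_det_ne_zero {Vo : Finset V} (hS : ∀ e : G.Edge, sinSol lam (G.length e) ≠ 0)
    (h : G.NonResonant Vo lam) :
    (innerBlock (G.netMatrix (G.edgeDiag lam) (G.edgeOff lam)) Vo).det ≠ 0 := by
  intro hdet
  obtain ⟨y, hy, h0, h1⟩ := exists_harmonic_of_det_eq_zero hdet
  have := (h _ _ (edgeCompat_ofReal hS y) (fun v hv => by rw [h0 v hv, Complex.ofReal_zero])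
    (fun v hv => by rw [flux_ofReal hS, h1 v hv, Complex.ofReal_zero])).2
  exact hy (funext fun v => Complex.ofReal_eq_zero.1 (congrFun this v))

end Bridge

end QuantumGraph

/-! ### Below the first eigenvalue -/

theorem sinSol_pos_of_nonpos {lam x : ℝ} (h : lam ≤ 0) (hx : 0 < x) : 0 < sinSol lam x := by
  refine intervalIntegral.intervalIntegral_pos_of_pos
    ((continuous_cosSol lam).intervalIntegrable _ _) (fun t => ?_) hx
  rw [cosSol_of_nonpos h]; exact Real.cosh_pos _

theorem sinSol_pos {lam x : ℝ} (hx : 0 < x) (h : lam < (Real.pi / x) ^ 2) : 0 < sinSol lam x := by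
  rcases le_or_gt lam 0 with h0 | h0
  · exact sinSol_pos_of_nonpos h0 hx
  · have hs : 0 < √lam := Real.sqrt_pos.2 h0
    have h1 : √lam * x < Real.pi := by
      rw [← lt_div_iff₀ hx]
      exact (Real.sqrt_lt' (by positivity)).2 h
    have h2 := Real.sin_pos_of_pos_of_lt_pi (by positivity) h1
    rw [← sqrt_mul_sinSol h0.le] at h2
    exact pos_of_mul_pos_right h2 hs.le

theorem sinSol_eq_zero_of_sq {x : ℝ} (hx : 0 < x) : sinSol ((Real.pi / x) ^ 2) x = 0 := by
  have h := sqrt_mul_sinSol (lam := (Real.pi / x) ^ 2) (by positivity) x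
  rw [Real.sqrt_sq (by positivity), div_mul_cancel₀ _ hx.ne', Real.sin_pi] at h
  exact (mul_eq_zero.1 h).resolve_left (by positivity)

theorem cosSol_eq_neg_one_of_sq {x : ℝ} (hx : 0 < x) : cosSol ((Real.pi / x) ^ 2) x = -1 := by
  rw [cosSol_of_nonneg (by positivity), Real.sqrt_sq (by positivity), div_mul_cancel₀ _ hx.ne',
    Real.cos_pi]

namespace Matrix

variable {V : Type*} [Fintype V] [DecidableEq V] {M : Matrix V V ℝ} {Vo : Finset V}

/-- A non-degenerate positive semidefinite form is positive definite. -/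
theorem dirichletPosDef_of_nonneg (hM : M.IsSymm) (hdet : (innerBlock M Vo).det ≠ 0)
    (h : ∀ y : V → ℝ, (∀ v ∈ Vo, y v = 0) → 0 ≤ y ⬝ᵥ M *ᵥ y) : DirichletPosDef M Vo := by
  intro y h0 hy
  refine lt_of_le_of_ne (h y h0) fun hq => hy (eq_zero_of_harmonic hdet h0 fun v hv => ?_)
  -- the form is minimal at `y`, so its derivative in the direction of `v` vanishes
  set z : V → ℝ := Pi.single v 1 with hz
  have hzM : z ⬝ᵥ M *ᵥ y = (M *ᵥ y) v := by simp [hz]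
  have hMz : y ⬝ᵥ M *ᵥ z = (M *ᵥ y) v := by
    rw [← hzM, dotProduct_mulVec, ← mulVec_transpose, hM.eq, dotProduct_comm]
  have key : ∀ t : ℝ, 0 ≤ 2 * t * (M *ᵥ y) v + t ^ 2 * (z ⬝ᵥ M *ᵥ z) := fun t => by
    have := h (y + t • z) fun w hw => by
      have : w ≠ v := fun h => hv (h ▸ hw)
      simp [h0 w hw, hz, this]
    rw [mulVec_add, mulVec_smul, dotProduct_add, add_dotProduct, add_dotProduct, ← hq,
      smul_dotProduct, smul_dotProduct, dotProduct_smul, dotProduct_smul, hzM, hMz] at this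
    simp only [smul_eq_mul] at this
    linarith
  by_contra hne
  set a := (M *ᵥ y) v
  set q := z ⬝ᵥ M *ᵥ z
  have hq1 : 0 < |q| + 1 := by positivity
  have h1 := key (-a / (|q| + 1))
  have h2 : 2 * (-a / (|q| + 1)) * a + (-a / (|q| + 1)) ^ 2 * q
      = a ^ 2 / (|q| + 1) ^ 2 * (q - 2 * (|q| + 1)) := by field_simp; ring
  rw [h2] at h1
  have h3 : 0 < a ^ 2 / (|q| + 1) ^ 2 := by positivity
  have h4 : q - 2 * (|q| + 1) < 0 := by have := le_abs_self q; have := abs_nonneg q; linarith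
  nlinarith

end Matrix

namespace QuantumGraph

theorem flux_congr {V : Type*} [Fintype V] {G : QuantumGraph V} {lam : ℝ} {b b' : G.Edge → ℂ}
    {y y' : V → ℂ} {v : V} (hl : ∀ e, G.left e = v → b e = b' e)
    (hr : ∀ e, G.right e = v → b e = b' e ∧ y (G.left e) = y' (G.left e)) :
    flux lam b y v = flux lam b' y' v := by
  simp only [flux, Finset.sum_filter]
  congr 1
  · refine congrArg _ (Finset.sum_congr rfl fun e _ => ?_)
    split_ifs with h
    exacts [hl e h, rfl]
  · refine Finset.sum_congr rfl fun e _ => ?_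
    split_ifs with h
    exacts [by rw [(hr e h).1, (hr e h).2], rfl]

open Matrix

variable {V : Type*} [Fintype V] [DecidableEq V] {G : QuantumGraph V}

theorem continuousAt_netMatrix_edge {lam : ℝ} (hS : ∀ e : G.Edge, sinSol lam (G.length e) ≠ 0) :
    ContinuousAt (fun mu => G.netMatrix (G.edgeDiag mu) (G.edgeOff mu)) lam := by
  refine continuousAt_pi.2 fun v => continuousAt_pi.2 fun w => ?_
  have hc : ∀ e : G.Edge, ContinuousAt (fun mu => G.edgeDiag mu e) lam := fun e =>
    ContinuousAt.div (f := fun mu => cosSol mu (G.length e)) (g := fun mu => sinSol mu (G.length e))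
      (continuous_cosSol_left _).continuousAt (continuous_sinSol_left _).continuousAt (hS e)
  have hs : ∀ e : G.Edge, ContinuousAt (fun mu => G.edgeOff mu e) lam := fun e =>
    ContinuousAt.inv₀ (f := fun mu => sinSol mu (G.length e))
      (continuous_sinSol_left _).continuousAt (hS e)
  simp only [netMatrix, of_apply]
  refine tendsto_finsetSum _ fun e _ => ?_
  refine Filter.Tendsto.add ?_ ?_
  · split_ifs
    · exact ((hc e).mul_const _).sub ((hs e).mul_const _)
    · exact ((hc e).mul_const _).sub ((hs e).mul_const _)
    · exact ((hc e).mul_const _).sub ((hs e).mul_const _)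
    · exact ((hc e).mul_const _).sub ((hs e).mul_const _)
    · exact tendsto_const_nhds
  · split_ifs
    · exact ((hc e).mul_const _).sub ((hs e).mul_const _)
    · exact ((hc e).mul_const _).sub ((hs e).mul_const _)
    · exact ((hc e).mul_const _).sub ((hs e).mul_const _)
    · exact ((hc e).mul_const _).sub ((hs e).mul_const _)
    · exact tendsto_const_nhds

theorem stronglyPositive_of_dirichletPosDef (hG : G.graph.Connected) {Vo : Finset V} {lam : ℝ}
    (hS : ∀ e : G.Edge, 0 < sinSol lam (G.length e))
    (h : DirichletPosDef (G.netMatrix (G.edgeDiag lam) (G.edgeOff lam)) Vo) :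
    SemigroupStronglyPositive (G.dtnMatrix Vo lam) := by
  have hs : ∀ e, 0 < G.edgeOff lam e := fun e => inv_pos.2 (hS e)
  rw [dtnMatrix_eq_schur (fun e => (hS e).ne') h.det_ne_zero]
  exact h.stronglyPositive (fun v w hvw => netMatrix_apply_nonpos (fun e => (hs e).le) hvw)
    netMatrix_isSymm (netMatrix_reflTransGen hG hs)

theorem dirichletPosDef_of_nonpos (hG : G.graph.Connected) {Vo : Finset V} (hVo : Vo.Nonempty)
    {lam : ℝ} (hlam : lam ≤ 0) :
    DirichletPosDef (G.netMatrix (G.edgeDiag lam) (G.edgeOff lam)) Vo := by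
  have hS := fun e : G.Edge => sinSol_pos_of_nonpos hlam (G.length_pos e)
  refine netMatrix_dirichletPosDef hG hVo (fun e => inv_pos.2 (hS e)) fun e => ?_
  rw [edgeOff, edgeDiag, inv_eq_one_div]
  refine div_le_div_of_nonneg_right ?_ (hS e).le
  rw [cosSol_of_nonpos hlam]; exact Real.one_le_cosh _

/-- Positive definiteness propagates from the spectral parameter `0` along an interval that contains
no resonance. -/
theorem dirichletPosDef_of_forall_nonResonant (hG : G.graph.Connected) {Vo : Finset V}
    (hVo : Vo.Nonempty) {lam : ℝ} (hlam : 0 ≤ lam)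
    (hL : ∀ e : G.Edge, lam < (Real.pi / G.length e) ^ 2)
    (hN : ∀ mu ≤ lam, G.NonResonant Vo mu) :
    DirichletPosDef (G.netMatrix (G.edgeDiag lam) (G.edgeOff lam)) Vo := by
  have hS : ∀ mu ≤ lam, ∀ e : G.Edge, 0 < sinSol mu (G.length e) := fun mu hmu e =>
    sinSol_pos (G.length_pos e) (hmu.trans_lt (hL e))
  have hcont : ∀ mu ≤ lam, ContinuousAt (fun mu => G.netMatrix (G.edgeDiag mu) (G.edgeOff mu)) mu :=
    fun mu hmu => continuousAt_netMatrix_edge fun e => (hS mu hmu e).ne'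
  let P : Set ℝ := {mu | DirichletPosDef (G.netMatrix (G.edgeDiag mu) (G.edgeOff mu)) Vo}
  have hsub : Set.Icc 0 lam ⊆ P := by
    refine IsClosed.Icc_subset_of_forall_mem_nhdsWithin ?_ (dirichletPosDef_of_nonpos hG hVo le_rfl)
      fun mu hmu => ?_
    · refine isClosed_of_closure_subset fun mu hmu => ?_
      have hmuI : mu ∈ Set.Icc 0 lam := by
        have := closure_mono Set.inter_subset_right hmu
        rwa [isClosed_Icc.closure_eq] at this
      refine ⟨?_, hmuI⟩
      refine dirichletPosDef_of_nonneg netMatrix_isSymm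
        (nonResonant_det_ne_zero (fun e => (hS mu hmuI.2 e).ne') (hN mu hmuI.2)) fun y hy => ?_
      have hq : ContinuousAt (fun mu => y ⬝ᵥ G.netMatrix (G.edgeDiag mu) (G.edgeOff mu) *ᵥ y) mu := by
        have hc : Continuous fun M : Matrix V V ℝ => y ⬝ᵥ M *ᵥ y :=
          continuous_const.dotProduct (continuous_id.matrix_mulVec continuous_const)
        exact ContinuousAt.comp (g := fun M : Matrix V V ℝ => y ⬝ᵥ M *ᵥ y)
          hc.continuousAt (hcont mu hmuI.2)
      have hfr := mem_closure_iff_frequently.1 hmu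
      by_contra hneg
      push Not at hneg
      obtain ⟨nu, ⟨hnu, -⟩, hnu'⟩ := (hfr.and_eventually (hq.eventually (gt_mem_nhds hneg))).exists
      by_cases hy0 : y = 0
      · simp [hy0] at hneg
      · exact (hnu y hy hy0).not_gt hnu'
    · exact mem_nhdsWithin_of_mem_nhds ((hcont mu hmu.2.2.le).eventually hmu.1.eventually)
  exact hsub ⟨hlam, le_rfl⟩

/-- The interval below the spectrum contains no Dirichlet eigenvalue of a single edge. -/
theorem lt_sq_of_forall_nonResonant (hG : G.graph.Connected) {Vo : Finset V}
    (hVo : Vo.Nonempty) {lam : ℝ} (hN : ∀ mu ≤ lam, G.NonResonant Vo mu) (e : G.Edge) :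
    lam < (Real.pi / G.length e) ^ 2 := by
  obtain ⟨e₀, -, he₀⟩ := Finset.exists_max_image Finset.univ G.length ⟨e, Finset.mem_univ e⟩
  have hmono : ∀ e, (Real.pi / G.length e₀) ^ 2 ≤ (Real.pi / G.length e) ^ 2 := fun e => by
    have h1 := G.length_pos e
    have h2 := he₀ e (Finset.mem_univ e)
    have := Real.pi_pos
    have := G.length_pos e₀
    gcongr
  refine lt_of_lt_of_le ?_ (hmono e)
  by_contra hle
  push Not at hle
  set Lam := (Real.pi / G.length e₀) ^ 2 with hLam
  have hS0 : sinSol Lam (G.length e₀) = 0 := sinSol_eq_zero_of_sq (G.length_pos e₀)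
  by_cases hout : G.left e₀ ∈ Vo ∧ G.right e₀ ∈ Vo
  · -- the first Dirichlet eigenfunction of the edge, extended by zero, is a resonance
    have := (hN Lam hle (Pi.single e₀ 1) 0 (fun e => by
      by_cases he : e = e₀
      · subst he; simp [hS0]
      · simp [he]) (fun _ _ => rfl) (fun v hv => by
      have hz : ∀ e : G.Edge, (G.left e = v ∨ G.right e = v) → (Pi.single e₀ 1 : G.Edge → ℂ) e = 0 :=
        fun e he => Pi.single_eq_of_ne (by
          rintro rfl
          rcases he with rfl | rfl
          · exact hv hout.1
          · exact hv hout.2) _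
      rw [flux_congr (b' := 0) (y' := 0) (fun e he => hz e (Or.inl he))
        fun e he => ⟨hz e (Or.inr he), rfl⟩]
      simpa using flux_smul (lam := Lam) (b := (0 : G.Edge → ℂ)) (y := 0) 0 v)).1
    have h1 := congrFun this e₀
    rw [Pi.single_eq_same] at h1
    exact one_ne_zero h1
  · -- otherwise a diagonal entry of the inner block tends to `-∞`
    obtain ⟨v, hv, hve⟩ : ∃ v, v ∉ Vo ∧ (G.left e₀ = v ∨ G.right e₀ = v) := by
      by_cases h1 : G.left e₀ ∈ Vo
      · exact ⟨_, fun h2 => hout ⟨h1, h2⟩, Or.inr rfl⟩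
      · exact ⟨_, h1, Or.inl rfl⟩
    let n : G.Edge → ℝ := fun e =>
      (if G.left e = v then 1 else 0) + (if G.right e = v then 1 else 0)
    have hn0 : ∀ e, 0 ≤ n e := fun e => by simp only [n]; split_ifs <;> norm_num
    have hn1 : 1 ≤ n e₀ := by
      simp only [n]
      rcases hve with h | h
      · rw [if_pos h]; split_ifs <;> norm_num
      · rw [if_pos h]; split_ifs <;> norm_num
    have hLpos : 0 < Lam := by have := G.length_pos e₀; have := Real.pi_pos; positivity
    have hSpos : ∀ mu < Lam, ∀ e : G.Edge, 0 < sinSol mu (G.length e) := fun mu hmu e =>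
      sinSol_pos (G.length_pos e) (hmu.trans_le (hmono e))
    let g : G.Edge → ℝ → ℝ := fun e mu => if G.length e = G.length e₀ then cosSol mu (G.length e)
      else sinSol mu (G.length e₀) * (cosSol mu (G.length e) / sinSol mu (G.length e))
    have hpos : ∀ mu ∈ Set.Ico 0 Lam, 0 ≤ ∑ e, n e * g e mu := fun mu hmu => by
      have hPD := dirichletPosDef_of_forall_nonResonant hG hVo hmu.1
        (fun e => hmu.2.trans_le (hmono e)) fun nu hnu => hN nu (hnu.trans (hmu.2.le.trans hle))
      have h0 : ∀ w ∈ Vo, (Pi.single v 1 : V → ℝ) w = 0 := fun w hw =>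
        Pi.single_eq_of_ne (fun h : w = v => hv (h ▸ hw)) _
      have h1 := hPD _ h0 fun h => one_ne_zero (α := ℝ) (by simpa using congrFun h v)
      rw [dotProduct_netMatrix_mulVec] at h1
      have h2 := mul_nonneg (hSpos mu hmu.2 e₀).le h1.le
      rw [Finset.mul_sum] at h2
      refine h2.trans_eq (Finset.sum_congr rfl fun e _ => ?_)
      have hS := (hSpos mu hmu.2 e).ne'
      have hlr := left_ne_right e
      have hg : g e mu = sinSol mu (G.length e₀) * G.edgeDiag mu e := by
        simp only [g, edgeDiag]
        split_ifs with hL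
        · rw [← hL]; field_simp
        · rfl
      rw [hg]
      simp only [n, Pi.single_apply]
      by_cases h1 : G.left e = v
      · have h2 : G.right e ≠ v := fun h => hlr (h1.trans h.symm)
        simp [h1, h2]
      · by_cases h2 : G.right e = v
        · simp [h1, h2]
        · simp [h1, h2]
    have hg : ∀ e, ContinuousAt (g e) Lam := fun e => by
      simp only [g]
      split_ifs with hL
      · exact (continuous_cosSol_left _).continuousAt
      · have hlt : Lam < (Real.pi / G.length e) ^ 2 := by
          have h1 := G.length_pos e
          have h2 := lt_of_le_of_ne (he₀ e (Finset.mem_univ e)) hL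
          have := Real.pi_pos
          have := G.length_pos e₀
          rw [hLam]; gcongr
        exact (continuous_sinSol_left _).continuousAt.mul
          ((continuous_cosSol_left _).continuousAt.div (continuous_sinSol_left _).continuousAt
            (sinSol_pos (G.length_pos e) hlt).ne')
    have hlim : Filter.Tendsto (fun mu => ∑ e, n e * g e mu) (nhdsWithin Lam (Set.Iio Lam))
        (nhds (∑ e, n e * g e Lam)) :=
      (tendsto_finsetSum _ fun e _ => (hg e).const_mul (n e)).mono_left nhdsWithin_le_nhds
    have hge : 0 ≤ ∑ e, n e * g e Lam := by
      refine ge_of_tendsto hlim ?_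
      filter_upwards [Ico_mem_nhdsLT hLpos] with mu hmu using hpos mu hmu
    have hg1 : ∀ e, n e * g e Lam ≤ 0 := fun e => by
      simp only [g]
      split_ifs with hL
      · rw [hL, cosSol_eq_neg_one_of_sq (G.length_pos e₀)]; linarith [hn0 e]
      · rw [hS0]; simp
    have hg2 : n e₀ * g e₀ Lam ≤ -1 := by
      simp only [g, if_true]
      rw [cosSol_eq_neg_one_of_sq (G.length_pos e₀)]; linarith
    have := Finset.single_le_sum (f := fun e => -(n e * g e Lam))
      (fun e _ => neg_nonneg.2 (hg1 e)) (Finset.mem_univ e₀)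
    rw [Finset.sum_neg_distrib] at this
    linarith

theorem stronglyPositive_of_lt_lambda1 (hG : G.graph.Connected) {Vo : Finset V} (hVo : Vo.Nonempty)
    {lam : ℝ} (h : (lam : EReal) < G.lambda1 Vo) :
    SemigroupStronglyPositive (G.dtnMatrix Vo lam) := by
  have hN : ∀ mu ≤ lam, G.NonResonant Vo mu := fun mu hmu =>
    nonResonant_of_notMem_spectrum hG hVo fun hmem => by
      have : G.lambda1 Vo ≤ (mu : EReal) := iInf₂_le mu hmem
      exact absurd (h.trans_le this) (not_lt.2 (by exact_mod_cast hmu))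
  rcases le_total lam 0 with h0 | h0
  · exact stronglyPositive_of_dirichletPosDef hG
      (fun e => sinSol_pos_of_nonpos h0 (G.length_pos e)) (dirichletPosDef_of_nonpos hG hVo h0)
  · have hL := lt_sq_of_forall_nonResonant hG hVo hN
    exact stronglyPositive_of_dirichletPosDef hG (fun e => sinSol_pos (G.length_pos e) (hL e))
      (dirichletPosDef_of_forall_nonResonant hG hVo h0 hL hN)

end QuantumGraph

/-! ### Sign patterns supported on a forest -/

/-- A symmetric real matrix can be conjugated by a diagonal matrix of signs so that its entries at
the edges of a given forest become non-positive. -/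
theorem SimpleGraph.IsAcyclic.exists_signs {ι : Type*} [Finite ι] {A : ι → ι → ℝ}
    (hA : ∀ i j, A i j = A j i) {H : SimpleGraph ι} (hH : H.IsAcyclic) :
    ∃ s : ι → ℝ, (∀ i, s i * s i = 1) ∧ ∀ i j, H.Adj i j → s i * A i j * s j ≤ 0 := by
  induction hn : H.edgeSet.ncard generalizing H with
  | zero =>
    refine ⟨1, by simp, fun i j hij => ?_⟩
    have h0 : H.edgeSet = ∅ := (Set.ncard_eq_zero (Set.toFinite _)).1 hn
    have : s(i, j) ∈ H.edgeSet := hij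
    simp [h0] at this
  | succ n ih =>
    obtain ⟨e, he⟩ := Set.nonempty_of_ncard_ne_zero (s := H.edgeSet) (by omega)
    induction e with | _ u v
    have huv : H.Adj u v := he
    have hbr := SimpleGraph.isAcyclic_iff_forall_adj_isBridge.1 hH huv
    rw [SimpleGraph.isBridge_iff] at hbr
    set H' := H.deleteEdges {s(u, v)} with hH'
    have hle : H' ≤ H := H.deleteEdges_le _
    have hcard : H'.edgeSet.ncard = n := by
      rw [hH', SimpleGraph.edgeSet_deleteEdges, Set.ncard_sdiff_singleton_of_mem he, hn]; rfl
    obtain ⟨s, hs, hsA⟩ := ih (hH.anti hle) hcard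
    have hadj : ∀ i j, H.Adj i j → ¬ (s(i, j) = s(u, v)) → H'.Adj i j := fun i j hij h => by
      rw [hH', SimpleGraph.deleteEdges_adj]
      exact ⟨hij, h⟩
    have hcomm : ∀ (t : ι → ℝ), t u * A u v * t v ≤ 0 →
        (∀ i j, H'.Adj i j → t i * A i j * t j ≤ 0) → ∀ i j, H.Adj i j → t i * A i j * t j ≤ 0 := by
      intro t h1 h2 i j hij
      by_cases h : s(i, j) = s(u, v)
      · rcases Sym2.eq_iff.1 h with ⟨rfl, rfl⟩ | ⟨rfl, rfl⟩
        · exact h1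
        · rw [hA i j]; linarith
      · exact h2 i j (hadj i j hij h)
    rcases le_total (s u * A u v * s v) 0 with h | h
    · exact ⟨s, hs, hcomm s h hsA⟩
    · -- change all signs on the side of `v`
      classical
      let t : ι → ℝ := fun i => if H'.Reachable v i then -s i else s i
      refine ⟨t, fun i => by simp only [t]; split_ifs <;> simp [hs], hcomm t ?_ fun i j hij => ?_⟩
      · have h1 : t u = s u := if_neg fun h => hbr h.symm
        have h2 : t v = -s v := if_pos (SimpleGraph.Reachable.refl v)
        rw [h1, h2]; linarith
      · have hiff : H'.Reachable v i ↔ H'.Reachable v j :=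
          ⟨fun h => h.trans hij.reachable, fun h => h.trans hij.symm.reachable⟩
        have := hsA i j hij
        simp only [t, hiff]
        split_ifs <;> linarith

/-! ### Structure of the Dirichlet-to-Neumann matrix -/

namespace QuantumGraph

section

variable {V : Type*} [Fintype V] {G : QuantumGraph V} {lam : ℝ} {b b' : G.Edge → ℂ} {y y' : V → ℂ}

theorem flux_conj (v : V) :
    flux lam (fun e => (starRingEnd ℂ) (b e)) (fun v => (starRingEnd ℂ) (y v)) v
      = (starRingEnd ℂ) (flux lam b y v) := by
  simp [flux, map_sum]

/-- Green's identity for two solutions of the equation `u'' + lam u = 0`. -/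
theorem sum_mul_flux_comm (h : EdgeCompat lam b y) (h' : EdgeCompat lam b' y') :
    ∑ v, y' v * flux lam b y v = ∑ v, y v * flux lam b' y' v := by
  classical
  have key : ∀ (b : G.Edge → ℂ) (y y' : V → ℂ), ∑ v, y' v * flux lam b y v
      = ∑ e, (-(y' (G.left e) * b e) + y' (G.right e) * ((cosSol lam (G.length e) : ℂ) * b e
        - lam * (sinSol lam (G.length e) : ℂ) * y (G.left e))) := fun b y y' => by
    simp only [flux, mul_add, Finset.sum_add_distrib, mul_neg, Finset.sum_neg_distrib,
      Finset.sum_filter, Finset.mul_sum]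
    congr 1
    · rw [Finset.sum_comm]
      simp
    · rw [Finset.sum_comm]
      simp
  rw [key, key]
  refine Finset.sum_congr rfl fun e _ => ?_
  rw [← h e, ← h' e]
  have := cosSol_sq_add_complex lam (G.length e)
  linear_combination (y' (G.left e) * b e - y (G.left e) * b' e) * this

/-- `u` can be reached from `w` through vertices outside `Vo`. -/
def InnerReachable (G : QuantumGraph V) (Vo : Finset V) (w u : V) : Prop :=
  ∃ p : G.graph.Walk w u, ∀ x ∈ p.support, x ≠ w → x ∉ Vo

omit [Fintype V] in
theorem InnerReachable.refl {Vo : Finset V} (w : V) : G.InnerReachable Vo w w :=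
  ⟨.nil, fun x hx h => absurd (by simpa using hx) h⟩

omit [Fintype V] in
theorem InnerReachable.concat {Vo : Finset V} {w u v : V} (h : G.InnerReachable Vo w u)
    (huv : G.graph.Adj u v) (hv : v ∉ Vo) : G.InnerReachable Vo w v := by
  obtain ⟨p, hp⟩ := h
  refine ⟨p.concat huv, fun x hx hxw => ?_⟩
  rw [SimpleGraph.Walk.support_concat, List.mem_append] at hx
  rcases hx with hx | hx
  · exact hp x hx hxw
  · rwa [List.mem_singleton.1 hx]

omit [Fintype V] in
theorem InnerReachable.eq_or_notMem {Vo : Finset V} {w u : V} (h : G.InnerReachable Vo w u) :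
    u = w ∨ u ∉ Vo := by
  obtain ⟨p, hp⟩ := h
  by_cases hu : u = w
  · exact Or.inl hu
  · exact Or.inr (hp u p.end_mem_support hu)

omit [Fintype V] in
theorem InnerReachable.reducedGraph_adj {Vo : Finset V} {w v : Vo} {u : V}
    (h : G.InnerReachable Vo w u) (huv : G.graph.Adj u v) (hvw : v ≠ w) :
    (G.reducedGraph Vo).Adj w v := by
  classical
  obtain ⟨p, hp⟩ := h
  refine ⟨hvw.symm, Or.inr ⟨(p.concat huv).bypass, SimpleGraph.Walk.bypass_isPath _,
    fun x hx hxw hxv => ?_⟩⟩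
  have hx' := SimpleGraph.Walk.support_bypass_subset_support _ hx
  rw [SimpleGraph.Walk.support_concat, List.mem_append] at hx'
  rcases hx' with hx' | hx'
  · exact hp x hx' hxw
  · exact absurd (List.mem_singleton.1 hx') hxv

end

variable {V : Type*} [Fintype V] [DecidableEq V] {G : QuantumGraph V} {lam : ℝ} {Vo : Finset V}

theorem NonResonant.dtnMatrix_conj (h : G.NonResonant Vo lam) (v w : Vo) :
    (starRingEnd ℂ) (G.dtnMatrix Vo lam v w) = G.dtnMatrix Vo lam v w := by
  obtain ⟨b, y, hc, hy, hf⟩ := h.exists_sys (Pi.single w 1)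
  rw [h.dtnMatrix_apply hc hy hf, ← flux_conj, ← h.dtnMatrix_apply (fun e => ?_) (fun v => ?_)
    (fun v hv => ?_), h.dtnMatrix_apply hc hy hf]
  · rw [← hc e]; simp
  · rw [hy v, Pi.single_apply]; split_ifs <;> simp
  · rw [flux_conj, hf v hv, map_zero]

theorem NonResonant.dtnMatrix_symm (h : G.NonResonant Vo lam) (v w : Vo) :
    G.dtnMatrix Vo lam v w = G.dtnMatrix Vo lam w v := by
  obtain ⟨b, y, hc, hy, hf⟩ := h.exists_sys (Pi.single w 1)
  obtain ⟨b', y', hc', hy', hf'⟩ := h.exists_sys (Pi.single v 1)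
  rw [h.dtnMatrix_apply hc hy hf, h.dtnMatrix_apply hc' hy' hf']
  have key : ∀ (b : G.Edge → ℂ) (y y' : V → ℂ) (v : Vo), (∀ u : Vo, y' u = (Pi.single v 1 : Vo → ℂ) u) →
      (∀ u ∉ Vo, flux lam b y u = 0) → ∑ u, y' u * flux lam b y u = flux lam b y v := by
    intro b y y' v hy' hf
    rw [Finset.sum_eq_single (v : V)]
    · rw [hy' v, Pi.single_eq_same, one_mul]
    · intro u _ huv
      by_cases hu : u ∈ Vo
      · rw [show y' u = _ from hy' ⟨u, hu⟩, Pi.single_eq_of_ne, zero_mul]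
        exact fun h => huv (congrArg Subtype.val h)
      · rw [hf u hu, mul_zero]
    · simp
  rw [← key b y y' v hy' hf, ← key b' y' y w hy hf', sum_mul_flux_comm hc hc']

/-- The solution with boundary values `Pi.single w 1` vanishes beyond the outer vertices different
from `w` that are first met on the way from `w`. -/
theorem NonResonant.dtnMatrix_eq_zero (h : G.NonResonant Vo lam) {v w : Vo} (hvw : v ≠ w)
    (hadj : ¬ (G.reducedGraph Vo).Adj w v) : G.dtnMatrix Vo lam v w = 0 := by
  classical
  obtain ⟨b, y, hc, hy, hf⟩ := h.exists_sys (Pi.single w 1)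
  have hy0 : ∀ u ∈ Vo, u ≠ w → y u = 0 := fun u hu huw => by
    rw [show y u = _ from hy ⟨u, hu⟩, Pi.single_eq_of_ne]
    exact fun h => huw (congrArg Subtype.val h)
  let Q : V → Prop := G.InnerReachable Vo w
  have hQ0 : ∀ {u u'}, G.graph.Adj u u' → Q u → ¬ Q u' → y u' = 0 := fun {u u'} huu' hu hu' => by
    have h1 : u' ∈ Vo := by by_contra h1; exact hu' (InnerReachable.concat hu huu' h1)
    exact hy0 u' h1 fun h => hu' (h ▸ InnerReachable.refl _)
  let y' : V → ℂ := fun u => if Q u then y u else 0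
  let b' : G.Edge → ℂ := fun e => if Q (G.left e) ∨ Q (G.right e) then b e else 0
  have hyy : ∀ {u u'}, G.graph.Adj u u' → Q u → y' u' = y u' := fun {u u'} huu' hu => by
    by_cases hu' : Q u'
    · exact if_pos hu'
    · simp only [y', if_neg hu', hQ0 huu' hu hu']
  have hc' : EdgeCompat lam b' y' := fun e => by
    have hlr := adj_left_right e
    by_cases hl : Q (G.left e)
    · rw [hyy hlr hl, show y' (G.left e) = y (G.left e) from if_pos hl,
        show b' e = b e from if_pos (Or.inl hl), hc e]
    · by_cases hr : Q (G.right e)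
      · rw [hyy hlr.symm hr, show y' (G.right e) = y (G.right e) from if_pos hr,
          show b' e = b e from if_pos (Or.inr hr), hc e]
      · simp [y', b', hl, hr]
  -- around a vertex that is not attached to `w` the truncated function vanishes
  have hz : ∀ u, ¬ Q u → (∀ u', G.graph.Adj u' u → ¬ Q u') → flux lam b' y' u = 0 := by
    intro u hu hu'
    rw [flux_congr (b' := 0) (y' := 0) (fun e he => ?_) fun e he => ⟨?_, ?_⟩]
    · simpa using flux_smul (lam := lam) (b := (0 : G.Edge → ℂ)) (y := 0) 0 u
    · have h1 : ¬ Q (G.right e) := hu' _ (he ▸ (adj_left_right e).symm)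
      exact if_neg (by rw [he]; tauto)
    · have h1 : ¬ Q (G.left e) := hu' _ (he ▸ adj_left_right e)
      exact if_neg (by rw [he]; tauto)
    · exact if_neg (hu' _ (he ▸ adj_left_right e))
  have hf' : ∀ u ∉ Vo, flux lam b' y' u = 0 := fun u hu => by
    by_cases hQ : Q u
    · rw [flux_congr (b' := b) (y' := y) (fun e he => ?_) fun e he => ⟨?_, ?_⟩, hf u hu]
      · exact if_pos (Or.inl (by rwa [he]))
      · exact if_pos (Or.inr (by rwa [he]))
      · exact hyy (he ▸ (adj_left_right e).symm) hQ
    · exact hz u hQ fun u' hu' h => hQ (InnerReachable.concat h hu' hu)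
  have hy' : ∀ u : Vo, y' u = (Pi.single w 1 : Vo → ℂ) u := fun u => by
    by_cases huw : u = w
    · rw [show y' u = y u from if_pos (huw ▸ InnerReachable.refl _), hy u]
    · rw [Pi.single_eq_of_ne huw]
      simp only [y']
      split_ifs
      · exact hy0 u u.2 fun h => huw (Subtype.ext h)
      · rfl
  rw [h.dtnMatrix_apply hc' hy' hf']
  refine hz v (fun hQ => ?_) fun u hu hQ => hadj (hQ.reducedGraph_adj hu hvw)
  rcases hQ.eq_or_notMem with h | h
  · exact hvw (Subtype.ext h)
  · exact h v.2

theorem positive_or_not_eventuallyStronglyPositive (h : G.NonResonant Vo lam)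
    (hT : (G.reducedGraph Vo).IsAcyclic) : SemigroupPositive (G.dtnMatrix Vo lam) ∨
        ¬ SemigroupEventuallyStronglyPositive (G.dtnMatrix Vo lam) := by
  let A : Matrix Vo Vo ℝ := (G.dtnMatrix Vo lam).map Complex.re
  have hA : G.dtnMatrix Vo lam = A.map Complex.ofReal := by
    ext v w
    exact (Complex.conj_eq_iff_re.1 (h.dtnMatrix_conj v w)).symm
  obtain ⟨s, hs, hsA⟩ := hT.exists_signs (A := A)
    fun v w => congrArg Complex.re (h.dtnMatrix_symm v w)
  rw [hA, Matrix.semigroupPositive_map_iff, Matrix.semigroupEventuallyStronglyPositive_map_iff]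
  refine Matrix.nonneg_or_not_eventually_pos_of_signs hs fun v w hvw => ?_
  by_cases hadj : (G.reducedGraph Vo).Adj w v
  · exact hsA v w hadj.symm
  · have : A v w = 0 := congrArg Complex.re (h.dtnMatrix_eq_zero hvw hadj)
    simp [this]

end QuantumGraph

/-! ### Kronecker's approximation theorem -/

section Kronecker

variable {E : Type*} [Fintype E]

theorem integral_mFourier_of_ne_zero {n : E → ℤ} (hn : n ≠ 0) :
    ∫ x, UnitAddTorus.mFourier n x ∂(Measure.pi fun _ : E => AddCircle.haarAddCircle (T := 1)) = 0 := by
  obtain ⟨i, hi⟩ := Function.ne_iff.mp hn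
  simp only [UnitAddTorus.mFourier, ContinuousMap.coe_mk]
  rw [integral_fintype_prod_eq_prod (fun (e : E) (x : UnitAddCircle) => fourier (n e) x)]
  refine Finset.prod_eq_zero (Finset.mem_univ i) ?_
  have h := congrFun (fourierCoeff_fourier (T := 1) (n i)) 0
  have hi' : (0 : ℤ) ≠ n i := fun h => hi h.symm
  rw [Pi.single_eq_of_ne hi', fourierCoeff] at h
  simpa using h

/-- The linear flow on the torus. -/
noncomputable def linearFlow (L : E → ℝ) (t : ℝ) : UnitAddTorus E :=
  fun e => ((t * L e : ℝ) : UnitAddCircle)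

omit [Fintype E] in
theorem continuous_linearFlow (L : E → ℝ) : Continuous (linearFlow L) :=
  continuous_pi fun e => (AddCircle.continuous_mk' 1).comp (by fun_prop)

theorem mFourier_linearFlow (L : E → ℝ) (n : E → ℤ) (t : ℝ) :
    UnitAddTorus.mFourier n (linearFlow L t)
      = Complex.exp ((2 * Real.pi * (∑ e, n e * L e : ℝ) * Complex.I) * t) := by
  simp only [UnitAddTorus.mFourier, ContinuousMap.coe_mk, linearFlow, fourier_coe_apply]
  rw [← Complex.exp_sum]
  congr 1
  push_cast
  rw [Finset.mul_sum, Finset.sum_mul, Finset.sum_mul]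
  refine Finset.sum_congr rfl fun e _ => ?_
  ring

/-- The time averages of the characters along the flow converge to their space averages. -/
theorem tendsto_average_mFourier {L : E → ℝ} (hL : LinearIndependent ℚ L) (n : E → ℤ) :
    Filter.Tendsto (fun T : ℝ => (T : ℂ)⁻¹ * ∫ t in T..2 * T,
      UnitAddTorus.mFourier n (linearFlow L t)) Filter.atTop
      (nhds (∫ x, UnitAddTorus.mFourier n x
        ∂(Measure.pi fun _ : E => AddCircle.haarAddCircle (T := 1)))) := by
  by_cases hn : n = 0
  · subst hn
    simp only [UnitAddTorus.mFourier_zero, ContinuousMap.one_apply]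
    refine Filter.Tendsto.congr' ?_ tendsto_const_nhds
    filter_upwards [Filter.eventually_gt_atTop 0] with T hT
    have : (T : ℂ) ≠ 0 := by exact_mod_cast hT.ne'
    simp only [integral_const, intervalIntegral.integral_const, probReal_univ, one_smul]
    simp only [Complex.real_smul, mul_one]
    push_cast
    field_simp
    ring
  · rw [integral_mFourier_of_ne_zero hn]
    set om : ℝ := ∑ e, n e * L e with hom
    have hom0 : om ≠ 0 := fun h => hn <| funext fun e => by
      have h1 := Fintype.linearIndependent_iff.1 hL (fun e => (n e : ℚ))
        (by rw [← h, hom]; exact Finset.sum_congr rfl fun e _ => by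
              rw [Rat.smul_def]; push_cast; rfl) e
      exact_mod_cast h1
    set c : ℂ := 2 * Real.pi * (om : ℝ) * Complex.I with hc
    have hc0 : c ≠ 0 := by
      have := Real.pi_ne_zero
      simp [hc, hom0]
    have hexp : ∀ t : ℝ, ‖Complex.exp (c * t)‖ = 1 := fun t => by
      rw [show c * t = ((2 * Real.pi * om * t : ℝ) : ℂ) * Complex.I by rw [hc]; push_cast; ring]
      exact Complex.norm_exp_ofReal_mul_I _
    refine squeeze_zero_norm' (a := fun T : ℝ => T⁻¹ * (2 / ‖c‖)) ?_ ?_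
    · filter_upwards [Filter.eventually_gt_atTop 0] with T hT
      simp only [mFourier_linearFlow]
      rw [integral_exp_mul_complex hc0, norm_mul, norm_inv, Complex.norm_real, Real.norm_of_nonneg hT.le,
        norm_div]
      gcongr
      refine (norm_sub_le _ _).trans ?_
      rw [hexp, hexp]; norm_num
    · simpa using tendsto_inv_atTop_zero.mul_const (2 / ‖c‖)

theorem tendsto_average_of_mem_span {L : E → ℝ} (hL : LinearIndependent ℚ L)
    {p : C(UnitAddTorus E, ℂ)}
    (hp : p ∈ Submodule.span ℂ (Set.range (UnitAddTorus.mFourier (d := E)))) :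
    Filter.Tendsto (fun T : ℝ => (T : ℂ)⁻¹ * ∫ t in T..2 * T, p (linearFlow L t)) Filter.atTop
      (nhds (∫ x, p x ∂(Measure.pi fun _ : E => AddCircle.haarAddCircle (T := 1)))) := by
  have hint : ∀ q : C(UnitAddTorus E, ℂ), Integrable q
      (Measure.pi fun _ : E => AddCircle.haarAddCircle (T := 1)) := fun q =>
    q.continuous.integrable_of_hasCompactSupport (HasCompactSupport.of_compactSpace _)
  have hint' : ∀ (q : C(UnitAddTorus E, ℂ)) (a b : ℝ),
      IntervalIntegrable (fun t => q (linearFlow L t)) volume a b := fun q a b =>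
    (q.continuous.comp (continuous_linearFlow L)).intervalIntegrable a b
  induction hp using Submodule.span_induction with
  | mem x hx =>
    obtain ⟨n, rfl⟩ := hx
    exact tendsto_average_mFourier hL n
  | zero => simp
  | add p q _ _ h1 h2 =>
    simp only [ContinuousMap.add_apply]
    rw [integral_add (hint p) (hint q)]
    refine (h1.add h2).congr fun T => ?_
    rw [intervalIntegral.integral_add (hint' p _ _) (hint' q _ _), mul_add]
  | smul a p _ h =>
    simp only [ContinuousMap.smul_apply, smul_eq_mul]
    rw [integral_const_mul]
    refine (h.const_mul a).congr fun T => ?_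
    rw [intervalIntegral.integral_const_mul]; ring

/-- The orbit of a linear flow on the torus with rationally independent frequencies visits every
open set at arbitrarily large times. -/
theorem LinearIndependent.exists_linearFlow_mem {L : E → ℝ} (hL : LinearIndependent ℚ L)
    {U : Set (UnitAddTorus E)} (hU : IsOpen U) {x₀ : UnitAddTorus E} (hx₀ : x₀ ∈ U) (T₀ : ℝ) :
    ∃ t, T₀ < t ∧ linearFlow L t ∈ U := by
  by_cases hc : (Uᶜ).Nonempty
  swap
  · rw [Set.not_nonempty_iff_eq_empty, Set.compl_empty_iff] at hc
    exact ⟨T₀ + 1, by linarith, hc ▸ Set.mem_univ _⟩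
  set μ : Measure (UnitAddTorus E) := Measure.pi fun _ : E => AddCircle.haarAddCircle (T := 1)
  let g : UnitAddTorus E → ℝ := fun x => Metric.infDist x Uᶜ
  have hg : Continuous g := Metric.continuous_infDist_pt _
  have hg0 : g x₀ ≠ 0 := fun h =>
    (hU.isClosed_compl.mem_iff_infDist_zero hc).2 h hx₀
  obtain ⟨c, hcdef⟩ : ∃ c, c = ∫ x, g x ∂μ := ⟨_, rfl⟩
  have hcpos : 0 < c := hcdef ▸ hg.integral_pos_of_hasCompactSupport_nonneg_nonzero
    (HasCompactSupport.of_compactSpace _) (fun x => Metric.infDist_nonneg) hg0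
  let f : C(UnitAddTorus E, ℂ) := ⟨fun x => (g x : ℂ), Complex.continuous_ofReal.comp hg⟩
  have hf : ∫ x, f x ∂μ = c := by rw [hcdef]; exact integral_ofReal
  have hcl : f ∈ closure (Submodule.span ℂ (Set.range (UnitAddTorus.mFourier (d := E))) :
      Set C(UnitAddTorus E, ℂ)) := by
    have h : f ∈ (Submodule.span ℂ
        (Set.range (UnitAddTorus.mFourier (d := E)))).topologicalClosure := by
      rw [UnitAddTorus.span_mFourier_closure_eq_top]; exact Submodule.mem_top
    rwa [← SetLike.mem_coe, Submodule.topologicalClosure_coe] at h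
  obtain ⟨p, hp, hpf⟩ := Metric.mem_closure_iff.1 hcl (c / 4) (by positivity)
  have hle : ∀ x, ‖f x - p x‖ ≤ c / 4 := fun x => by
    rw [← dist_eq_norm]; exact (ContinuousMap.dist_apply_le_dist x).trans hpf.le
  have hint : ∀ q : C(UnitAddTorus E, ℂ), Integrable q μ := fun q =>
    q.continuous.integrable_of_hasCompactSupport (HasCompactSupport.of_compactSpace _)
  have h1 : ‖(c : ℂ) - ∫ x, p x ∂μ‖ ≤ c / 4 := by
    rw [← hf, ← integral_sub (hint f) (hint p)]
    refine (norm_integral_le_of_norm_le_const (Filter.Eventually.of_forall hle)).trans ?_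
    rw [probReal_univ, mul_one]
  obtain ⟨T, h2, hT0, hT1⟩ := (((Metric.tendsto_nhds.1 (tendsto_average_of_mem_span hL hp)) (c / 4)
    (by positivity)).and ((Filter.eventually_gt_atTop T₀).and
      (Filter.eventually_gt_atTop 0))).exists
  by_contra hno
  push Not at hno
  have h3 : ‖(T : ℂ)⁻¹ * ∫ t in T..2 * T, p (linearFlow L t)‖ ≤ c / 4 := by
    have hb : ∀ t ∈ Set.uIoc T (2 * T), ‖p (linearFlow L t)‖ ≤ c / 4 := fun t ht => by
      rw [Set.uIoc_of_le (by linarith)] at ht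
      have hz : f (linearFlow L t) = 0 := by
        have : g (linearFlow L t) = 0 := Metric.infDist_zero_of_mem (hno t (hT0.trans ht.1))
        simp [f, this]
      have := hle (linearFlow L t)
      rwa [hz, zero_sub, norm_neg] at this
    have := intervalIntegral.norm_integral_le_of_norm_le_const hb
    rw [norm_mul, norm_inv, Complex.norm_real, Real.norm_of_nonneg hT1.le]
    rw [show |2 * T - T| = T by rw [abs_of_pos] <;> linarith] at this
    calc T⁻¹ * _ ≤ T⁻¹ * (c / 4 * T) := by gcongr
      _ = c / 4 := by field_simp
  rw [dist_eq_norm] at h2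
  have h4 : (c : ℂ) = (c - ∫ x, p x ∂μ) - ((T : ℂ)⁻¹ * (∫ t in T..2 * T, p (linearFlow L t))
      - ∫ x, p x ∂μ) + (T : ℂ)⁻¹ * ∫ t in T..2 * T, p (linearFlow L t) := by ring
  have h5 := congrArg norm h4
  rw [Complex.norm_real, Real.norm_of_nonneg hcpos.le] at h5
  have h6 := (norm_add_le _ _).trans (add_le_add_left (norm_sub_le ((c : ℂ) - ∫ x, p x ∂μ)
    ((T : ℂ)⁻¹ * (∫ t in T..2 * T, p (linearFlow L t)) - ∫ x, p x ∂μ))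
      (‖(T : ℂ)⁻¹ * ∫ t in T..2 * T, p (linearFlow L t)‖))
  rw [← h5] at h6
  linarith

/-- Given non-zero weights `w`, the cotangents and the cosecants of suitable multiples of rationally
independent numbers are, up to a common factor, simultaneously close to `w`. -/
theorem LinearIndependent.exists_cot_csc_mem {L : E → ℝ} (hL : LinearIndependent ℚ L) {w : E → ℝ}
    (hw : ∀ e, w e ≠ 0) {P : (E → ℝ) × (E → ℝ) → Prop} (hP : ∀ᶠ p in nhds (w, w), P p) (K : ℝ) :
    ∃ ε k : ℝ, 0 < ε ∧ K < k ∧ (∀ e, Real.sin (k * L e) ≠ 0) ∧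
      P (fun e => ε * (Real.cos (k * L e) / Real.sin (k * L e)),
        fun e => ε * (Real.sin (k * L e))⁻¹) := by
  -- the angles `arcsin (ε / w e)` have the required properties for small `ε`
  have h1 : Filter.Tendsto (fun ε : ℝ => ((fun e => w e * √(1 - (ε / w e) ^ 2)), w))
      (nhds 0) (nhds (w, w)) := by
    refine Filter.Tendsto.prodMk_nhds (tendsto_pi_nhds.2 fun e => ?_) tendsto_const_nhds
    have : Continuous fun ε : ℝ => w e * √(1 - (ε / w e) ^ 2) := by fun_prop
    simpa using this.tendsto 0
  have h2 : ∀ᶠ ε : ℝ in nhds 0, ∀ e, |ε / w e| < 1 := Filter.eventually_all.2 fun e => by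
    have : Continuous fun ε : ℝ => |ε / w e| := by fun_prop
    exact this.tendsto 0 |>.eventually (gt_mem_nhds (by simp))
  obtain ⟨ε, ⟨hε1, hε2⟩, hε⟩ := ((((h1.eventually hP.eventually_nhds).and h2).filter_mono
    nhdsWithin_le_nhds).and (self_mem_nhdsWithin (s := Set.Ioi (0 : ℝ)))).exists
  have hε : 0 < ε := hε
  let x₀ : UnitAddTorus E := fun e => ((Real.arcsin (ε / w e) / (2 * Real.pi) : ℝ) : UnitAddCircle)
  let Z : UnitAddTorus E → E → ℂ := fun x e => fourier 1 (x e)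
  have hZ : ∀ θ : E → ℝ, ∀ e, Z (fun e => ((θ e / (2 * Real.pi) : ℝ) : UnitAddCircle)) e
      = Complex.exp (θ e * Complex.I) := fun θ e => by
    simp only [Z, fourier_coe_apply]
    congr 1
    have := Real.pi_ne_zero
    push_cast
    field_simp
  have hZre : ∀ θ : E → ℝ, ∀ e,
      (Z (fun e => ((θ e / (2 * Real.pi) : ℝ) : UnitAddCircle)) e).re = Real.cos (θ e) :=
    fun θ e => by rw [hZ, Complex.exp_ofReal_mul_I_re]
  have hZim : ∀ θ : E → ℝ, ∀ e,
      (Z (fun e => ((θ e / (2 * Real.pi) : ℝ) : UnitAddCircle)) e).im = Real.sin (θ e) :=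
    fun θ e => by rw [hZ, Complex.exp_ofReal_mul_I_im]
  have hZc : ∀ e, Continuous fun x => Z x e := fun e =>
    (fourier 1).continuous.comp (continuous_apply e)
  have hsin : ∀ e, (Z x₀ e).im = ε / w e := fun e => by
    have := abs_lt.1 (hε2 e)
    rw [hZim fun e => Real.arcsin (ε / w e), Real.sin_arcsin this.1.le this.2.le]
  have hcos : ∀ e, (Z x₀ e).re = √(1 - (ε / w e) ^ 2) := fun e => by
    rw [hZre fun e => Real.arcsin (ε / w e), Real.cos_arcsin]
  have hne : ∀ e, (Z x₀ e).im ≠ 0 := fun e => by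
    rw [hsin]; exact div_ne_zero hε.ne' (hw e)
  have hre : ∀ e, ContinuousAt (fun x => (Z x e).re) x₀ := fun e =>
    (Complex.continuous_re.comp (hZc e)).continuousAt
  have him : ∀ e, ContinuousAt (fun x => (Z x e).im) x₀ := fun e =>
    (Complex.continuous_im.comp (hZc e)).continuousAt
  have hcont : Filter.Tendsto (fun x => ((fun e => ε * ((Z x e).re / (Z x e).im)),
      fun e => ε * ((Z x e).im)⁻¹)) (nhds x₀)
      (nhds ((fun e => w e * √(1 - (ε / w e) ^ 2)), w)) := by
    refine Filter.Tendsto.prodMk_nhds (tendsto_pi_nhds.2 fun e => ?_) (tendsto_pi_nhds.2 fun e => ?_)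
    · have : ContinuousAt (fun x => ε * ((Z x e).re / (Z x e).im)) x₀ :=
        ((hre e).div (him e) (hne e)).const_mul ε
      convert this.tendsto using 2
      rw [hsin, hcos]; field_simp [hw e]
    · have : ContinuousAt (fun x => ε * ((Z x e).im)⁻¹) x₀ :=
        ((him e).inv₀ (hne e)).const_mul ε
      convert this.tendsto using 2
      rw [hsin]; field_simp [hw e]
  have hall : ∀ᶠ x in nhds x₀, (∀ e, (Z x e).im ≠ 0) ∧
      P ((fun e => ε * ((Z x e).re / (Z x e).im)), fun e => ε * ((Z x e).im)⁻¹) :=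
    (Filter.eventually_all.2 fun e => (him e).eventually_ne (hne e)).and
      (hcont.eventually hε1)
  obtain ⟨U, hUsub, hU, hxU⟩ := mem_nhds_iff.1 hall
  obtain ⟨t, htK, ht⟩ := hL.exists_linearFlow_mem hU hxU (K / (2 * Real.pi))
  have hflow : linearFlow L t
      = fun e => ((2 * Real.pi * t * L e / (2 * Real.pi) : ℝ) : UnitAddCircle) := by
    ext1 e
    simp only [linearFlow]
    have := Real.pi_ne_zero
    congr 1
    field_simp
  obtain ⟨h3, h4⟩ := hUsub ht
  rw [hflow] at h3 h4
  simp only [hZre (fun e => 2 * Real.pi * t * L e), hZim (fun e => 2 * Real.pi * t * L e)] at h3 h4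
  exact ⟨ε, 2 * Real.pi * t, hε, by rwa [div_lt_iff₀' (by positivity)] at htK, h3, h4⟩

end Kronecker

/-! ### High frequencies -/

namespace QuantumGraph

open Matrix

variable {V : Type*} [Fintype V] [DecidableEq V] {G : QuantumGraph V} {Vo : Finset V}

omit [Fintype V] [DecidableEq V] in
theorem edgeDiag_sq {k ε : ℝ} (hk : 0 < k) (hε : ε ≠ 0) :
    G.edgeDiag (k ^ 2)
      = (k / ε) • fun e => ε * (Real.cos (k * G.length e) / Real.sin (k * G.length e)) := by
  ext e
  have h := sqrt_mul_sinSol (sq_nonneg k) (G.length e)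
  rw [Real.sqrt_sq hk.le] at h
  simp only [edgeDiag, Pi.smul_apply, smul_eq_mul]
  rw [cosSol_of_nonneg (sq_nonneg k), Real.sqrt_sq hk.le, ← h]
  field_simp

omit [Fintype V] [DecidableEq V] in
theorem edgeOff_sq {k ε : ℝ} (hk : 0 < k) (hε : ε ≠ 0) :
    G.edgeOff (k ^ 2) = (k / ε) • fun e => ε * (Real.sin (k * G.length e))⁻¹ := by
  ext e
  have h := sqrt_mul_sinSol (sq_nonneg k) (G.length e)
  rw [Real.sqrt_sq hk.le] at h
  simp only [edgeOff, Pi.smul_apply, smul_eq_mul]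
  rw [← h]
  field_simp

theorem continuousAt_schur_netMatrix {p : (G.Edge → ℝ) × (G.Edge → ℝ)}
    (hdet : (innerBlock (G.netMatrix p.1 p.2) Vo).det ≠ 0) :
    ContinuousAt (fun p : (G.Edge → ℝ) × (G.Edge → ℝ) => schur (G.netMatrix p.1 p.2) Vo) p :=
  ContinuousAt.comp (g := fun N : Matrix V V ℝ => schur N Vo) (continuousAt_schur hdet)
    continuous_netMatrix.continuousAt

theorem eventually_det_ne_zero {p : (G.Edge → ℝ) × (G.Edge → ℝ)}
    (hdet : (innerBlock (G.netMatrix p.1 p.2) Vo).det ≠ 0) :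
    ∀ᶠ q in nhds p, (innerBlock (G.netMatrix q.1 q.2) Vo).det ≠ 0 := by
  have hc : Continuous fun q : (G.Edge → ℝ) × (G.Edge → ℝ) =>
      (innerBlock (G.netMatrix q.1 q.2) Vo).det :=
    (continuous_netMatrix.matrix_submatrix _ _).matrix_det
  exact hc.continuousAt.eventually_ne hdet

/-- For rationally independent edge lengths, every weighted graph Laplacian with non-zero weights is
approximated, up to positive factors, by the network matrices at arbitrarily large spectral
parameters. A property that is stable under small perturbations of the weights is therefore attained
by Dirichlet-to-Neumann matrices. -/
theorem exists_dtnMatrix_eq_smul_schur (hL : LinearIndependent ℚ G.length) {w : G.Edge → ℝ}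
    (hw : ∀ e, w e ≠ 0) (hdet : (innerBlock (G.netMatrix w w) Vo).det ≠ 0)
    {Q : Matrix Vo Vo ℝ → Prop}
    (hQ : ∀ᶠ p : (G.Edge → ℝ) × (G.Edge → ℝ) in nhds (w, w), Q (schur (G.netMatrix p.1 p.2) Vo))
    (lamHat : ℝ) :
    ∃ (lam r : ℝ) (B : Matrix Vo Vo ℝ), lamHat < lam ∧ (lam : ℂ) ∉ G.dirichletSpectrum Vo ∧ 0 < r ∧
      Q B ∧ G.dtnMatrix Vo lam = (r • B).map Complex.ofReal := by
  obtain ⟨ε, k, hε, hk, hsin, hdet', hQ'⟩ := hL.exists_cot_csc_mem hw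
    ((eventually_det_ne_zero (p := (w, w)) hdet).and hQ) (max lamHat 1)
  have hk1 : 1 < k := (le_max_right _ _).trans_lt hk
  have hk0 : 0 < k := by linarith
  have hr : 0 < k / ε := by positivity
  have hS : ∀ e : G.Edge, sinSol (k ^ 2) (G.length e) ≠ 0 := fun e h0 => by
    have h := sqrt_mul_sinSol (sq_nonneg k) (G.length e)
    rw [Real.sqrt_sq hk0.le, h0, mul_zero] at h
    exact hsin e h.symm
  have hM : G.netMatrix (G.edgeDiag (k ^ 2)) (G.edgeOff (k ^ 2)) = (k / ε) • G.netMatrix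
      (fun e => ε * (Real.cos (k * G.length e) / Real.sin (k * G.length e)))
      fun e => ε * (Real.sin (k * G.length e))⁻¹ := by
    rw [edgeDiag_sq hk0 hε.ne', edgeOff_sq hk0 hε.ne', netMatrix_smul]
  have hd : (innerBlock (G.netMatrix (G.edgeDiag (k ^ 2)) (G.edgeOff (k ^ 2))) Vo).det ≠ 0 := by
    rw [hM]; exact det_innerBlock_smul hr.ne' hdet'
  refine ⟨k ^ 2, k / ε, _, ?_, notMem_spectrum_of_nonResonant (nonResonant_of_det_ne_zero hS hd), hr,
    hQ', ?_⟩
  · have := (le_max_left lamHat 1).trans_lt hk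
    nlinarith
  · rw [dtnMatrix_eq_schur hS hd, hM, schur_smul hr.ne' hdet']

/-- The Laplacian with weights `1` and its perturbations generate strongly positive semigroups. -/
theorem eventually_schur_netMatrix_one_pos (hG : G.graph.Connected) (hVo : Vo.Nonempty) :
    ∀ᶠ p : (G.Edge → ℝ) × (G.Edge → ℝ) in nhds (1, 1), (innerBlock (G.netMatrix p.1 p.2) Vo).det ≠ 0 ∧
      ∀ t : ℝ, 0 < t → ∀ i j, 0 < NormedSpace.exp ((-t) • schur (G.netMatrix p.1 p.2) Vo) i j := by
  have h1 : DirichletPosDef (G.netMatrix (1 : G.Edge → ℝ) 1) Vo :=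
    netMatrix_dirichletPosDef hG hVo (fun _ => one_pos) fun _ => le_rfl
  have h2 : ∀ᶠ p : (G.Edge → ℝ) × (G.Edge → ℝ) in nhds (1, 1),
      DirichletPosDef (G.netMatrix p.1 p.2) Vo :=
    (continuous_netMatrix.tendsto ((1 : G.Edge → ℝ), (1 : G.Edge → ℝ))).eventually h1.eventually
  have h3 : ∀ᶠ p : (G.Edge → ℝ) × (G.Edge → ℝ) in nhds (1, 1), ∀ e, 0 < p.2 e :=
    Filter.eventually_all.2 fun e => ((continuous_apply e).comp continuous_snd).continuousAt.eventually
      (lt_mem_nhds (by simp))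
  filter_upwards [h2, h3] with p hp hs
  exact ⟨hp.det_ne_zero, semigroupStronglyPositive_map_iff.1 <|
    hp.stronglyPositive (fun v w hvw => netMatrix_apply_nonpos (fun e => (hs e).le) hvw)
      netMatrix_isSymm (netMatrix_reflTransGen hG hs)⟩

theorem exists_stronglyPositive (hG : G.graph.Connected) (hVo : Vo.Nonempty)
    (hL : LinearIndependent ℚ G.length) (lamHat : ℝ) :
    ∃ lam : ℝ, lamHat < lam ∧ (lam : ℂ) ∉ G.dirichletSpectrum Vo ∧
      SemigroupStronglyPositive (G.dtnMatrix Vo lam) := by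
  have hev := eventually_schur_netMatrix_one_pos hG hVo
  obtain ⟨lam, r, B, hlam, hsp, hr, hB, hD⟩ := exists_dtnMatrix_eq_smul_schur hL (w := 1)
    (fun _ => one_ne_zero) hev.self_of_nhds.1
    (Q := fun B => ∀ t : ℝ, 0 < t → ∀ i j, 0 < NormedSpace.exp ((-t) • B) i j)
    (hev.mono fun p hp => hp.2) lamHat
  refine ⟨lam, hlam, hsp, ?_⟩
  rw [hD, semigroupStronglyPositive_map_iff]
  intro t ht
  rw [smul_smul, neg_mul]
  exact hB (t * r) (by positivity)

/-- With the weights `-1` the semigroup runs backwards in time. -/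
theorem exists_not_eventuallyPositive (hG : G.graph.Connected) (hVo : 2 ≤ Vo.card)
    (hL : LinearIndependent ℚ G.length) (lamHat : ℝ) :
    ∃ lam : ℝ, lamHat < lam ∧ (lam : ℂ) ∉ G.dirichletSpectrum Vo ∧
      ¬ SemigroupEventuallyPositive (G.dtnMatrix Vo lam) := by
  have : Nontrivial Vo := by
    rw [← Fintype.one_lt_card_iff_nontrivial, Fintype.card_coe]; omega
  have hne : Vo.Nonempty := Finset.card_pos.1 (by omega)
  have hneg : ∀ c s : G.Edge → ℝ, G.netMatrix c s = (-1 : ℝ) • G.netMatrix (-c) (-s) := fun c s => by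
    rw [← netMatrix_smul]; simp
  have hev := eventually_schur_netMatrix_one_pos hG hne
  have hev' : ∀ᶠ p : (G.Edge → ℝ) × (G.Edge → ℝ) in nhds (-1, -1),
      (innerBlock (G.netMatrix (-p.1) (-p.2)) Vo).det ≠ 0 ∧ ∀ t : ℝ, 0 < t → ∀ i j,
        0 < NormedSpace.exp ((-t) • schur (G.netMatrix (-p.1) (-p.2)) Vo) i j := by
    have hc : Filter.Tendsto (fun p : (G.Edge → ℝ) × (G.Edge → ℝ) => -p) (nhds (-1, -1))
        (nhds (1, 1)) := by
      simpa using (continuous_neg (G := (G.Edge → ℝ) × (G.Edge → ℝ))).tendsto (-1, -1)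
    exact hc.eventually hev
  obtain ⟨lam, r, B, hlam, hsp, hr, hB, hD⟩ := exists_dtnMatrix_eq_smul_schur hL (w := -1)
    (fun _ => by simp)
    (by rw [hneg]; exact det_innerBlock_smul (by norm_num) hev'.self_of_nhds.1)
    (Q := fun B => ∀ t : ℝ, 0 < t → ∀ i j, 0 < NormedSpace.exp ((-t) • (-B)) i j)
    (hev'.mono fun p hp => by
      rw [hneg p.1, schur_smul (by norm_num) hp.1, neg_one_smul, neg_neg]
      exact hp.2) lamHat
  refine ⟨lam, hlam, hsp, ?_⟩
  rw [hD, semigroupEventuallyPositive_map_iff,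
    exp_smul_pos_iff hr fun M : Matrix Vo Vo ℝ => ∀ i j, 0 ≤ M i j]
  have := not_eventually_nonneg_of_pos hB
  rwa [neg_neg] at this

/-- Weights for which the Dirichlet-to-Neumann matrix is positive semidefinite with kernel spanned
by the constants and has a positive off-diagonal entry give rise to semigroups that are eventually
strongly positive, but not positive. -/
theorem exists_eventuallyStronglyPositive_of_weights (hL : LinearIndependent ℚ G.length)
    {w : G.Edge → ℝ} (hw : ∀ e, w e ≠ 0) (hdet : (innerBlock (G.netMatrix w w) Vo).det ≠ 0)
    (hpos : ∀ y : V → ℝ, (∀ v ∉ Vo, (G.netMatrix w w *ᵥ y) v = 0) → (∃ u ∈ Vo, ∃ v ∈ Vo, y u ≠ y v) →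
      0 < y ⬝ᵥ G.netMatrix w w *ᵥ y)
    {i j : Vo} (hij : i ≠ j) (hD : 0 < schur (G.netMatrix w w) Vo i j) (lamHat : ℝ) :
    ∃ lam : ℝ, lamHat < lam ∧ (lam : ℂ) ∉ G.dirichletSpectrum Vo ∧
      SemigroupEventuallyStronglyPositive (G.dtnMatrix Vo lam) ∧
      ¬ SemigroupPositive (G.dtnMatrix Vo lam) := by
  have : Nonempty Vo := ⟨i⟩
  set D := schur (G.netMatrix w w) Vo with hDdef
  have hone : G.netMatrix w w *ᵥ 1 = 0 := by
    ext v
    rw [netMatrix_mulVec]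
    simp
  have h1 : D *ᵥ 1 = 0 := by
    ext v
    have := schur_mulVec hdet (y := 1) (fun v _ => by rw [hone]; rfl) v
    rw [hone] at this
    exact this
  have h2 : ∀ x : Vo → ℝ, (∃ i j, x i ≠ x j) → 0 < x ⬝ᵥ D *ᵥ x := by
    rintro x ⟨u, v, huv⟩
    obtain ⟨y, hy1, hy2, -⟩ := exists_harmonic hdet x
    have h := dotProduct_schur_mulVec hdet hy2
    rw [funext hy1] at h
    rw [h]
    exact hpos y hy2 ⟨u, u.2, v, v.2, by rwa [hy1, hy1]⟩
  obtain ⟨T, hT, hT'⟩ := exists_forall_exp_neg_smul_pos (schur_isSymm netMatrix_isSymm) h1 h2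
  have hopen : ∀ᶠ B : Matrix Vo Vo ℝ in nhds D, 0 < B i j :=
    (show Continuous fun B : Matrix Vo Vo ℝ => B i j from
      (continuous_apply j).comp (continuous_apply i)).continuousAt.eventually (lt_mem_nhds hD)
  obtain ⟨lam, r, B, hlam, hsp, hr, ⟨hB, hBij⟩, hDB⟩ := exists_dtnMatrix_eq_smul_schur hL hw hdet
    ((continuousAt_schur_netMatrix (p := (w, w)) hdet).eventually
      ((eventually_exists_forall_exp_pos hT hT').and hopen)) lamHat
  refine ⟨lam, hlam, hsp, ?_, ?_⟩
  · rw [hDB, semigroupEventuallyStronglyPositive_map_iff,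
      exp_smul_pos_iff hr fun M : Matrix Vo Vo ℝ => ∀ i j, 0 < M i j]
    exact hB
  · rw [hDB, semigroupPositive_map_iff]
    intro h
    have := nonpos_of_exp_neg_smul_nonneg h hij
    rw [Matrix.smul_apply, smul_eq_mul] at this
    have := mul_pos hr hBij
    linarith

end QuantumGraph

/-! ### A negative weight near an inner vertex attached to three outer vertices -/

namespace Matrix

variable {V : Type*} [Fintype V] [DecidableEq V] {M : Matrix V V ℝ} {Vo : Finset V}

/-- Positivity of a non-negative function propagates backwards along negative matrix entries, as
long as the function is harmonic where it vanishes. -/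
theorem pos_of_reflTransGen (hoff : ∀ v w, v ≠ w → M v w ≤ 0) {y : V → ℝ} (hy : ∀ v, 0 ≤ y v)
    (hh : ∀ v ∉ Vo, y v = 0 → (M *ᵥ y) v = 0) {v w : V}
    (hvw : Relation.ReflTransGen (fun a b => a ∉ Vo ∧ M a b < 0) v w) (hw : 0 < y w) : 0 < y v := by
  induction hvw using Relation.ReflTransGen.head_induction_on with
  | refl => exact hw
  | head hab _ ih =>
    refine lt_of_le_of_ne (hy _) fun h0 => ?_
    exact ih.ne' (eq_zero_of_harmonic_of_eq_zero hoff hy (hh _ hab.1 h0.symm) h0.symm hab.2)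

omit [DecidableEq V] in
theorem DirichletPosDef.mono (h : DirichletPosDef M Vo) {W : Finset V} (hW : Vo ⊆ W) :
    DirichletPosDef M W := fun y h0 => h y fun v hv => h0 v (hW hv)

end Matrix

namespace QuantumGraph

open Matrix

section Attached

variable {V : Type*} {G : QuantumGraph V} {Vo : Finset V}

variable (G Vo) in
/-- `u` is reached from `z` by a walk all of whose vertices, except possibly `u`, are inner
vertices. -/
def Attached (z u : V) : Prop :=
  Relation.ReflTransGen (fun a b => a ∉ Vo ∧ G.graph.Adj a b) z u

theorem Attached.symm {z a : V} (h : G.Attached Vo z a) (ha : a ∉ Vo) : G.Attached Vo a z := by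
  induction h with
  | refl => exact .refl
  | tail _ hbc ih => exact .head ⟨ha, hbc.2.symm⟩ (ih hbc.1)

theorem Attached.eq_of_mem {z u : V} (h : G.Attached Vo z u) (hz : z ∈ Vo) : z = u := by
  rcases Relation.ReflTransGen.cases_head h with h | ⟨b, hb, -⟩
  · exact h
  · exact absurd hz hb.1

theorem attached_of_adj {z u : V} (hz : z ∉ Vo) (h : G.graph.Adj z u) : G.Attached Vo z u :=
  .single ⟨hz, h⟩

end Attached

variable {V : Type*} [Fintype V] [DecidableEq V] {G : QuantumGraph V} {Vo : Finset V}

theorem netMatrix_self_mulVec (w : G.Edge → ℝ) (y : V → ℝ) (v : V) :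
    (G.netMatrix w w *ᵥ y) v = ∑ e : G.Edge, w e *
      ((if G.left e = v then y (G.left e) - y (G.right e) else 0)
      + (if G.right e = v then y (G.right e) - y (G.left e) else 0)) := by
  rw [netMatrix_mulVec]
  refine Finset.sum_congr rfl fun e _ => ?_
  split_ifs <;> ring

theorem dotProduct_netMatrix_self_mulVec (w : G.Edge → ℝ) (z y : V → ℝ) :
    z ⬝ᵥ G.netMatrix w w *ᵥ y = ∑ e : G.Edge,
      w e * ((z (G.left e) - z (G.right e)) * (y (G.left e) - y (G.right e))) := by
  rw [dotProduct_netMatrix_mulVec]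
  exact Finset.sum_congr rfl fun e _ => by ring

/-- The edge from the inner vertex `z` to the outer vertex `o` is given a negative weight `-b`,
where `b` is slightly larger than the conductance between `z` and the outer vertices in the rest of
the graph. -/
theorem exists_eventuallyStronglyPositive_of_three (hG : G.graph.Connected)
    (hL : LinearIndependent ℚ G.length) {z : V} (hz : z ∉ Vo) {o u w : Vo} (hzo : G.graph.Adj z o)
    (hzu : G.Attached Vo z u) (hzw : G.Attached Vo z w) (hou : o ≠ u) (how : o ≠ w) (huw : u ≠ w)
    (lamHat : ℝ) :
    ∃ lam : ℝ, lamHat < lam ∧ (lam : ℂ) ∉ G.dirichletSpectrum Vo ∧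
      SemigroupEventuallyStronglyPositive (G.dtnMatrix Vo lam) ∧
      ¬ SemigroupPositive (G.dtnMatrix Vo lam) := by
  have hou' : (o : V) ≠ u := fun h => hou (Subtype.ext h)
  have how' : (o : V) ≠ w := fun h => how (Subtype.ext h)
  have hzV : ∀ a : Vo, (a : V) ≠ z := fun a h => hz (h ▸ a.2)
  obtain ⟨e₁, he₁⟩ := exists_edge_of_adj hzo
  -- the Laplacian of the graph without the edge `e₁`
  let w' : G.Edge → ℝ := fun e => if e = e₁ then 0 else 1
  have hw'0 : ∀ e, 0 ≤ w' e := fun e => by simp only [w']; split_ifs <;> norm_num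
  set L := G.netMatrix w' w' with hLdef
  have hLsymm : L.IsSymm := netMatrix_isSymm
  have hoff : ∀ a b, a ≠ b → L a b ≤ 0 := fun a b hab => netMatrix_apply_nonpos hw'0 hab
  have hedge : ∀ {a b : V}, a ∉ Vo → G.graph.Adj a b → b ≠ o → ∃ e ≠ e₁,
      (G.left e = a ∧ G.right e = b) ∨ (G.left e = b ∧ G.right e = a) := fun {a b} ha hab hb => by
    obtain ⟨e, he⟩ := exists_edge_of_adj hab
    refine ⟨e, fun h => ?_, he⟩
    have hao : a ≠ o := fun h => ha (h ▸ o.2)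
    subst h
    rcases he with ⟨h1, h2⟩ | ⟨h1, h2⟩ <;> rcases he₁ with ⟨h3, h4⟩ | ⟨h3, h4⟩
    · exact hb (h2.symm.trans h4)
    · exact hao (h1.symm.trans h3)
    · exact hao (h2.symm.trans h4)
    · exact hb (h1.symm.trans h3)
  have hneg : ∀ {a b : V}, a ∉ Vo → G.graph.Adj a b → b ≠ o → L a b < 0 := fun {a b} ha hab hb => by
    obtain ⟨e, he, h⟩ := hedge ha hab hb
    exact netMatrix_apply_neg_of_edge hw'0 h (by simp [w', he])
  have hpath : ∀ {a : V} {v : Vo}, o ≠ v → G.Attached Vo a v →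
      Relation.ReflTransGen (fun a b => (a ∉ Vo ∧ G.graph.Adj a b) ∧ b ≠ o) a v := fun {a v} hov h => by
    induction h using Relation.ReflTransGen.head_induction_on with
    | refl => exact .refl
    | head hab hbv ih =>
      refine .head ⟨hab, ?_⟩ ih
      rintro rfl
      exact hov (Subtype.ext (Attached.eq_of_mem hbv o.2))
  have hpathL : ∀ {a : V} {v : Vo}, o ≠ v → G.Attached Vo a v →
      Relation.ReflTransGen (fun a b => a ∉ Vo ∧ L a b < 0) a v := fun hov h =>
    Relation.ReflTransGen.mono (fun _ _ h => ⟨h.1.1, hneg h.1.1 h.1.2 h.2⟩) _ _ (hpath hov h)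
  -- functions that are constant along all edges but `e₁`
  have hE0 : ∀ y : V → ℝ, 0 ≤ y ⬝ᵥ L *ᵥ y := fun y => by
    rw [dotProduct_netMatrix_self_mulVec]
    exact Finset.sum_nonneg fun e _ => mul_nonneg (hw'0 e) (mul_self_nonneg _)
  have hEeq : ∀ y : V → ℝ, y ⬝ᵥ L *ᵥ y = 0 → ∀ e ≠ e₁, y (G.left e) = y (G.right e) := by
    intro y hy e he
    rw [dotProduct_netMatrix_self_mulVec] at hy
    have := (Finset.sum_eq_zero_iff_of_nonneg fun e _ => mul_nonneg (hw'0 e) (mul_self_nonneg _)).1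
      hy e (Finset.mem_univ e)
    simpa [w', he, sub_eq_zero] using this
  have hconst : ∀ y : V → ℝ, y ⬝ᵥ L *ᵥ y = 0 → y z = y o → ∀ a b, y a = y b := by
    intro y hy hzo' a b
    refine eq_of_forall_edge hG (fun e => ?_) a b
    by_cases he : e = e₁
    · subst he
      rcases he₁ with ⟨h1, h2⟩ | ⟨h1, h2⟩
      · rw [h1, h2, hzo']
      · rw [h1, h2, hzo']
    · exact hEeq y hy e he
  have hPD : DirichletPosDef L Vo := by
    intro y h0 hy
    refine lt_of_le_of_ne (hE0 y) fun hE => hy ?_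
    have hyu : ∀ a, Relation.ReflTransGen (fun a b => (a ∉ Vo ∧ G.graph.Adj a b) ∧ b ≠ o) a u →
        y a = y u := fun a ha => by
      induction ha using Relation.ReflTransGen.head_induction_on with
      | refl => rfl
      | head hab _ ih =>
        obtain ⟨e, he, ⟨h1, h2⟩ | ⟨h1, h2⟩⟩ := hedge hab.1.1 hab.1.2 hab.2
        · rw [← ih, ← h1, ← h2]; exact hEeq y hE.symm e he
        · rw [← ih, ← h1, ← h2]; exact (hEeq y hE.symm e he).symm
    have hzo' : y z = y o := by rw [hyu z (hpath hou hzu), h0 u u.2, h0 o o.2]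
    ext a
    rw [hconst y hE.symm hzo' a o, h0 o o.2]; rfl
  -- the potential of a unit voltage at `z`
  obtain ⟨g, hg1, hg2, -⟩ := exists_harmonic (hPD.mono (Finset.subset_insert z Vo)).det_ne_zero
    (Pi.single ⟨z, Finset.mem_insert_self z Vo⟩ (1 : ℝ))
  have hgz : g z = 1 := by simpa using hg1 ⟨z, Finset.mem_insert_self z Vo⟩
  have hg0 : ∀ a ∈ Vo, g a = 0 := fun a ha => by
    rw [hg1 ⟨a, Finset.mem_insert_of_mem ha⟩, Pi.single_eq_of_ne]
    exact fun h => hzV ⟨a, ha⟩ (congrArg Subtype.val h)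
  have hgh : ∀ a ∉ Vo, a ≠ z → (L *ᵥ g) a = 0 := fun a ha haz => hg2 a (by simp [ha, haz])
  set k := (L *ᵥ g) z with hk
  have hgk : g ⬝ᵥ L *ᵥ g = k := by
    rw [dotProduct, Finset.sum_eq_single z, hgz, one_mul]
    · intro a _ haz
      by_cases ha : a ∈ Vo
      · rw [hg0 a ha, zero_mul]
      · rw [hgh a ha haz, mul_zero]
    · simp
  have hk0 : 0 < k := hgk ▸ hPD g hg0 fun h => by simp [h] at hgz
  have hgnn : ∀ a, 0 ≤ g a := hPD.nonneg hoff (fun a ha => (hg0 a ha).ge) fun a ha => by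
    by_cases haz : a = z
    · rw [haz]; exact hk0.le
    · exact (hgh a ha haz).ge
  have hgu : (L *ᵥ g) u < 0 := by
    rcases Relation.ReflTransGen.cases_tail hzu with h | ⟨a, hza, ha, hau⟩
    · exact absurd h (hzV u)
    have haz := Attached.symm hza ha
    have hga : 0 < g a := by
      refine pos_of_reflTransGen hoff hgnn (Vo := Vo) (fun b hb hb0 => hgh b hb ?_)
        (w := z) ?_ (by rw [hgz]; exact one_pos)
      · rintro rfl; rw [hgz] at hb0; exact one_ne_zero hb0
      · clear hza hau
        induction haz using Relation.ReflTransGen.head_induction_on with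
        | refl => exact .refl
        | head hab hbz ih =>
          have hb : _ ∉ Vo := fun hb => hz (Attached.eq_of_mem hbz hb ▸ hb)
          exact .head ⟨hab.1, hneg hab.1 hab.2 fun h => hb (h ▸ o.2)⟩ (ih hb)
    have hle : ∀ b ∈ Finset.univ, L u b * g b ≤ 0 := fun b _ => by
      by_cases hb : (u : V) = b
      · rw [← hb, hg0 u u.2, mul_zero]
      · exact mul_nonpos_of_nonpos_of_nonneg (hoff _ _ hb) (hgnn b)
    refine Finset.sum_neg' hle ⟨a, Finset.mem_univ a, mul_neg_of_neg_of_pos ?_ hga⟩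
    refine lt_of_eq_of_lt (hLsymm.apply _ _).symm ?_
    exact hneg ha hau hou'.symm
  -- the harmonic measure of `w`
  obtain ⟨p, hp1, hp2, -⟩ := exists_harmonic hPD.det_ne_zero (Pi.single w (1 : ℝ))
  have hpnn : ∀ a, 0 ≤ p a := hPD.nonneg hoff
    (fun a ha => by rw [hp1 ⟨a, ha⟩, Pi.single_apply]; split_ifs <;> norm_num)
    (fun a ha => (hp2 a ha).ge)
  have hpz : 0 < p z := pos_of_reflTransGen hoff hpnn (fun b hb _ => hp2 b hb) (hpathL how hzw)
    (by rw [hp1]; simp)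
  -- the resonant weight
  set ε := k * p z * -(L *ᵥ g) u / (|(L *ᵥ p) u| + 1) with hε
  have hκ : 0 < -(L *ᵥ g) u := neg_pos.2 hgu
  have hε0 : 0 < ε := by positivity
  set b := k + ε with hb
  have hb0 : 0 < b := by positivity
  let wt : G.Edge → ℝ := fun e => if e = e₁ then -b else 1
  have hwt : ∀ e, wt e = w' e - b * if e = e₁ then 1 else 0 := fun e => by
    simp only [wt, w']; split_ifs <;> ring
  set M := G.netMatrix wt wt with hM
  have hMv : ∀ (y : V → ℝ) (a : V), (M *ᵥ y) a = (L *ᵥ y) a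
      - b * (y z - y o) * ((if a = z then 1 else 0) - if a = o then 1 else 0) := fun y a => by
    rw [netMatrix_self_mulVec, netMatrix_self_mulVec]
    simp only [hwt, sub_mul, Finset.sum_sub_distrib, mul_assoc, ite_mul, one_mul, zero_mul,
      mul_ite, mul_zero, Finset.sum_ite_eq', Finset.mem_univ, if_true]
    congr 1
    have hzo' := hzo.ne
    rcases he₁ with ⟨h1, h2⟩ | ⟨h1, h2⟩
    · rw [h1, h2]; simp only [eq_comm (a := a)]; split_ifs <;> ring
    · rw [h1, h2]; simp only [eq_comm (a := a)]; split_ifs <;> ring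
  have hME : ∀ y : V → ℝ, y ⬝ᵥ M *ᵥ y = y ⬝ᵥ L *ᵥ y - b * (y z - y o) ^ 2 := fun y => by
    rw [dotProduct_netMatrix_self_mulVec, dotProduct_netMatrix_self_mulVec]
    simp only [hwt, sub_mul, Finset.sum_sub_distrib, mul_assoc, ite_mul, one_mul, zero_mul,
      mul_ite, mul_zero, Finset.sum_ite_eq', Finset.mem_univ, if_true]
    congr 1
    rcases he₁ with ⟨h1, h2⟩ | ⟨h1, h2⟩
    · rw [h1, h2]; ring
    · rw [h1, h2]; ring
  -- decomposition of the harmonic functions of the new weights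
  have hdec : ∀ y : V → ℝ, (∀ a ∉ Vo, (M *ᵥ y) a = 0) →
      ∀ a ∉ Vo, (L *ᵥ (y - (b * (y z - y o) / k) • g)) a = 0 := fun y hy a ha => by
    have h := hy a ha
    have hao : a ≠ o := fun h => ha (h ▸ o.2)
    rw [hMv, if_neg hao] at h
    rw [mulVec_sub, mulVec_smul, Pi.sub_apply, Pi.smul_apply, smul_eq_mul]
    by_cases haz : a = z
    · rw [if_pos haz] at h
      rw [haz] at h ⊢
      rw [← hk]; field_simp; linarith
    · rw [if_neg haz] at h
      rw [hgh a ha haz]; linarith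
  have hdiff : ∀ y : V → ℝ, (y - (b * (y z - y o) / k) • g) z - (y - (b * (y z - y o) / k) • g) o
      = -(ε / k) * (y z - y o) := fun y => by
    simp only [Pi.sub_apply, Pi.smul_apply, smul_eq_mul, hgz, hg0 o o.2]
    rw [hb]; field_simp; ring
  have hdet : (innerBlock M Vo).det ≠ 0 := by
    intro hdet
    obtain ⟨y, hy, h0, h1⟩ := exists_harmonic_of_det_eq_zero hdet
    have hp := eq_zero_of_harmonic hPD.det_ne_zero
      (fun a ha => by simp [h0 a ha, hg0 a ha]) (hdec y h1)
    have hd := hdiff y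
    rw [hp, Pi.zero_apply, Pi.zero_apply, sub_zero] at hd
    have hd0 : y z - y o = 0 :=
      (mul_eq_zero.1 hd.symm).resolve_left (neg_ne_zero.2 (by positivity))
    rw [hd0] at hp
    exact hy (by simpa using hp)
  refine exists_eventuallyStronglyPositive_of_weights hL (w := wt) (fun e => ?_) hdet ?_ huw ?_ lamHat
  · simp only [wt]; split_ifs
    · exact neg_ne_zero.2 hb0.ne'
    · exact one_ne_zero
  · rintro y hy ⟨a, -, c, -, hac⟩
    set d := y z - y o with hd
    set t := b * d / k with ht
    set q := y - t • g with hq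
    have hq0 : g ⬝ᵥ L *ᵥ q = 0 := Finset.sum_eq_zero fun a _ => by
      by_cases ha : a ∈ Vo
      · rw [hg0 a ha, zero_mul]
      · rw [hdec y hy a ha, mul_zero]
    have hq0' : q ⬝ᵥ L *ᵥ g = 0 := by
      rw [dotProduct_mulVec, ← mulVec_transpose, hLsymm.eq, dotProduct_comm, hq0]
    have hy : y = q + t • g := by rw [hq]; abel
    have hE : y ⬝ᵥ L *ᵥ y = q ⬝ᵥ L *ᵥ q + t ^ 2 * k := by
      conv_lhs => rw [hy]
      rw [mulVec_add, mulVec_smul, dotProduct_add, add_dotProduct, add_dotProduct, smul_dotProduct,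
        smul_dotProduct, dotProduct_smul, dotProduct_smul, hq0, hq0', hgk]
      simp only [smul_eq_mul]
      ring
    rw [hME, hE]
    have hval : t ^ 2 * k - b * d ^ 2 = b * d ^ 2 * (ε / k) := by
      rw [ht]; field_simp; rw [hb]; ring
    rw [← hd, add_sub_assoc, hval]
    by_cases hd0 : d = 0
    · have hqy : q = y := by rw [hq, ht, hd0]; simp
      rw [hd0, hqy]
      refine lt_of_le_of_ne (by have := hE0 y; simpa using this) fun h => hac ?_
      exact hconst y (by simpa using h.symm) (sub_eq_zero.1 hd0) a c
    · have := hE0 q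
      positivity
  · obtain ⟨y, h1, h2, -⟩ := exists_harmonic hdet (Pi.single w (1 : ℝ))
    rw [schur_apply hdet h1 h2]
    have hyo : y o = 0 := by rw [h1, Pi.single_eq_of_ne how]
    have hyp : y - (b * (y z - y o) / k) • g = p := harmonic_unique hPD.det_ne_zero
      (fun a ha => by
        have := (h1 ⟨a, ha⟩).trans (hp1 ⟨a, ha⟩).symm
        simpa [hg0 a ha] using this) (hdec y h2) hp2
    have hd := hdiff y
    have hpo : p o = 0 := by rw [hp1, Pi.single_eq_of_ne how]
    rw [hyp, hpo, sub_zero] at hd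
    set d := y z - y o
    have hyd : y = p + (b * d / k) • g := by rw [← hyp]; abel
    rw [hMv, if_neg (hzV u), if_neg hou'.symm, sub_zero, mul_zero, sub_zero]
    rw [hyd, mulVec_add, mulVec_smul, Pi.add_apply, Pi.smul_apply, smul_eq_mul]
    have ht : b * d / k = -(b * p z / ε) := by
      rw [hd]; field_simp
    rw [ht]
    have h3 : k * p z * -(L *ᵥ g) u / ε = |(L *ᵥ p) u| + 1 := by
      rw [hε]; exact div_div_cancel₀ (by positivity)
    have h4 : -(b * p z / ε) * (L *ᵥ g) u = k * p z * -(L *ᵥ g) u / ε + p z * -(L *ᵥ g) u := by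
      rw [hb]; field_simp; ring
    rw [h4, h3]
    have := neg_abs_le ((L *ᵥ p) u)
    have : 0 < p z * -(L *ᵥ g) u := by positivity
    linarith

end QuantumGraph

/-! ### Small negative weights on an edge of the reduced graph that is not a bridge -/

namespace QuantumGraph

open Matrix

section ReducedGraph

variable {V : Type*} [Fintype V] {G : QuantumGraph V} {Vo : Finset V}

omit [Fintype V] in
theorem attached_of_walk {b t : V} (p : G.graph.Walk b t) (h : ∀ a ∈ p.support, a ≠ t → a ∉ Vo) :
    G.Attached Vo b t := by
  induction p with
  | nil => exact .refl
  | @cons a b t hab q ih =>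
    by_cases hat : a = t
    · subst hat; exact .refl
    · exact .head ⟨h a (by simp) hat, hab⟩ (ih fun c hc => h c (by simp [hc]))

omit [Fintype V] in
theorem exists_attached_of_reducedGraph_adj {s t : Vo} (h : (G.reducedGraph Vo).Adj s t) :
    ∃ b : V, G.graph.Adj s b ∧ G.Attached Vo b t := by
  obtain ⟨hne, h | ⟨p, hp, hs⟩⟩ := h
  · exact ⟨t, h, .refl⟩
  · have hne' : (s : V) ≠ t := fun h => hne (Subtype.ext h)
    obtain ⟨b, hsb, q, rfl⟩ := SimpleGraph.Walk.exists_eq_cons_of_ne hne' p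
    rw [SimpleGraph.Walk.cons_isPath_iff] at hp
    refine ⟨b, hsb, attached_of_walk q fun a ha hat => hs a (by simp [ha]) ?_ hat⟩
    rintro rfl
    exact hp.2 ha

end ReducedGraph

variable {V : Type*} [Fintype V] [DecidableEq V] {G : QuantumGraph V} {Vo : Finset V}

theorem netMatrix_self_mulVec_congr {w w' : G.Edge → ℝ} {y y' : V → ℝ} {r : ℝ} {v : V}
    (h : ∀ e, (G.left e = v ∨ G.right e = v) →
      w e * (y (G.left e) - y (G.right e)) = r * (w' e * (y' (G.left e) - y' (G.right e)))) :
    (G.netMatrix w w *ᵥ y) v = r * (G.netMatrix w' w' *ᵥ y') v := by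
  rw [netMatrix_self_mulVec, netMatrix_self_mulVec, Finset.mul_sum]
  refine Finset.sum_congr rfl fun e _ => ?_
  by_cases h1 : G.left e = v
  · have h2 : G.right e ≠ v := fun h2 => left_ne_right e (h1.trans h2.symm)
    rw [if_pos h1, if_pos h1, if_neg h2, if_neg h2, add_zero, add_zero]
    exact h e (Or.inl h1)
  · by_cases h2 : G.right e = v
    · rw [if_pos h2, if_pos h2, if_neg h1, if_neg h1, zero_add, zero_add]
      linear_combination -h e (Or.inr h2)
    · simp [h1, h2]

omit [DecidableEq V] in
/-- The difference of the values of a function at two vertices that are joined by edges in `N` is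
controlled by its energy on `N`. -/
theorem exists_sq_sub_le_energy {N : G.Edge → Prop} [DecidablePred N] {u v : V}
    (h : Relation.ReflTransGen (fun a b => ∃ e, N e ∧
      ((G.left e = a ∧ G.right e = b) ∨ (G.left e = b ∧ G.right e = a))) u v) :
    ∃ C : ℝ, 0 ≤ C ∧ ∀ y : V → ℝ,
      (y u - y v) ^ 2 ≤ C * ∑ e, if N e then (y (G.left e) - y (G.right e)) ^ 2 else 0 := by
  induction h with
  | refl => exact ⟨0, le_rfl, fun y => by simp⟩
  | @tail b c _ hbc ih =>
    obtain ⟨C, hC, h⟩ := ih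
    obtain ⟨e, he, hbc⟩ := hbc
    refine ⟨2 * C + 2, by positivity, fun y => ?_⟩
    have h1 := h y
    have h2 : (y b - y c) ^ 2 ≤ ∑ e, if N e then (y (G.left e) - y (G.right e)) ^ 2 else 0 := by
      refine le_of_eq_of_le ?_ (Finset.single_le_sum (fun e _ => ?_) (Finset.mem_univ e))
      · rw [if_pos he]
        rcases hbc with ⟨h3, h4⟩ | ⟨h3, h4⟩
        · rw [h3, h4]
        · rw [h3, h4]; ring
      · split_ifs
        · positivity
        · exact le_rfl
    nlinarith [sq_nonneg ((y u - y b) - (y b - y c))]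

/-- The edge of the reduced graph between `o` and `v` consists of the edges of the graph that join
`o` and `v` or belong to an inner component attached to `o` and `v`. These edges are given the
weight `-δ` for a small `δ`; since `o` and `v` are connected through other edges, the energy remains
positive. -/
theorem exists_eventuallyStronglyPositive_of_not_isBridge (hG : G.graph.Connected)
    (hL : LinearIndependent ℚ G.length)
    (hthree : ∀ z ∉ Vo, ∀ a b c : Vo, G.Attached Vo z a → G.Attached Vo z b → G.Attached Vo z c →
      a = b ∨ a = c ∨ b = c)
    {o v : Vo} (hov : (G.reducedGraph Vo).Adj o v)
    (hbr : ¬ (G.reducedGraph Vo).IsBridge s(o, v)) (lamHat : ℝ) :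
    ∃ lam : ℝ, lamHat < lam ∧ (lam : ℂ) ∉ G.dirichletSpectrum Vo ∧
      SemigroupEventuallyStronglyPositive (G.dtnMatrix Vo lam) ∧
      ¬ SemigroupPositive (G.dtnMatrix Vo lam) := by
  classical
  have hVo : Vo.Nonempty := ⟨o, o.2⟩
  have hne : o ≠ v := hov.ne
  have hne' : (o : V) ≠ v := fun h => hne (Subtype.ext h)
  let T : V → Prop := fun z => z ∉ Vo ∧ G.Attached Vo z o ∧ G.Attached Vo z v
  let F : G.Edge → Prop := fun e =>
    s(G.left e, G.right e) = s((o : V), (v : V)) ∨ T (G.left e) ∨ T (G.right e)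
  have hTadj : ∀ {a b : V}, a ∉ Vo → G.graph.Adj a b → T b → T a := fun ha hab hb =>
    ⟨ha, .head ⟨ha, hab⟩ hb.2.1, .head ⟨ha, hab⟩ hb.2.2⟩
  have hF_left : ∀ e, G.left e ∉ Vo → (F e ↔ T (G.left e)) := fun e he => by
    refine ⟨fun h => ?_, fun h => Or.inr (Or.inl h)⟩
    rcases h with h | h | h
    · have : G.left e ∈ s((o : V), (v : V)) := h ▸ Sym2.mem_mk_left _ _
      rcases Sym2.mem_iff.1 this with h | h
      · exact absurd (h ▸ o.2) he
      · exact absurd (h ▸ v.2) he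
    · exact h
    · exact hTadj he (adj_left_right e) h
  have hF_right : ∀ e, G.right e ∉ Vo → (F e ↔ T (G.right e)) := fun e he => by
    refine ⟨fun h => ?_, fun h => Or.inr (Or.inr h)⟩
    rcases h with h | h | h
    · have : G.right e ∈ s((o : V), (v : V)) := h ▸ Sym2.mem_mk_right _ _
      rcases Sym2.mem_iff.1 this with h | h
      · exact absurd (h ▸ o.2) he
      · exact absurd (h ▸ v.2) he
    · exact hTadj he (adj_left_right e).symm h
    · exact h
  have hF_of_edge : ∀ {e : G.Edge} {a b : V}, ((G.left e = a ∧ G.right e = b) ∨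
      (G.left e = b ∧ G.right e = a)) → (F e ↔ s(a, b) = s((o : V), (v : V)) ∨ T a ∨ T b) := by
    rintro e a b (⟨rfl, rfl⟩ | ⟨rfl, rfl⟩)
    · exact Iff.rfl
    · simp only [F]; rw [Sym2.eq_swap, or_comm (a := T (G.left e))]
  -- `o` and `v` are connected by edges outside `F`
  let R : V → V → Prop := fun a b => ∃ e, ¬ F e ∧
    ((G.left e = a ∧ G.right e = b) ∨ (G.left e = b ∧ G.right e = a))
  have hR : ∀ {a b : V}, G.graph.Adj a b → s(a, b) ≠ s((o : V), (v : V)) → ¬ T a → ¬ T b → R a b :=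
    fun hab h1 h2 h3 => by
      obtain ⟨e, he⟩ := exists_edge_of_adj hab
      exact ⟨e, by rw [hF_of_edge he]; tauto, he⟩
  have hstep : ∀ s t : Vo, (G.reducedGraph Vo).Adj s t → s(s, t) ≠ s(o, v) →
      Relation.ReflTransGen R s t := by
    intro s t hst hne2
    have hnT : ∀ b, G.Attached Vo b s → G.Attached Vo b t → ¬ T b := fun b hs ht hT => by
      rcases hthree b hT.1 s o v hs hT.2.1 hT.2.2 with h1 | h1 | h1
      · rcases hthree b hT.1 t o v ht hT.2.1 hT.2.2 with h2 | h2 | h2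
        · exact hst.ne (h1.trans h2.symm)
        · exact hne2 (by rw [h1, h2])
        · exact hne h2
      · rcases hthree b hT.1 t o v ht hT.2.1 hT.2.2 with h2 | h2 | h2
        · exact hne2 (by rw [h1, h2, Sym2.eq_swap])
        · exact hst.ne (h1.trans h2.symm)
        · exact hne h2
      · exact hne h1
    have hchain : ∀ b : V, G.Attached Vo b t → (b ∉ Vo → G.Attached Vo b s) →
        Relation.ReflTransGen R b t := fun b hb => by
      induction hb using Relation.ReflTransGen.head_induction_on with
      | refl => exact fun _ => .refl
      | @head a b hab hbt ih =>
        intro has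
        have hbs : b ∉ Vo → G.Attached Vo b s := fun hb => .head ⟨hb, hab.2.symm⟩ (has hab.1)
        refine .head (hR hab.2 (fun h => ?_) (hnT a (has hab.1) (.head hab hbt)) fun hT => ?_)
          (ih hbs)
        · have : a ∈ s((o : V), (v : V)) := h ▸ Sym2.mem_mk_left _ _
          rcases Sym2.mem_iff.1 this with h | h
          · exact hab.1 (h ▸ o.2)
          · exact hab.1 (h ▸ v.2)
        · exact hnT b (hbs hT.1) hbt hT
    obtain ⟨b, hsb, hbt⟩ := exists_attached_of_reducedGraph_adj hst
    have hbs : b ∉ Vo → G.Attached Vo b s := fun hb => attached_of_adj hb hsb.symm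
    refine .head (hR hsb (fun h => ?_) (fun hT => hT.1 s.2) fun hT => hnT b (hbs hT.1) hbt hT)
      (hchain b hbt hbs)
    have hb : b ∈ Vo := by
      have : b ∈ s((o : V), (v : V)) := h ▸ Sym2.mem_mk_right _ _
      rcases Sym2.mem_iff.1 this with h | h
      · exact h ▸ o.2
      · exact h ▸ v.2
    have hbt' := hbt.eq_of_mem hb
    rw [hbt'] at h
    apply hne2
    rcases Sym2.eq_iff.1 h with ⟨h1, h2⟩ | ⟨h1, h2⟩
    · rw [Subtype.ext h1, Subtype.ext h2]
    · rw [Subtype.ext h1, Subtype.ext h2, Sym2.eq_swap]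
  have hRov : Relation.ReflTransGen R o v := by
    rw [SimpleGraph.isBridge_iff, not_not, SimpleGraph.reachable_iff_reflTransGen] at hbr
    have key : ∀ t : Vo, Relation.ReflTransGen
        ((G.reducedGraph Vo).deleteEdges {s(o, v)}).Adj o t → Relation.ReflTransGen R o t := by
      intro t ht
      induction ht with
      | refl => exact .refl
      | tail _ hbc ih =>
        rw [SimpleGraph.deleteEdges_adj] at hbc
        exact ih.trans (hstep _ _ hbc.1 hbc.2)
    exact key v hbr
  obtain ⟨C, hC, hCle⟩ := exists_sq_sub_le_energy (N := fun e => ¬ F e) hRov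
  -- the weights
  set n : ℝ := ((Fintype.card G.Edge : ℕ) : ℝ) with hn
  have hn0 : 0 ≤ n := Nat.cast_nonneg _
  set δ : ℝ := (2 * (n * C) + 1)⁻¹ with hδ
  have hδ0 : 0 < δ := by positivity
  have hδC : δ * (n * C) ≤ 1 / 2 := by
    rw [hδ, inv_mul_le_iff₀ (by positivity)]
    have : 0 ≤ n * C := by positivity
    linarith
  let w : G.Edge → ℝ := fun e => if F e then -δ else 1
  set M := G.netMatrix w w with hM
  set L := G.netMatrix (1 : G.Edge → ℝ) 1 with hLdef
  have hPD : DirichletPosDef L Vo :=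
    netMatrix_dirichletPosDef hG hVo (fun _ => one_pos) fun _ => le_rfl
  have hoff : ∀ a b, a ≠ b → L a b ≤ 0 := fun a b hab =>
    netMatrix_apply_nonpos (fun _ => zero_le_one) hab
  have hLneg : ∀ {a b}, G.graph.Adj a b → L a b < 0 := fun hab =>
    netMatrix_apply_neg (fun _ => one_pos) hab
  -- the weights are constant around every inner vertex
  have hML : ∀ (y : V → ℝ), ∀ a ∉ Vo, (M *ᵥ y) a = (if T a then -δ else 1) * (L *ᵥ y) a :=
    fun y a ha => netMatrix_self_mulVec_congr fun e he => by
      have hFT : F e ↔ T a := by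
        rcases he with rfl | rfl
        · exact hF_left e ha
        · exact hF_right e ha
      simp only [w, hFT, Pi.one_apply, one_mul]
  have hc : ∀ a, (if T a then -δ else 1) ≠ 0 := fun a => by
    split_ifs
    · exact neg_ne_zero.2 hδ0.ne'
    · exact one_ne_zero
  have hLh : ∀ y : V → ℝ, (∀ a ∉ Vo, (M *ᵥ y) a = 0) → ∀ a ∉ Vo, (L *ᵥ y) a = 0 := fun y hy a ha =>
    (mul_eq_zero.1 ((hML y a ha).symm.trans (hy a ha))).resolve_left (hc a)
  have hdet : (innerBlock M Vo).det ≠ 0 := fun hdet => by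
    obtain ⟨y, hy, h0, h1⟩ := exists_harmonic_of_det_eq_zero hdet
    exact hy (eq_zero_of_harmonic hPD.det_ne_zero h0 (hLh y h1))
  have hT_end : ∀ {a b : V}, T a → G.graph.Adj a b → T b ∨ b = o ∨ b = v := fun {a b} ha hab => by
    by_cases hb : b ∈ Vo
    · rcases hthree a ha.1 ⟨b, hb⟩ o v (attached_of_adj ha.1 hab) ha.2.1 ha.2.2 with h | h | h
      · exact Or.inr (Or.inl (congrArg Subtype.val h))
      · exact Or.inr (Or.inr (congrArg Subtype.val h))
      · exact absurd h hne
    · exact Or.inl (hTadj hb hab.symm ha)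
  have hF_end : ∀ e, F e → (T (G.left e) ∨ G.left e = o ∨ G.left e = v) ∧
      (T (G.right e) ∨ G.right e = o ∨ G.right e = v) := fun e he => by
    rcases he with h | h | h
    · rcases Sym2.eq_iff.1 h with ⟨h1, h2⟩ | ⟨h1, h2⟩
      · exact ⟨Or.inr (Or.inl h1), Or.inr (Or.inr h2)⟩
      · exact ⟨Or.inr (Or.inr h1), Or.inr (Or.inl h2)⟩
    · exact ⟨Or.inl h, hT_end h (adj_left_right e)⟩
    · exact ⟨hT_end h (adj_left_right e).symm, Or.inl h⟩
  have hw : ∀ (e : G.Edge) (x : ℝ), w e * x = (if ¬ F e then x else 0) - δ * if F e then x else 0 :=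
    fun e x => by
      by_cases he : F e
      · simp [w, he]
      · simp [w, he]
  refine exists_eventuallyStronglyPositive_of_weights hL (w := w) (fun e => ?_) hdet ?_ hne ?_ lamHat
  · simp only [w]; split_ifs
    · exact neg_ne_zero.2 hδ0.ne'
    · exact one_ne_zero
  · rintro y hy ⟨a, -, c, -, hac⟩
    -- Dirichlet's principle bounds the energy on `F`
    have hEF : ∑ e, (if F e then (y (G.left e) - y (G.right e)) ^ 2 else 0) ≤ n * (y o - y v) ^ 2 := by
      let ζ : V → ℝ := fun u => if T u then y u - y v else 0
      have hζ : ζ ⬝ᵥ M *ᵥ y = 0 := Finset.sum_eq_zero fun u _ => by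
        by_cases hu : T u
        · rw [hy u hu.1, mul_zero]
        · simp [ζ, hu]
      rw [dotProduct_netMatrix_self_mulVec] at hζ
      have h1 : ∀ e, w e * ((ζ (G.left e) - ζ (G.right e)) * (y (G.left e) - y (G.right e)))
          = -δ * if F e then (ζ (G.left e) - ζ (G.right e)) * (y (G.left e) - y (G.right e)) else 0 :=
        fun e => by
          rw [hw]
          by_cases he : F e
          · simp [he]
          · have hl : ¬ T (G.left e) := fun h => he (Or.inr (Or.inl h))
            have hr : ¬ T (G.right e) := fun h => he (Or.inr (Or.inr h))
            simp [he, ζ, hl, hr]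
      rw [Finset.sum_congr rfl fun e _ => h1 e, ← Finset.mul_sum] at hζ
      have h2 := (mul_eq_zero.1 hζ).resolve_left (neg_ne_zero.2 hδ0.ne')
      have hφ : ∀ u, (T u ∨ u = o ∨ u = v) → y u - ζ u = y o ∨ y u - ζ u = y v := fun u hu => by
        by_cases hT : T u
        · right; simp [ζ, hT]
        · rcases hu with hu | rfl | rfl
          · exact absurd hu hT
          · left; simp [ζ, hT]
          · right; simp [ζ, hT]
      have h3 : ∀ e, (if F e then (y (G.left e) - y (G.right e)) ^ 2 else 0) ≤ (y o - y v) ^ 2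
          + 2 * if F e then (ζ (G.left e) - ζ (G.right e)) * (y (G.left e) - y (G.right e)) else 0 :=
        fun e => by
          by_cases he : F e
          · rw [if_pos he, if_pos he]
            obtain ⟨hl, hr⟩ := hF_end e he
            have h4 : ((y (G.left e) - ζ (G.left e)) - (y (G.right e) - ζ (G.right e))) ^ 2
                ≤ (y o - y v) ^ 2 := by
              rcases hφ _ hl with h | h <;> rcases hφ _ hr with h' | h' <;> rw [h, h']
              · rw [sub_self, zero_pow two_ne_zero]; positivity
              · exact (sub_sq_comm _ _).le
              · rw [sub_self, zero_pow two_ne_zero]; positivity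
            nlinarith [sq_nonneg (ζ (G.left e) - ζ (G.right e))]
          · rw [if_neg he, if_neg he]; positivity
      refine (Finset.sum_le_sum fun e _ => h3 e).trans ?_
      rw [Finset.sum_add_distrib, ← Finset.mul_sum, h2, Finset.sum_const, Finset.card_univ,
        nsmul_eq_mul, mul_zero, add_zero]
    have hE : y ⬝ᵥ M *ᵥ y
        = (∑ e, if ¬ F e then (y (G.left e) - y (G.right e)) ^ 2 else 0)
          - δ * ∑ e, if F e then (y (G.left e) - y (G.right e)) ^ 2 else 0 := by
      rw [dotProduct_netMatrix_self_mulVec, Finset.mul_sum, ← Finset.sum_sub_distrib]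
      refine Finset.sum_congr rfl fun e _ => ?_
      rw [hw, ← sq]
    set EN := ∑ e, if ¬ F e then (y (G.left e) - y (G.right e)) ^ 2 else 0 with hEN
    set EF := ∑ e, if F e then (y (G.left e) - y (G.right e)) ^ 2 else 0 with hEFdef
    have hnn : ∀ (P : Prop) [Decidable P] (x : ℝ), 0 ≤ if P then x ^ 2 else 0 := fun P _ x => by
      split_ifs
      · positivity
      · exact le_rfl
    have hEN0 : 0 ≤ EN := Finset.sum_nonneg fun e _ => hnn _ _
    have hCy := hCle y
    rw [← hEN] at hCy
    have h5 : δ * EF ≤ EN / 2 := by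
      have h6 : EF ≤ n * C * EN := hEF.trans (by rw [mul_assoc]; gcongr)
      calc δ * EF ≤ δ * (n * C * EN) := by gcongr
        _ = δ * (n * C) * EN := by ring
        _ ≤ 1 / 2 * EN := by gcongr
        _ = EN / 2 := by ring
    rw [hE]
    rcases hEN0.lt_or_eq with h | h
    · linarith
    · -- without energy outside `F`, the function is constant
      exfalso
      have hEF0 : EF = 0 := by
        refine le_antisymm ?_ (Finset.sum_nonneg fun e _ => hnn _ _)
        rw [← h] at h5
        by_contra hpos
        push Not at hpos
        have := mul_pos hδ0 hpos
        linarith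
      have h7 := (Finset.sum_eq_zero_iff_of_nonneg fun e _ => hnn _ _).1 h.symm
      have h8 := (Finset.sum_eq_zero_iff_of_nonneg fun e _ => hnn _ _).1 hEF0
      refine hac (eq_of_forall_edge hG (fun e => ?_) a c)
      by_cases he : F e
      · have := h8 e (Finset.mem_univ e)
        rw [if_pos he] at this
        exact sub_eq_zero.1 (pow_eq_zero_iff two_ne_zero |>.1 this)
      · have := h7 e (Finset.mem_univ e)
        rw [if_pos he] at this
        exact sub_eq_zero.1 (pow_eq_zero_iff two_ne_zero |>.1 this)
  · obtain ⟨y, h1, h2, -⟩ := exists_harmonic hdet (Pi.single v (1 : ℝ))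
    rw [schur_apply hdet h1 h2]
    have hy0 : ∀ a ∈ Vo, a ≠ v → y a = 0 := fun a ha hav => by
      rw [h1 ⟨a, ha⟩, Pi.single_eq_of_ne]
      exact fun h => hav (congrArg Subtype.val h)
    have hyv : y v = 1 := by rw [h1, Pi.single_eq_same]
    have hyL := hLh y h2
    have hynn : ∀ a, 0 ≤ y a := hPD.nonneg hoff (fun a ha => by
      by_cases hav : a = v
      · rw [hav, hyv]; exact zero_le_one
      · exact (hy0 a ha hav).ge) fun a ha => (hyL a ha).ge
    have hypos : ∀ a, G.Attached Vo a v → 0 < y a := fun a ha =>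
      pos_of_reflTransGen hoff hynn (fun b hb _ => hyL b hb)
        (Relation.ReflTransGen.mono (fun _ _ h => ⟨h.1, hLneg h.2⟩) _ _ ha)
        (by rw [hyv]; exact one_pos)
    -- the solution vanishes on the inner vertices that are not attached to `v`
    have hyz : ∀ a ∉ Vo, ¬ G.Attached Vo a v → y a = 0 := by
      let y' : V → ℝ := fun a => if G.Attached Vo a v then y a else 0
      have hyy' : y' = y := by
        refine harmonic_unique hPD.det_ne_zero (fun a ha => ?_) (fun a ha => ?_) hyL
        · by_cases hav : a = v
          · exact if_pos (hav ▸ Relation.ReflTransGen.refl)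
          · simp only [y', hy0 a ha hav, ite_self]
        · by_cases hat : G.Attached Vo a v
          · have hyb : ∀ b, G.graph.Adj a b → y' b = y b := fun b hab => by
              by_cases hb : b ∈ Vo
              · by_cases hbv : b = v
                · exact if_pos (hbv ▸ Relation.ReflTransGen.refl)
                · simp only [y', hy0 b hb hbv, ite_self]
              · exact if_pos (Relation.ReflTransGen.head ⟨hb, hab.symm⟩ hat)
            have hya : y' a = y a := if_pos hat
            have := netMatrix_self_mulVec_congr (G := G) (w := 1) (w' := 1) (y := y') (y' := y)
              (r := 1) (v := a) fun e he => by
                rcases he with rfl | rfl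
                · rw [hya, hyb _ (adj_left_right e), one_mul]
                · rw [hya, hyb _ (adj_left_right e).symm, one_mul]
            rw [this, hyL a ha, mul_zero]
          · have hyb : ∀ b, G.graph.Adj a b → y' b = 0 := fun b hab =>
              if_neg fun h => hat (.head ⟨ha, hab⟩ h)
            have hya : y' a = 0 := if_neg hat
            have := netMatrix_self_mulVec_congr (G := G) (w := 1) (w' := 1) (y := y') (y' := 0)
              (r := 0) (v := a) fun e he => by
                rcases he with rfl | rfl
                · rw [hya, hyb _ (adj_left_right e)]; simp
                · rw [hya, hyb _ (adj_left_right e).symm]; simp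
            rw [this, zero_mul]
      intro a _ hat
      rw [← hyy']
      exact if_neg hat
    have hyo : y o = 0 := hy0 o o.2 hne'
    -- only the edges in `F` contribute to the flux at `o`
    have hterm : ∀ (e : G.Edge) (b : V), ((G.left e = o ∧ G.right e = b) ∨
        (G.left e = b ∧ G.right e = o)) → w e * (y o - y b) = if F e then δ * y b else 0 := by
      intro e b he
      have hob : G.graph.Adj o b := by
        rcases he with ⟨h1, h2⟩ | ⟨h1, h2⟩
        · rw [← h1, ← h2]; exact adj_left_right e
        · rw [← h1, ← h2]; exact (adj_left_right e).symm
      by_cases hF : F e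
      · rw [if_pos hF, hyo]; simp only [w, if_pos hF]; ring
      · have hyb : y b = 0 := by
          by_cases hb : b ∈ Vo
          · refine hy0 b hb fun hbv => hF ((hF_of_edge he).2 (Or.inl (by rw [hbv])))
          · exact hyz b hb fun hat => hF ((hF_of_edge he).2
              (Or.inr (Or.inr ⟨hb, attached_of_adj hb hob.symm, hat⟩)))
        rw [if_neg hF, hyo, hyb]; ring
    have hsum : ∀ e : G.Edge, w e * ((if G.left e = o then y (G.left e) - y (G.right e) else 0)
        + (if G.right e = o then y (G.right e) - y (G.left e) else 0))
        = if G.left e = o then (if F e then δ * y (G.right e) else 0)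
          else if G.right e = o then (if F e then δ * y (G.left e) else 0) else 0 := fun e => by
      by_cases hl : G.left e = o
      · have hr : G.right e ≠ o := fun hr => left_ne_right e (hl.trans hr.symm)
        rw [if_pos hl, if_pos hl, if_neg hr, add_zero, show y (G.left e) = y o by rw [hl]]
        exact hterm e _ (Or.inl ⟨hl, rfl⟩)
      · by_cases hr : G.right e = o
        · rw [if_neg hl, if_neg hl, if_pos hr, if_pos hr, zero_add, show y (G.right e) = y o by rw [hr]]
          exact hterm e _ (Or.inr ⟨rfl, hr⟩)
        · simp [hl, hr]
    rw [netMatrix_self_mulVec, Finset.sum_congr rfl fun e _ => hsum e]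
    obtain ⟨b, hob, hbv⟩ := exists_attached_of_reducedGraph_adj hov
    obtain ⟨e, he⟩ := exists_edge_of_adj hob
    have hFe : F e := by
      rw [hF_of_edge he]
      by_cases hb : b ∈ Vo
      · exact Or.inl (by rw [hbv.eq_of_mem hb])
      · exact Or.inr (Or.inr ⟨hb, attached_of_adj hb hob.symm, hbv⟩)
    refine Finset.sum_pos' (fun e _ => ?_) ⟨e, Finset.mem_univ e, ?_⟩
    · split_ifs
      · exact mul_nonneg hδ0.le (hynn _)
      · exact le_rfl
      · exact mul_nonneg hδ0.le (hynn _)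
      · exact le_rfl
      · exact le_rfl
    · have hδb := mul_pos hδ0 (hypos b hbv)
      rcases he with ⟨h3, h4⟩ | ⟨h3, h4⟩
      · rw [if_pos h3, if_pos hFe, h4]; exact hδb
      · rw [if_neg (by rw [h3]; exact hob.ne'), if_pos h4, if_pos hFe, h3]; exact hδb

theorem exists_eventuallyStronglyPositive (hG : G.graph.Connected)
    (hL : LinearIndependent ℚ G.length) (hcyc : ¬ (G.reducedGraph Vo).IsAcyclic) (lamHat : ℝ) :
    ∃ lam : ℝ, lamHat < lam ∧ (lam : ℂ) ∉ G.dirichletSpectrum Vo ∧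
      SemigroupEventuallyStronglyPositive (G.dtnMatrix Vo lam) ∧
      ¬ SemigroupPositive (G.dtnMatrix Vo lam) := by
  by_cases hthree : ∀ z ∉ Vo, ∀ a b c : Vo, G.Attached Vo z a → G.Attached Vo z b →
      G.Attached Vo z c → a = b ∨ a = c ∨ b = c
  · rw [SimpleGraph.isAcyclic_iff_forall_adj_isBridge] at hcyc
    push Not at hcyc
    obtain ⟨o, v, hov, hbr⟩ := hcyc
    exact exists_eventuallyStronglyPositive_of_not_isBridge hG hL hthree hov hbr lamHat
  · push Not at hthree
    obtain ⟨z, hz, o, u, w, ho, hu, hw, hou, how, huw⟩ := hthree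
    rcases Relation.ReflTransGen.cases_tail ho with h | ⟨a, hza, ha, hao⟩
    · exact absurd (h ▸ o.2) hz
    · have haz := Attached.symm hza ha
      exact exists_eventuallyStronglyPositive_of_three hG hL ha hao (haz.trans hu) (haz.trans hw)
        hou how huw lamHat

end QuantumGraph

theorem theorem1p3 {V : Type*} [Fintype V] [DecidableEq V] (G : QuantumGraph V)
    (hG : G.graph.Connected) (Vo : Finset V) (hVo : Vo.Nonempty) :
    (∀ lam : ℝ, (lam : EReal) < G.lambda1 Vo →
      SemigroupStronglyPositive (G.dtnMatrix Vo lam)) ∧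
    ((G.reducedGraph Vo).IsTree → ∀ lam : ℝ, (lam : ℂ) ∉ G.dirichletSpectrum Vo →
      SemigroupPositive (G.dtnMatrix Vo lam) ∨
        ¬ SemigroupEventuallyStronglyPositive (G.dtnMatrix Vo lam)) ∧
    (LinearIndependent ℚ G.length →
      (∀ lamHat : ℝ, ∃ lam : ℝ, lamHat < lam ∧ (lam : ℂ) ∉ G.dirichletSpectrum Vo ∧
        SemigroupStronglyPositive (G.dtnMatrix Vo lam)) ∧
      (2 ≤ Vo.card → ∀ lamHat : ℝ, ∃ lam : ℝ, lamHat < lam ∧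
        (lam : ℂ) ∉ G.dirichletSpectrum Vo ∧
        ¬ SemigroupEventuallyPositive (G.dtnMatrix Vo lam)) ∧
      ((∃ (v : Vo) (p : (G.reducedGraph Vo).Walk v v), p.IsCycle) →
        ∀ lamHat : ℝ, ∃ lam : ℝ, lamHat < lam ∧ (lam : ℂ) ∉ G.dirichletSpectrum Vo ∧
          SemigroupEventuallyStronglyPositive (G.dtnMatrix Vo lam) ∧
          ¬ SemigroupPositive (G.dtnMatrix Vo lam))) := by
  refine ⟨fun lam h => QuantumGraph.stronglyPositive_of_lt_lambda1 hG hVo h, fun hT lam h =>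
    QuantumGraph.positive_or_not_eventuallyStronglyPositive
      (QuantumGraph.nonResonant_of_notMem_spectrum hG hVo h) hT.isAcyclic, fun hL =>
    ⟨QuantumGraph.exists_stronglyPositive hG hVo hL,
      fun hcard => QuantumGraph.exists_not_eventuallyPositive hG hcard hL, ?_⟩⟩
  rintro ⟨v, p, hp⟩
  exact QuantumGraph.exists_eventuallyStronglyPositive hG hL fun h => h p hp
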